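/- **Setting.** Formulas are built from countably many variables and $0,1$ with $\neg,\wedge,\vee$; an annotated formula is $\varphi^L$ or $\varphi^R$; a sequent is a set of at most two annotated formulas. Given a set $A$ of sequents (axioms), a sequent is *provable from $A$* if it is derivable from the axioms in $A$ in orthologic. With $\Gamma,\Delta$ each empty or a single annotated formula, the rules of orthologic are: hypothesis ($\varphi^L,\varphi^R$); cut (from $\Gamma,\psi^R$ and $\psi^L,\Delta$ infer $\Gamma,\Delta$); weakening (from $\Gamma$ infer $\Gamma,\Delta$); $0^L$ and $1^R$; from $\Gamma,\varphi^L$ infer $\Gamma,(\varphi\wedge\psi)^L$ and $\Gamma,(\psi\wedge\varphi)^L$; from $\Gamma,\varphi^R$ and $\Gamma,\psi^R$ infer $\Gamma,(\varphi\wedge\psi)^R$; from $\Gamma,\varphi^L$ and $\Gamma,\psi^L$ infer $\Gamma,(\varphi\vee\psi)^L$; from $\Gamma,\varphi^R$ infer $\Gamma,(\varphi\vee\psi)^R$ and $\Gamma,(\psi\vee\varphi)^R$; from $\Gamma,\varphi^R$ infer $\Gamma,(\neg\varphi)^L$; from $\Gamma,\varphi^L$ infer $\Gamma,(\neg\varphi)^R$.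 A singleton sequent is $b^R$ (meaning $1\le b$) or $a^L$ (meaning $a\le 0$). An input consists of a finite axiom set $A$ and a goal sequent $S$, stored in memory as a table of nodes (each node holds a symbol and pointers to its children, which have smaller numbers; sharing of equal subformulas is allowed but not required), followed by the sequents, given by sides and pointers into the table. If there are $m$ nodes and $k$ listed axioms, the input has $n=6+3m+4k$ words. The machine is a word RAM: words of $w$ bits, and reading or writing a memory cell, addition, truncated subtraction, multiplication, comparison, loading a constant and testing a register cost one step each. **Corollary ($O(n^2)$ algorithm for singleton-sequent axioms).** 1. There are a word RAM program $P$ and a constant $C$ such that the following holds for every finite set $A$ of singleton sequents, every sequent $S$, every input of $n$ words representing $(A,S)$, and every word length $w$ such that every input word is less than $2^w$ and $C n^2\le 2^w$. Started on this input, $P$ halts after at most $C n^2$ steps, and it outputs $1$ if $S$ is provable from $A$ and $0$ if it is not. 2. Moreover, the axioms can be merged into a single one: for every finite set $A$ of singleton sequents there is a formula $b$ with at most $3s+1$ symbols, where $s$ is the total number of symbols of the axioms in $A$ (the sum, over the axioms, of the numbers of symbols of their formulas), such that the same sequents are provable from $A$ as from the single axiom $b^R$. -/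

import Mathlib

namespace OL

/-! ### Orthologic -/

/-- Formulas (terms over the signature of ortholattices), with variables indexed by `ℕ`. -/
inductive Formula : Type
  | var (k : ℕ)
  | zero
  | one
  | neg (φ : Formula)
  | and (φ ψ : Formula)
  | or (φ ψ : Formula)
  deriving DecidableEq

/-- The number of symbols of a formula, i.e. the number of nodes of its syntax tree. -/
def Formula.size : Formula → ℕ
  | .var _ => 1
  | .zero => 1
  | .one => 1
  | .neg φ => φ.size + 1
  | .and φ ψ => φ.size + ψ.size + 1
  | .or φ ψ => φ.size + ψ.size + 1

/-- The set of subformulas of a formula. -/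
def Formula.subformulas : Formula → Finset Formula
  | .var k => {.var k}
  | .zero => {.zero}
  | .one => {.one}
  | .neg φ => insert (.neg φ) φ.subformulas
  | .and φ ψ => insert (.and φ ψ) (φ.subformulas ∪ ψ.subformulas)
  | .or φ ψ => insert (.or φ ψ) (φ.subformulas ∪ ψ.subformulas)

inductive Side : Type
  | left
  | right
  deriving DecidableEq

/-- Annotated formulas `φ^L` and `φ^R`. -/
structure AFormula : Type where
  side : Side
  form : Formula
  deriving DecidableEq

/-- `φ^L` -/
def L (φ : Formula) : AFormula := ⟨.left, φ⟩

/-- `φ^R` -/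
def R (φ : Formula) : AFormula := ⟨.right, φ⟩

/-- A sequent is a set of at most two annotated formulas. -/
def Sequent : Type := {S : Finset AFormula // S.card ≤ 2}

instance : DecidableEq Sequent := inferInstanceAs (DecidableEq {S : Finset AFormula // S.card ≤ 2})

/-- The sequent `Γ, Δ` (union of sets), where each of `Γ` and `Δ` is empty or one annotated
formula. -/
def seq (Γ Δ : Option AFormula) : Sequent :=
  ⟨Γ.toFinset ∪ Δ.toFinset, by
    refine (Finset.card_union_le _ _).trans ?_
    rcases Γ with _ | a <;> rcases Δ with _ | b <;> simp⟩

/-- A singleton sequent: `b^R` (that is `1 ≤ b`) or `a^L` (that is `a ≤ 0`). -/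
def Sequent.IsSingleton (S : Sequent) : Prop := S.1.card = 1

/-- The number of symbols in a sequent. -/
def Sequent.size (S : Sequent) : ℕ := ∑ a ∈ S.1, a.form.size

/-- The set of subformulas of the formulas of a sequent. -/
def Sequent.subformulas (S : Sequent) : Finset Formula := S.1.biUnion fun a => a.form.subformulas

/-- Provability in orthologic from the set `A` of axioms. `Γ`, `Δ` are empty or one annotated
formula. The binary connectives are commutative, so `leftAnd` and `rightOr` come in two versions.
`leftZero` and `rightOne` are the rules for the constants. -/
inductive Provable (A : Set Sequent) : Sequent → Prop
  | ax {S : Sequent} : S ∈ A → Provable A S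
  | hyp (φ : Formula) : Provable A (seq (some (L φ)) (some (R φ)))
  | cut {Γ Δ : Option AFormula} (ψ : Formula) :
      Provable A (seq Γ (some (R ψ))) → Provable A (seq (some (L ψ)) Δ) → Provable A (seq Γ Δ)
  | weaken {Γ : Option AFormula} (Δ : Option AFormula) :
      Provable A (seq Γ none) → Provable A (seq Γ Δ)
  | leftZero : Provable A (seq none (some (L .zero)))
  | rightOne : Provable A (seq none (some (R .one)))
  | leftAnd₁ {Γ : Option AFormula} {φ : Formula} (ψ : Formula) :
      Provable A (seq Γ (some (L φ))) → Provable A (seq Γ (some (L (.and φ ψ))))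
  | leftAnd₂ {Γ : Option AFormula} {φ : Formula} (ψ : Formula) :
      Provable A (seq Γ (some (L φ))) → Provable A (seq Γ (some (L (.and ψ φ))))
  | rightAnd {Γ : Option AFormula} {φ ψ : Formula} :
      Provable A (seq Γ (some (R φ))) → Provable A (seq Γ (some (R ψ))) →
        Provable A (seq Γ (some (R (.and φ ψ))))
  | leftOr {Γ : Option AFormula} {φ ψ : Formula} :
      Provable A (seq Γ (some (L φ))) → Provable A (seq Γ (some (L ψ))) →
        Provable A (seq Γ (some (L (.or φ ψ))))
  | rightOr₁ {Γ : Option AFormula} {φ : Formula} (ψ : Formula) :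
      Provable A (seq Γ (some (R φ))) → Provable A (seq Γ (some (R (.or φ ψ))))
  | rightOr₂ {Γ : Option AFormula} {φ : Formula} (ψ : Formula) :
      Provable A (seq Γ (some (R φ))) → Provable A (seq Γ (some (R (.or ψ φ))))
  | leftNot {Γ : Option AFormula} {φ : Formula} :
      Provable A (seq Γ (some (R φ))) → Provable A (seq Γ (some (L (.neg φ))))
  | rightNot {Γ : Option AFormula} {φ : Formula} :
      Provable A (seq Γ (some (L φ))) → Provable A (seq Γ (some (R (.neg φ))))

/-! ### The word RAM -/

/-- A machine state: registers and a random access memory, both holding words. -/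
structure State : Type where
  reg : ℕ → ℕ
  mem : ℕ → ℕ

/-- The instructions; `d`, `a`, `b` are names of registers. -/
inductive Instr : Type
  | const (d k : ℕ)
  | add (d a b : ℕ)
  | sub (d a b : ℕ)
  | mul (d a b : ℕ)
  | lt (d a b : ℕ)
  | load (d a : ℕ)
  | store (a b : ℕ)

def State.set (s : State) (d v : ℕ) : State := { s with reg := Function.update s.reg d v }

/-- The effect of an instruction on a machine with words of `w` bits: arithmetic is modulo `2 ^ w`,
except that subtraction is cut off at `0`. -/
def Instr.exec (w : ℕ) (s : State) : Instr → State
  | .const d k => s.set d (k % 2 ^ w)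
  | .add d a b => s.set d ((s.reg a + s.reg b) % 2 ^ w)
  | .sub d a b => s.set d (s.reg a - s.reg b)
  | .mul d a b => s.set d ((s.reg a * s.reg b) % 2 ^ w)
  | .lt d a b => s.set d ((if s.reg a < s.reg b then 1 else 0) % 2 ^ w)
  | .load d a => s.set d (s.mem (s.reg a))
  | .store a b => { s with mem := Function.update s.mem (s.reg a) (s.reg b) }

/-- Word RAM programs: instructions, sequential composition, branching on whether register `r`
is nonzero, and iteration as long as register `r` is nonzero. -/
inductive Program : Type
  | instr (i : Instr)
  | seq (P Q : Program)
  | cond (r : ℕ) (P Q : Program)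
  | loop (r : ℕ) (P : Program)

/-- `Exec w P s t s'`: on words of `w` bits, `P` started in state `s` halts in state `s'` after
exactly `t` steps. Every instruction and every test of a register is one step. -/
inductive Exec (w : ℕ) : Program → State → ℕ → State → Prop
  | instr (i : Instr) (s : State) : Exec w (.instr i) s 1 (i.exec w s)
  | seq {P Q : Program} {s s' s'' : State} {t u : ℕ} :
      Exec w P s t s' → Exec w Q s' u s'' → Exec w (.seq P Q) s (t + u) s''
  | condTrue {r : ℕ} {P Q : Program} {s s' : State} {t : ℕ} :
      s.reg r ≠ 0 → Exec w P s t s' → Exec w (.cond r P Q) s (t + 1) s'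
  | condFalse {r : ℕ} {P Q : Program} {s s' : State} {t : ℕ} :
      s.reg r = 0 → Exec w Q s t s' → Exec w (.cond r P Q) s (t + 1) s'
  | loopStop {r : ℕ} {P : Program} {s : State} :
      s.reg r = 0 → Exec w (.loop r P) s 1 s
  | loopStep {r : ℕ} {P : Program} {s s' s'' : State} {t u : ℕ} :
      s.reg r ≠ 0 → Exec w P s t s' → Exec w (.loop r P) s' u s'' →
        Exec w (.loop r P) s (t + u + 1) s''

/-- Execution is deterministic. -/
theorem Exec.det {w : ℕ} {P : Program} {s s₁ s₂ : State} {t₁ t₂ : ℕ}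
    (h₁ : Exec w P s t₁ s₁) (h₂ : Exec w P s t₂ s₂) : t₁ = t₂ ∧ s₁ = s₂ := by
  induction h₁ generalizing t₂ s₂ with
  | instr i s => cases h₂; exact ⟨rfl, rfl⟩
  | seq _ _ ih ih' =>
    cases h₂ with
    | seq a b =>
      obtain ⟨rfl, rfl⟩ := ih a
      obtain ⟨rfl, rfl⟩ := ih' b
      exact ⟨rfl, rfl⟩
  | condTrue h _ ih =>
    cases h₂ with
    | condTrue _ a => obtain ⟨rfl, rfl⟩ := ih a; exact ⟨rfl, rfl⟩
    | condFalse h' _ => exact absurd h' h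
  | condFalse h _ ih =>
    cases h₂ with
    | condTrue h' _ => exact absurd h h'
    | condFalse _ a => obtain ⟨rfl, rfl⟩ := ih a; exact ⟨rfl, rfl⟩
  | loopStop h =>
    cases h₂ with
    | loopStop _ => exact ⟨rfl, rfl⟩
    | loopStep h' _ _ => exact absurd h h'
  | loopStep h _ _ ih ih' =>
    cases h₂ with
    | loopStop h' => exact absurd h' h
    | loopStep _ a b =>
      obtain ⟨rfl, rfl⟩ := ih a
      obtain ⟨rfl, rfl⟩ := ih' b
      exact ⟨rfl, rfl⟩

/-- The initial state: the input is in the first memory cells, everything else is `0`. -/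
def State.init (input : List ℕ) : State := ⟨fun _ => 0, fun i => input.getD i 0⟩

/-- On words of `w` bits and the given input, `P` halts within `T` steps, with `1` in register `0`
if `Q` holds and with `0` in register `0` otherwise. -/
def Program.Decides (P : Program) (w : ℕ) (input : List ℕ) (T : ℕ) (Q : Prop) : Prop :=
  ∃ t ≤ T, ∃ s, Exec w P (State.init input) t s ∧ (Q → s.reg 0 = 1) ∧ (¬ Q → s.reg 0 = 0)

/-! ### Inputs -/

/-- A node of a formula in memory: the symbol at its root and pointers to its children. -/
inductive Node : Type
  | var (k : ℕ)
  | zero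
  | one
  | neg (i : ℕ)
  | and (i j : ℕ)
  | or (i j : ℕ)

def Node.children : Node → List ℕ
  | .var _ => []
  | .zero => []
  | .one => []
  | .neg i => [i]
  | .and i j => [i, j]
  | .or i j => [i, j]

/-- The formula at a node, if `f` gives the formulas at its children. -/
def Node.formula (f : ℕ → Formula) : Node → Formula
  | .var k => .var k
  | .zero => .zero
  | .one => .one
  | .neg i => .neg (f i)
  | .and i j => .and (f i) (f j)
  | .or i j => .or (f i) (f j)

/-- The three words that hold a node. -/
def Node.words : Node → List ℕ
  | .var k => [0, k, 0]
  | .zero => [1, 0, 0]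
  | .one => [2, 0, 0]
  | .neg i => [3, i, 0]
  | .and i j => [4, i, j]
  | .or i j => [5, i, j]

/-- `f i` is the formula at the node with number `i`, for every node of the table; pointers go to
nodes with smaller numbers. Subformulas may be shared, but need not be. -/
def IsTable (nodes : List Node) (f : ℕ → Formula) : Prop :=
  ∀ i nd, nodes[i]? = some nd → (∀ j ∈ nd.children, j < i) ∧ f i = nd.formula f

/-- A slot of a sequent: empty, or a side with a pointer to a formula. -/
abbrev Slot : Type := Option (Side × ℕ)

def Slot.denote (f : ℕ → Formula) (x : Slot) : Option AFormula := x.map fun p => ⟨p.1, f p.2⟩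

def Slot.words : Slot → List ℕ
  | none => [0, 0]
  | some (.left, i) => [1, i]
  | some (.right, i) => [2, i]

/-- An input: a table of nodes, the goal, and the list of axioms. -/
structure Input : Type where
  nodes : List Node
  goal : Slot × Slot
  axs : List (Slot × Slot)

/-- The input as it is laid out in memory, `6 + 3 * nodes.length + 4 * axs.length` words. -/
def Input.words (I : Input) : List ℕ :=
  [I.nodes.length, I.axs.length] ++ I.nodes.flatMap Node.words ++
    (I.goal.1.words ++ I.goal.2.words) ++ I.axs.flatMap fun x => x.1.words ++ x.2.words

/-- `I` represents the axiom set `A` and the goal `S`. -/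
def Input.Represents (I : Input) (A : Finset Sequent) (S : Sequent) : Prop :=
  ∃ f : ℕ → Formula, IsTable I.nodes f ∧
    (∀ x ∈ I.goal :: I.axs, ∀ p : Side × ℕ, x.1 = some p ∨ x.2 = some p → p.2 < I.nodes.length) ∧
    S = seq (I.goal.1.denote f) (I.goal.2.denote f) ∧
    ∀ a, a ∈ A ↔ ∃ x ∈ I.axs, a = seq (x.1.denote f) (x.2.denote f)

theorem Formula.self_mem (φ : Formula) : φ ∈ φ.subformulas := by
  cases φ <;> simp [Formula.subformulas]

/-- The subformulas of a formula are closed under subformulas. -/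
theorem Formula.closed (χ : Formula) :
    (∀ φ, .neg φ ∈ χ.subformulas → φ ∈ χ.subformulas) ∧
    (∀ φ ψ, .and φ ψ ∈ χ.subformulas → φ ∈ χ.subformulas ∧ ψ ∈ χ.subformulas) ∧
    (∀ φ ψ, .or φ ψ ∈ χ.subformulas → φ ∈ χ.subformulas ∧ ψ ∈ χ.subformulas) := by
  induction χ with
  | var k => simp [Formula.subformulas]
  | zero => simp [Formula.subformulas]
  | one => simp [Formula.subformulas]
  | neg φ ih =>
    have := φ.self_mem
    simp only [Formula.subformulas, Finset.mem_insert]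
    grind
  | and φ ψ ih ih' =>
    have := φ.self_mem
    have := ψ.self_mem
    simp only [Formula.subformulas, Finset.mem_insert, Finset.mem_union]
    grind
  | or φ ψ ih ih' =>
    have := φ.self_mem
    have := ψ.self_mem
    simp only [Formula.subformulas, Finset.mem_insert, Finset.mem_union]
    grind

theorem exists_slots (F : Finset Formula) (l : List Formula) (hF : ∀ φ, φ ∈ l ↔ φ ∈ F)
    (S : Sequent) (hS : S.subformulas ⊆ F) :
    ∃ x : Slot × Slot, (∀ p : Side × ℕ, x.1 = some p ∨ x.2 = some p → p.2 < l.length) ∧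
      S = seq (x.1.denote fun i => l.getD i .zero) (x.2.denote fun i => l.getD i .zero) := by
  have key : ∀ a ∈ S.1, ∃ p : Side × ℕ, p.2 < l.length ∧ (⟨p.1, l.getD p.2 .zero⟩ : AFormula) = a := by
    intro a ha
    have : a.form ∈ l := (hF _).2 (hS (Finset.mem_biUnion.2 ⟨a, ha, a.form.self_mem⟩))
    obtain ⟨i, hi, h⟩ := List.getElem_of_mem this
    exact ⟨(a.side, i), hi, by simp [hi, h]⟩
  have hc := S.2
  rcases hn : S.1.card with _ | _ | _ | n
  · refine ⟨(none, none), by simp, Subtype.ext ?_⟩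
    rw [Finset.card_eq_zero] at hn
    simp [seq, Slot.denote, hn]
  · obtain ⟨a, ha⟩ := Finset.card_eq_one.1 hn
    obtain ⟨p, hp, h⟩ := key a (by simp [ha])
    refine ⟨(some p, none), by simp; grind, Subtype.ext ?_⟩
    simp only [seq, Slot.denote, Option.map_some, Option.map_none, h, ha]
    simp
  · obtain ⟨a, b, -, hab⟩ := Finset.card_eq_two.1 hn
    obtain ⟨p, hp, h⟩ := key a (by simp [hab])
    obtain ⟨q, hq, h'⟩ := key b (by simp [hab])
    refine ⟨(some p, some q), by simp; grind, Subtype.ext ?_⟩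
    simp only [seq, Slot.denote, Option.map_some, h, h', hab]
    ext; simp
  · omega

/-- Every finite axiom set and goal are represented by an input whose nodes are the distinct
subformulas, one node for each, and whose axioms are listed once. -/
theorem Input.exists_represents (A : Finset Sequent) (S : Sequent) :
    ∃ I : Input, I.Represents A S ∧ I.axs.length = A.card ∧
      I.nodes.length = (S.subformulas ∪ A.biUnion Sequent.subformulas).card := by
  classical
  set F := S.subformulas ∪ A.biUnion Sequent.subformulas with hFdef
  have sub : ∀ χ ∈ F, ∃ χ' : Formula, χ ∈ χ'.subformulas ∧ χ'.subformulas ⊆ F := by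
    intro χ hχ
    have aux : ∀ T : Sequent, T.subformulas ⊆ F → χ ∈ T.subformulas →
        ∃ χ' : Formula, χ ∈ χ'.subformulas ∧ χ'.subformulas ⊆ F := by
      intro T hT h
      obtain ⟨a, ha, h⟩ := Finset.mem_biUnion.1 h
      exact ⟨a.form, h, fun x hx => hT (Finset.mem_biUnion.2 ⟨a, ha, hx⟩)⟩
    rcases Finset.mem_union.1 hχ with h | h
    · exact aux S Finset.subset_union_left h
    · obtain ⟨T, hT, h⟩ := Finset.mem_biUnion.1 h
      exact aux T (fun x hx => Finset.mem_union_right _ (Finset.mem_biUnion.2 ⟨T, hT, hx⟩)) h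
  set l := F.toList.mergeSort (fun a b => decide (a.size ≤ b.size)) with hl
  have hperm : l.Perm F.toList := List.mergeSort_perm _ _
  have hmem : ∀ φ, φ ∈ l ↔ φ ∈ F := fun φ => by rw [hperm.mem_iff, Finset.mem_toList]
  have hsort : l.Pairwise fun a b => a.size ≤ b.size := by
    have := List.pairwise_mergeSort (le := fun a b : Formula => decide (a.size ≤ b.size))
      (by intro a b c; simp; omega) (by intro a b; simp; omega) F.toList
    exact this.imp (by simp)
  have hlt : ∀ i (hi : i < l.length) φ, φ ∈ l → φ.size < (l[i]).size → l.idxOf φ < i := by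
    intro i hi φ hφ hs
    by_contra hcon
    have hj : l.idxOf φ < l.length := List.idxOf_lt_length_of_mem hφ
    have e : l[l.idxOf φ] = φ := List.getElem_idxOf hj
    rcases Nat.lt_or_eq_of_le (not_lt.1 hcon) with h | h
    · have := List.pairwise_iff_getElem.1 hsort i _ hi hj h
      rw [e] at this; omega
    · have h2 : l[i] = φ := by simp only [h]; exact e
      rw [h2] at hs; omega
  have hget : ∀ φ ∈ l, l.getD (l.idxOf φ) .zero = φ := by
    intro φ hφ
    have hj : l.idxOf φ < l.length := List.idxOf_lt_length_of_mem hφ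
    rw [List.getD_eq_getElem _ _ hj]; exact List.getElem_idxOf hj
  let nd : Formula → Node := fun φ => match φ with
    | .var k => .var k
    | .zero => .zero
    | .one => .one
    | .neg φ => .neg (l.idxOf φ)
    | .and φ ψ => .and (l.idxOf φ) (l.idxOf ψ)
    | .or φ ψ => .or (l.idxOf φ) (l.idxOf ψ)
  have hT : IsTable (l.map nd) fun i => l.getD i .zero := by
    intro i x hx
    have hi : i < l.length := by
      by_contra h
      rw [List.getElem?_eq_none (by simpa using h)] at hx
      cases hx
    rw [List.getElem?_map, List.getElem?_eq_getElem hi, Option.map_some, Option.some_inj] at hx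
    subst hx
    simp only [List.getD_eq_getElem _ _ hi]
    have hin : l[i] ∈ l := List.getElem_mem hi
    obtain ⟨χ, hχ, hsub⟩ := sub _ ((hmem _).1 hin)
    obtain ⟨c1, c2, c3⟩ := χ.closed
    have hlt' := hlt i hi
    revert hin hχ hlt'
    generalize l[i] = φ
    intro hin hχ hlt'
    cases φ with
    | var k => simp [nd, Node.children, Node.formula]
    | zero => simp [nd, Node.children, Node.formula]
    | one => simp [nd, Node.children, Node.formula]
    | neg φ =>
      have h1 : φ ∈ l := (hmem _).2 (hsub (c1 _ hχ))
      refine ⟨?_, ?_⟩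
      · simp only [nd, Node.children, List.mem_singleton, forall_eq]
        exact hlt' φ h1 (by simp [Formula.size])
      · simp only [nd, Node.formula, hget φ h1]
    | and φ ψ =>
      have h1 : φ ∈ l := (hmem _).2 (hsub (c2 _ _ hχ).1)
      have h2 : ψ ∈ l := (hmem _).2 (hsub (c2 _ _ hχ).2)
      refine ⟨?_, ?_⟩
      · simp only [nd, Node.children, List.mem_cons, List.not_mem_nil, or_false]
        rintro j (rfl | rfl)
        · exact hlt' φ h1 (by simp only [Formula.size]; omega)
        · exact hlt' ψ h2 (by simp only [Formula.size]; omega)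
      · simp only [nd, Node.formula, hget φ h1, hget ψ h2]
    | or φ ψ =>
      have h1 : φ ∈ l := (hmem _).2 (hsub (c3 _ _ hχ).1)
      have h2 : ψ ∈ l := (hmem _).2 (hsub (c3 _ _ hχ).2)
      refine ⟨?_, ?_⟩
      · simp only [nd, Node.children, List.mem_cons, List.not_mem_nil, or_false]
        rintro j (rfl | rfl)
        · exact hlt' φ h1 (by simp only [Formula.size]; omega)
        · exact hlt' ψ h2 (by simp only [Formula.size]; omega)
      · simp only [nd, Node.formula, hget φ h1, hget ψ h2]
  have hA : ∀ T ∈ A, T.subformulas ⊆ F := fun T hT x hx =>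
    Finset.mem_union_right _ (Finset.mem_biUnion.2 ⟨T, hT, hx⟩)
  have ex : ∀ T : Sequent, ∃ x : Slot × Slot, T.subformulas ⊆ F →
      (∀ p : Side × ℕ, x.1 = some p ∨ x.2 = some p → p.2 < l.length) ∧
      T = seq (x.1.denote fun i => l.getD i .zero) (x.2.denote fun i => l.getD i .zero) := by
    intro T
    by_cases h : T.subformulas ⊆ F
    · obtain ⟨x, hx⟩ := exists_slots F l hmem T h
      exact ⟨x, fun _ => hx⟩
    · exact ⟨(none, none), fun h' => absurd h' h⟩
  choose g hg using ex
  refine ⟨⟨l.map nd, g S, A.toList.map g⟩, ⟨_, hT, ?_, (hg S Finset.subset_union_left).2, ?_⟩,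
    by simp, by simp [hperm.length_eq]⟩
  · simp only [List.mem_cons, List.mem_map, Finset.mem_toList, List.length_map]
    rintro x (rfl | ⟨T, hT, rfl⟩)
    · exact (hg S Finset.subset_union_left).1
    · exact (hg T (hA T hT)).1
  · intro a
    simp only [List.mem_map, Finset.mem_toList]
    constructor
    · intro h
      exact ⟨g a, ⟨a, h, rfl⟩, (hg a (hA a h)).2⟩
    · rintro ⟨x, ⟨T, hT, rfl⟩, h⟩
      rw [← (hg T (hA T hT)).2] at h
      exact h ▸ hT

end OL

namespace OL

/-! ### Orthologic: merging axioms -/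

/-! The algorithm works on pairs of codes. Every node of the table gets two codes, one for each
annotation of its formula, and so does one additional node that holds `0`; a pair of codes stands
for a sequent, and `x, x` for the singleton sequent `x`. The program derives pairs by forward
chaining. It starts from `0^L`, `1^R` and the hypotheses on variables, and it uses four kinds of
inference: symmetry; weakening (`x, x` yields `x, z` for all `z`); cut with an axiom (if `x` is the
dual of an axiom, `x, y` yields `y, y`); and the introduction rules, all of the form "from `c, y`
and `s, y` infer `z, y`". The general cut rule is absent. Every inference is sound for orthologic.

Completeness is a semantic cut elimination. The derived relation `T` is symmetric and is full at
every point related to itself, so the sets closed under double orthogonality form an ortholattice,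
in which orthologic including cut is sound (`Provable.valid`). Under a suitable valuation of the
variables, the left code of each node lies in the value of its formula and the right code in the
orthocomplement (`Saturated.mem_val`); this needs only the introduction rules. Closure under cuts
with axioms makes the axioms valid. A provable goal is then valid, and evaluating validity at its
own codes shows that the pair was derived (`Saturated.complete`).

The time is quadratic because an axiom is a singleton: a cut with it removes its formula from a pair
in constant time, with no search for a matching second sequent. With `N` codes there are `N²` pairs,
each processed once. A pair `x, y` pays for the rules with first premise `x`; there are at most `2N`
rules in all, so these payments sum to `O(N²)`. A whole row is filled only for the `N` pairs on the
diagonal. `N` is linear in the input length, and duplicate nodes for equal formulas do no harm.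

The program is written in a small imperative language whose compilation to the word RAM is verified
with time bounds; loops are paid for by a potential.

For the merging of axioms, `a^L` is interderivable with `(¬a)^R`, and `(φ ∧ ψ)^R` with the two
sequents `φ^R` and `ψ^R`. The conjunction of all asserted formulas therefore replaces the axioms. -/

theorem Provable.of_axioms {A B : Set Sequent} (h : ∀ S ∈ A, Provable B S) {S : Sequent}
    (hS : Provable A S) : Provable B S := by
  induction hS with
  | ax h' => exact h _ h'
  | hyp φ => exact .hyp φ
  | cut ψ _ _ ih ih' => exact .cut ψ ih ih'
  | weaken Δ _ ih => exact .weaken Δ ih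
  | leftZero => exact .leftZero
  | rightOne => exact .rightOne
  | leftAnd₁ ψ _ ih => exact .leftAnd₁ ψ ih
  | leftAnd₂ ψ _ ih => exact .leftAnd₂ ψ ih
  | rightAnd _ _ ih ih' => exact .rightAnd ih ih'
  | leftOr _ _ ih ih' => exact .leftOr ih ih'
  | rightOr₁ ψ _ ih => exact .rightOr₁ ψ ih
  | rightOr₂ ψ _ ih => exact .rightOr₂ ψ ih
  | leftNot _ ih => exact .leftNot ih
  | rightNot _ ih => exact .rightNot ih

theorem seq_comm (Γ Δ : Option AFormula) : seq Γ Δ = seq Δ Γ :=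
  Subtype.ext (Finset.union_comm _ _)

theorem seq_self (Γ : Option AFormula) : seq Γ Γ = seq none Γ :=
  Subtype.ext (by simp [seq])

theorem Sequent.IsSingleton.exists_eq {S : Sequent} (h : S.IsSingleton) :
    ∃ a : AFormula, S = seq none (some a) := by
  obtain ⟨a, ha⟩ := Finset.card_eq_one.1 h
  exact ⟨a, Subtype.ext (by simp [seq, ha])⟩

theorem Formula.size_pos (φ : Formula) : 1 ≤ φ.size := by
  cases φ <;> simp [Formula.size]

/-- The formula that is asserted by a singleton sequent. -/
def AFormula.asserted : AFormula → Formula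
  | ⟨.left, φ⟩ => .neg φ
  | ⟨.right, φ⟩ => φ

theorem AFormula.size_asserted_le (a : AFormula) : a.asserted.size ≤ a.form.size + 1 := by
  rcases a with ⟨_ | _, φ⟩ <;> simp [AFormula.asserted, Formula.size]

/-- On the left side the way back is a cut of `(¬φ)^R` against `(¬φ)^L, φ^L`, which follows from the
hypothesis rule. -/
theorem provable_asserted_iff (A : Set Sequent) (a : AFormula) :
    Provable A (seq none (some (R a.asserted))) ↔ Provable A (seq none (some a)) := by
  rcases a with ⟨_ | _, φ⟩
  · refine ⟨fun h => ?_, fun h => .rightNot h⟩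
    have h2 : Provable A (seq (some (L φ)) (some (L (.neg φ)))) := .leftNot (.hyp φ)
    rw [seq_comm] at h2
    exact .cut _ h h2
  · exact Iff.rfl

theorem provable_and_iff (A : Set Sequent) (φ ψ : Formula) :
    Provable A (seq none (some (R (.and φ ψ)))) ↔
      Provable A (seq none (some (R φ))) ∧ Provable A (seq none (some (R ψ))) := by
  refine ⟨fun h => ⟨.cut _ h ?_, .cut _ h ?_⟩, fun h => .rightAnd h.1 h.2⟩
  · rw [seq_comm]
    refine .leftAnd₁ ψ ?_
    rw [seq_comm]
    exact .hyp φ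
  · rw [seq_comm]
    refine .leftAnd₂ φ ?_
    rw [seq_comm]
    exact .hyp ψ

/-- Conjoining the asserted formulas one at a time onto `1`. An axiom costs its own symbols plus at
most a negation and a conjunction sign, so at most three times its size; the final `1` accounts for
the summand `1`. Quantifying over `B` lets both inclusions of the merging be instances. -/
theorem exists_single_axiom (A : Finset Sequent) (hA : ∀ a ∈ A, a.IsSingleton) :
    ∃ b : Formula, b.size ≤ 3 * ∑ a ∈ A, a.size + 1 ∧
      ∀ B : Set Sequent, Provable B (seq none (some (R b))) ↔ ∀ S ∈ A, Provable B S := by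
  induction A using Finset.induction_on with
  | empty => exact ⟨.one, by simp [Formula.size], fun B => by simp [Provable.rightOne]⟩
  | insert S A hS ih =>
    obtain ⟨b, hb, h⟩ := ih fun a ha => hA a (Finset.mem_insert_of_mem ha)
    obtain ⟨a, rfl⟩ := (hA S (Finset.mem_insert_self _ _)).exists_eq
    refine ⟨.and a.asserted b, ?_, fun B => ?_⟩
    · rw [Finset.sum_insert hS]
      have h1 := a.size_asserted_le
      have h2 := a.form.size_pos
      have h3 : (seq none (some a)).size = a.form.size := by simp [Sequent.size, seq]
      simp only [Formula.size]
      omega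
    · rw [provable_and_iff, provable_asserted_iff, h]
      simp

theorem exists_merged_axiom (A : Finset Sequent) (hA : ∀ a ∈ A, a.IsSingleton) :
    ∃ b : Formula, b.size ≤ 3 * ∑ a ∈ A, a.size + 1 ∧
      ∀ S : Sequent, Provable (A : Set Sequent) S ↔ Provable {seq none (some (R b))} S := by
  obtain ⟨b, hb, h⟩ := exists_single_axiom A hA
  refine ⟨b, hb, fun S => ⟨Provable.of_axioms ?_, Provable.of_axioms ?_⟩⟩
  -- Here `B` is the merged axiom alone; in the other direction it is `A`.
  · exact (h _).1 (.ax rfl)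
  · rintro _ rfl
    exact (h _).2 fun S hS => .ax hS

/-! ### Completeness of saturated relations -/

/-- The points that are related to all points of `X`. -/
def perp (T : ℕ → ℕ → Prop) (X : Set ℕ) : Set ℕ := {y | ∀ x ∈ X, T x y}

theorem perp_anti {T : ℕ → ℕ → Prop} {X Y : Set ℕ} (h : X ⊆ Y) : perp T Y ⊆ perp T X :=
  fun _ hy x hx => hy x (h hx)

/-- A symmetric relation that is full at every point related to itself. Its closed sets form an
ortholattice. -/
structure IsOrthoframe (T : ℕ → ℕ → Prop) : Prop where
  symm : ∀ {x y}, T x y → T y x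
  full : ∀ {x}, T x x → ∀ y, T x y

theorem IsOrthoframe.subset_perp_perp {T : ℕ → ℕ → Prop} (hT : IsOrthoframe T) (X : Set ℕ) :
    X ⊆ perp T (perp T X) :=
  fun _ hx _ hy => hT.symm (hy _ hx)

/-- The value of a formula in the ortholattice of closed sets. -/
def Formula.val (T : ℕ → ℕ → Prop) (V : ℕ → Set ℕ) : Formula → Set ℕ
  | .var k => perp T (V k)
  | .zero => perp T Set.univ
  | .one => Set.univ
  | .neg φ => perp T (φ.val T V)
  | .and φ ψ => φ.val T V ∩ ψ.val T V
  | .or φ ψ => perp T (perp T (φ.val T V) ∩ perp T (ψ.val T V))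

/-- Apart from `1` and conjunctions every value is a `perp` by definition, and three `perp`s reduce
to one; intersections of closed sets are closed. -/
theorem Formula.perp_perp_val {T : ℕ → ℕ → Prop} (hT : IsOrthoframe T) (V : ℕ → Set ℕ)
    (φ : Formula) : perp T (perp T (φ.val T V)) ⊆ φ.val T V := by
  have triple : ∀ X, perp T (perp T (perp T X)) ⊆ perp T X := fun X =>
    perp_anti (hT.subset_perp_perp X)
  induction φ with
  | one => exact Set.subset_univ _
  | and φ ψ ih ih' =>
    exact Set.subset_inter ((perp_anti (perp_anti Set.inter_subset_left)).trans ih)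
      ((perp_anti (perp_anti Set.inter_subset_right)).trans ih')
  | _ => exact triple _

/-! ### Soundness of orthologic in the ortholattice of closed sets -/

def AFormula.val (T : ℕ → ℕ → Prop) (V : ℕ → Set ℕ) : AFormula → Set ℕ
  | ⟨.left, φ⟩ => φ.val T V
  | ⟨.right, φ⟩ => perp T (φ.val T V)

/-- An empty slot is the whole space, so a singleton sequent is valid exactly if all points of its
value are related to everything. -/
def slotVal (T : ℕ → ℕ → Prop) (V : ℕ → Set ℕ) : Option AFormula → Set ℕ
  | none => Set.univ
  | some a => a.val T V

/-- Validity of a sequent in the ortholattice of closed sets. -/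
def Sequent.Valid (T : ℕ → ℕ → Prop) (V : ℕ → Set ℕ) (S : Sequent) : Prop :=
  ∀ p q, (∀ a ∈ S.1, p ∈ a.val T V ∨ q ∈ a.val T V) → T p q

/-- `Sequent.Valid` refers to the set and so cannot depend on how it is split into two slots. If one
point lies in both values, it is related to itself, and `full` supplies the rest. -/
theorem valid_seq_iff {T : ℕ → ℕ → Prop} (hT : IsOrthoframe T) (V : ℕ → Set ℕ)
    (Γ Δ : Option AFormula) :
    (seq Γ Δ).Valid T V ↔ ∀ p ∈ slotVal T V Γ, ∀ q ∈ slotVal T V Δ, T p q := by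
  constructor
  · intro h p hp q hq
    refine h p q fun a ha => ?_
    simp only [seq, Finset.mem_union, Option.mem_toFinset, Option.mem_def] at ha
    rcases ha with rfl | rfl
    · exact .inl hp
    · exact .inr hq
  · intro h p q hpq
    have key : ∀ Θ : Option AFormula, (∀ a, Θ = some a → a ∈ (seq Γ Δ).1) →
        p ∈ slotVal T V Θ ∨ q ∈ slotVal T V Θ := by
      rintro (_ | a) ha
      · exact .inl trivial
      · exact hpq a (ha a rfl)
    have h1 := key Γ (by rintro a rfl; simp [seq])
    have h2 := key Δ (by rintro a rfl; simp [seq])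
    rcases h1 with h1 | h1 <;> rcases h2 with h2 | h2
    · exact hT.full (h p h1 p h2) q
    · exact h p h1 q h2
    · exact hT.symm (h q h1 p h2)
    · exact hT.symm (hT.full (h q h1 q h2) p)

/-- A rule becomes a statement about orthogonality. Closedness of values, `dbl`, is what cut,
`rightAnd` and `rightNot` need; for cut, the first premise puts `p` into the double orthocomplement
of the cut formula. -/
theorem Provable.valid {T : ℕ → ℕ → Prop} (hT : IsOrthoframe T) (V : ℕ → Set ℕ)
    {A : Set Sequent} (hA : ∀ S ∈ A, S.Valid T V) {S : Sequent} (hS : Provable A S) :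
    S.Valid T V := by
  have sub := fun φ : Formula => hT.subset_perp_perp (φ.val T V)
  have dbl := fun φ : Formula => φ.perp_perp_val hT V
  induction hS with
  | ax h => exact hA _ h
  | hyp φ =>
    rw [valid_seq_iff hT]
    exact fun p hp q hq => hq p hp
  | cut ψ _ _ ih ih' =>
    rw [valid_seq_iff hT] at ih ih' ⊢
    intro p hp q hq
    have h1 : p ∈ ψ.val T V := dbl ψ fun x hx => hT.symm (ih p hp x hx)
    exact ih' p h1 q hq
  | weaken Δ _ ih =>
    rw [valid_seq_iff hT] at ih ⊢
    exact fun p hp q _ => ih p hp q trivial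
  | leftZero =>
    rw [valid_seq_iff hT]
    exact fun p _ q hq => hq p trivial
  | rightOne =>
    rw [valid_seq_iff hT]
    exact fun p _ q hq => hq p trivial
  | leftAnd₁ ψ _ ih =>
    rw [valid_seq_iff hT] at ih ⊢
    exact fun p hp q hq => ih p hp q hq.1
  | leftAnd₂ ψ _ ih =>
    rw [valid_seq_iff hT] at ih ⊢
    exact fun p hp q hq => ih p hp q hq.2
  | @rightAnd _ φ ψ _ _ ih ih' =>
    rw [valid_seq_iff hT] at ih ih' ⊢
    intro p hp q hq
    exact hq p ⟨dbl φ fun x hx => hT.symm (ih p hp x hx),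
      dbl ψ fun x hx => hT.symm (ih' p hp x hx)⟩
  | leftOr _ _ ih ih' =>
    rw [valid_seq_iff hT] at ih ih' ⊢
    intro p hp q hq
    exact hq p ⟨fun x hx => hT.symm (ih p hp x hx), fun x hx => hT.symm (ih' p hp x hx)⟩
  | rightOr₁ ψ _ ih =>
    rw [valid_seq_iff hT] at ih ⊢
    intro p hp q hq
    refine ih p hp q fun x hx => hq x ?_
    exact fun y hy => hT.symm (hy.1 x hx)
  | rightOr₂ ψ _ ih =>
    rw [valid_seq_iff hT] at ih ⊢
    intro p hp q hq
    refine ih p hp q fun x hx => hq x ?_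
    exact fun y hy => hT.symm (hy.2 x hx)
  | leftNot _ ih =>
    rw [valid_seq_iff hT] at ih ⊢
    exact ih
  | @rightNot _ φ _ ih =>
    rw [valid_seq_iff hT] at ih ⊢
    exact fun p hp q hq => ih p hp q (dbl φ hq)

/-- The number of an annotated formula, given the number of the formula. -/
def code : Side × ℕ → ℕ
  | (.left, i) => 2 * i
  | (.right, i) => 2 * i + 1

def Side.dual : Side → Side
  | .left => .right
  | .right => .left

/-- `T` is closed under the rules of orthologic that introduce the formulas `g i` with `i ≤ m`. -/
structure Saturated (g : ℕ → Formula) (m : ℕ) (T : ℕ → ℕ → Prop) : Prop extends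
    IsOrthoframe T where
  var : ∀ i ≤ m, ∀ j ≤ m, ∀ k, g i = .var k → g j = .var k → T (2 * i) (2 * j + 1)
  zero : ∀ i ≤ m, g i = .zero → T (2 * i) (2 * i)
  one : ∀ i ≤ m, g i = .one → T (2 * i + 1) (2 * i + 1)
  neg : ∀ i ≤ m, ∀ φ, g i = .neg φ → ∃ a ≤ m, g a = φ ∧
    ∀ y, (T (2 * a + 1) y → T (2 * i) y) ∧ (T (2 * a) y → T (2 * i + 1) y)
  and : ∀ i ≤ m, ∀ φ ψ, g i = .and φ ψ → ∃ a ≤ m, ∃ b ≤ m, g a = φ ∧ g b = ψ ∧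
    ∀ y, (T (2 * a) y → T (2 * i) y) ∧ (T (2 * b) y → T (2 * i) y) ∧
      (T (2 * a + 1) y → T (2 * b + 1) y → T (2 * i + 1) y)
  or : ∀ i ≤ m, ∀ φ ψ, g i = .or φ ψ → ∃ a ≤ m, ∃ b ≤ m, g a = φ ∧ g b = ψ ∧
    ∀ y, (T (2 * a + 1) y → T (2 * i + 1) y) ∧ (T (2 * b + 1) y → T (2 * i + 1) y) ∧
      (T (2 * a) y → T (2 * b) y → T (2 * i) y)

/-- The valuation under which every `g i` is sandwiched between its two annotations. -/
def varSet (g : ℕ → Formula) (m k : ℕ) : Set ℕ := {u | ∃ j ≤ m, g j = .var k ∧ u = 2 * j + 1}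

/-- The heart of completeness. Hypotheses are needed for variables only: `var k` is valued as the
orthocomplement of its right codes, which the left codes belong to by `Saturated.var`. For a
connective, relations to the codes of the parts are carried to `i` by the introduction rules. -/
theorem Saturated.mem_val {g : ℕ → Formula} {m : ℕ} {T : ℕ → ℕ → Prop} (h : Saturated g m T)
    (φ : Formula) : ∀ i ≤ m, g i = φ →
      2 * i ∈ φ.val T (varSet g m) ∧ 2 * i + 1 ∈ perp T (φ.val T (varSet g m)) := by
  induction φ with
  | var k =>
    intro i hi hg
    refine ⟨?_, h.subset_perp_perp _ ⟨i, hi, hg, rfl⟩⟩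
    rintro _ ⟨j, hj, hg', rfl⟩
    exact h.symm (h.var i hi j hj k hg hg')
  | zero =>
    intro i hi hg
    exact ⟨fun x _ => h.symm (h.full (h.zero i hi hg) x), h.subset_perp_perp _ trivial⟩
  | one =>
    intro i hi hg
    exact ⟨trivial, fun x _ => h.symm (h.full (h.one i hi hg) x)⟩
  | neg φ ih =>
    intro i hi hg
    obtain ⟨a, ha, hga, hr⟩ := h.neg i hi φ hg
    obtain ⟨h1, h2⟩ := ih a ha hga
    exact ⟨fun x hx => h.symm ((hr x).1 (h.symm (h2 x hx))),
      fun x hx => h.symm ((hr x).2 (hx _ h1))⟩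
  | and φ ψ ih ih' =>
    intro i hi hg
    obtain ⟨a, ha, b, hb, hga, hgb, hr⟩ := h.and i hi φ ψ hg
    obtain ⟨h1, h2⟩ := ih a ha hga
    obtain ⟨h3, h4⟩ := ih' b hb hgb
    -- A point orthogonal to the value of `φ` is related to the left code of `a`, hence by the left
    -- rule to that of `i`; closedness then puts the latter into the value.
    refine ⟨⟨φ.perp_perp_val h.toIsOrthoframe _ fun x hx => ?_,
      ψ.perp_perp_val h.toIsOrthoframe _ fun x hx => ?_⟩, fun x hx => ?_⟩
    · exact h.symm ((hr x).1 (hx _ h1))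
    · exact h.symm ((hr x).2.1 (hx _ h3))
    · exact h.symm ((hr x).2.2 (h.symm (h2 x hx.1)) (h.symm (h4 x hx.2)))
  | or φ ψ ih ih' =>
    intro i hi hg
    obtain ⟨a, ha, b, hb, hga, hgb, hr⟩ := h.or i hi φ ψ hg
    obtain ⟨h1, h2⟩ := ih a ha hga
    obtain ⟨h3, h4⟩ := ih' b hb hgb
    refine ⟨fun x hx => ?_, h.subset_perp_perp _ ⟨fun x hx => ?_, fun x hx => ?_⟩⟩
    · exact h.symm ((hr x).2.2 (hx.1 _ h1) (hx.2 _ h3))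
    · exact h.symm ((hr x).1 (h.symm (h2 x hx)))
    · exact h.symm ((hr x).2.1 (h.symm (h4 x hx)))

theorem Saturated.code_mem_val {g : ℕ → Formula} {m : ℕ} {T : ℕ → ℕ → Prop}
    (h : Saturated g m T) (c : Side) {i : ℕ} (hi : i ≤ m) :
    code (c, i) ∈ AFormula.val T (varSet g m) ⟨c, g i⟩ := by
  cases c
  · exact (h.mem_val _ i hi rfl).1
  · exact (h.mem_val _ i hi rfl).2

/-- Every provable sequent belongs to a relation that is closed under the rules. -/
theorem Saturated.complete {g : ℕ → Formula} {m : ℕ} {T : ℕ → ℕ → Prop} (h : Saturated g m T)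
    {A : Set Sequent}
    (hA : ∀ S ∈ A, ∃ c, ∃ i ≤ m, S = seq none (some ⟨c, g i⟩) ∧
      ∀ y, T (code (c.dual, i)) y → T y y)
    {c d : Side} {i j : ℕ} (hi : i ≤ m) (hj : j ≤ m)
    (hp : Provable A (seq (some ⟨c, g i⟩) (some ⟨d, g j⟩))) : T (code (c, i)) (code (d, j)) := by
  refine (valid_seq_iff h.toIsOrthoframe _ _ _).1 (hp.valid h.toIsOrthoframe (varSet g m) ?_) _
    (h.code_mem_val c hi) _ (h.code_mem_val d hj)
  intro S hS
  obtain ⟨c, i, hi, rfl, hr⟩ := hA S hS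
  rw [valid_seq_iff h.toIsOrthoframe]
  intro p _ q hq
  -- A point `q` of the axiom's value is related to the dual code, so the cut with the axiom gives
  -- `T q q`.
  refine h.symm (h.full (hr q ?_) p)
  have h1 := h.code_mem_val c.dual hi
  cases c
  · exact h.symm (h1 q hq)
  · exact hq _ h1

end OL

namespace OL

/-! ### A small imperative language on top of the word RAM -/

/-- Variables and arrays. -/
structure Env : Type where
  V : ℕ → ℕ
  A : ℕ → ℕ → ℕ

/-- Expressions; `get k e` reads the array `k` and `inp e` reads the input. -/
inductive Ex : Type
  | var (v : ℕ)
  | num (k : ℕ)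
  | add (a b : Ex)
  | sub (a b : Ex)
  | mul (a b : Ex)
  | lt (a b : Ex)
  | get (k : ℕ) (e : Ex)
  | inp (e : Ex)

/-- The data of a run: word length, start of the arrays, and input. -/
structure Setup : Type where
  w : ℕ
  base : ℕ
  inp : ℕ → ℕ
  one_lt : 1 < 2 ^ w

/-- Values are unbounded natural numbers; `Ex.Ok` guarantees that the machine, computing modulo `2 ^
w`, obtains the same ones. -/
def Ex.eval (u : Setup) (σ : Env) : Ex → ℕ
  | .var v => σ.V v
  | .num k => k
  | .add a b => a.eval u σ + b.eval u σ
  | .sub a b => a.eval u σ - b.eval u σ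
  | .mul a b => a.eval u σ * b.eval u σ
  | .lt a b => if a.eval u σ < b.eval u σ then 1 else 0
  | .get k e => σ.A k (e.eval u σ)
  | .inp e => u.inp (e.eval u σ)

/-- There are 16 interleaved arrays behind the input. -/
def Setup.addr (u : Setup) (k i : ℕ) : ℕ := u.base + 16 * i + k

/-- The index `i` is addressable in every array. -/
def Setup.Fits (u : Setup) (i : ℕ) : Prop := u.base + 16 * i + 16 < 2 ^ u.w

/-- The evaluation of the expression does not overflow. -/
def Ex.Ok (u : Setup) (σ : Env) : Ex → Prop
  | .var _ => True
  | .num k => k < 2 ^ u.w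
  | .add a b => a.Ok u σ ∧ b.Ok u σ ∧ a.eval u σ + b.eval u σ < 2 ^ u.w
  | .sub a b => a.Ok u σ ∧ b.Ok u σ
  | .mul a b => a.Ok u σ ∧ b.Ok u σ ∧ a.eval u σ * b.eval u σ < 2 ^ u.w
  | .lt a b => a.Ok u σ ∧ b.Ok u σ
  | .get k e => e.Ok u σ ∧ k < 16 ∧ u.Fits (e.eval u σ)
  | .inp e => e.Ok u σ ∧ e.eval u σ < u.base

/-- The machine state `s` implements `σ`: the base is in register `1`, the variables are in the
other registers of even number. -/
structure Sim (u : Setup) (s : State) (σ : Env) : Prop where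
  base : s.reg 1 = u.base
  var : ∀ v, s.reg (2 * v + 2) = σ.V v
  inp : ∀ a < u.base, s.mem a = u.inp a
  arr : ∀ k < 16, ∀ i, s.mem (u.addr k i) = σ.A k i

/-- `P` run from `s` halts within `T` steps in a state satisfying `Q`. -/
def Halts (w : ℕ) (P : Program) (s : State) (T : ℕ) (Q : State → Prop) : Prop :=
  ∃ t ≤ T, ∃ s', Exec w P s t s' ∧ Q s'

theorem Halts.instr {w : ℕ} {i : Instr} {s : State} {Q : State → Prop} (h : Q (i.exec w s)) :
    Halts w (.instr i) s 1 Q :=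
  ⟨1, le_rfl, _, .instr i s, h⟩

theorem Halts.seq {w : ℕ} {P P' : Program} {s : State} {T T' : ℕ} {Q : State → Prop}
    (h : Halts w P s T fun s' => Halts w P' s' T' Q) : Halts w (.seq P P') s (T + T') Q := by
  obtain ⟨t, ht, s', e, t', ht', s'', e', hq⟩ := h
  exact ⟨t + t', by omega, s'', .seq e e', hq⟩

theorem Halts.imp {w : ℕ} {P : Program} {s : State} {T T' : ℕ} {Q Q' : State → Prop}
    (h : Halts w P s T Q) (hT : T ≤ T') (hQ : ∀ s', Q s' → Q' s') : Halts w P s T' Q' := by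
  obtain ⟨t, ht, s', e, hq⟩ := h
  exact ⟨t, by omega, s', e, hQ _ hq⟩

/-- The register for intermediate results at depth `d`. -/
abbrev tmp (d : ℕ) : ℕ := 2 * d + 3

/-- Code that puts the value of the expression into the register `tmp d`. -/
def Ex.compile : Ex → ℕ → Program
  -- There is no move instruction. Subtracting zero copies a register without reduction modulo `2 ^
  -- w`.
  | .var v, d => .seq (.instr (.const (tmp d) 0)) (.instr (.sub (tmp d) (2 * v + 2) (tmp d)))
  | .num k, d => .instr (.const (tmp d) k)
  | .add a b, d => .seq (a.compile d) (.seq (b.compile (d + 1))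
      (.instr (.add (tmp d) (tmp d) (tmp (d + 1)))))
  | .sub a b, d => .seq (a.compile d) (.seq (b.compile (d + 1))
      (.instr (.sub (tmp d) (tmp d) (tmp (d + 1)))))
  | .mul a b, d => .seq (a.compile d) (.seq (b.compile (d + 1))
      (.instr (.mul (tmp d) (tmp d) (tmp (d + 1)))))
  | .lt a b, d => .seq (a.compile d) (.seq (b.compile (d + 1))
      (.instr (.lt (tmp d) (tmp d) (tmp (d + 1)))))
  | .get k e, d => .seq (e.compile d) (.seq (.instr (.const (tmp (d + 1)) 16))
      (.seq (.instr (.mul (tmp d) (tmp d) (tmp (d + 1)))) (.seq (.instr (.const (tmp (d + 1)) k))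
      (.seq (.instr (.add (tmp d) (tmp d) (tmp (d + 1)))) (.seq (.instr (.add (tmp d) (tmp d) 1))
      (.instr (.load (tmp d) (tmp d))))))))
  | .inp e, d => .seq (e.compile d) (.instr (.load (tmp d) (tmp d)))

/-- A bound on the time for the evaluation. -/
def Ex.cost : Ex → ℕ
  | .var _ => 2
  | .num _ => 1
  | .add a b => a.cost + (b.cost + 1)
  | .sub a b => a.cost + (b.cost + 1)
  | .mul a b => a.cost + (b.cost + 1)
  | .lt a b => a.cost + (b.cost + 1)
  | .get _ e => e.cost + (1 + (1 + (1 + (1 + (1 + 1)))))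
  | .inp e => e.cost + 1

/-! ### Correctness of compiled expressions -/

theorem Sim.set_tmp {u : Setup} {s : State} {σ : Env} (h : Sim u s σ) (d x : ℕ) :
    Sim u (s.set (tmp d) x) σ where
  base := by simp [State.set, Function.update, h.base, tmp]
  var v := by
    have : 2 * v + 2 ≠ 2 * d + 3 := by omega
    rw [← h.var]
    exact Function.update_of_ne this _ _
  inp := h.inp
  arr := h.arr

@[simp] theorem State.set_reg_self (s : State) (d x : ℕ) : (s.set d x).reg d = x := by
  simp [State.set]

theorem State.set_reg_of_ne (s : State) {d e : ℕ} (x : ℕ) (h : e ≠ d) :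
    (s.set d x).reg e = s.reg e := by
  simp [State.set, h]

/-- The state after the evaluation of an expression at depth `d`. -/
structure Evaluated (u : Setup) (σ : Env) (d : ℕ) (s : State) (x : ℕ) (s' : State) : Prop where
  sim : Sim u s' σ
  val : s'.reg (tmp d) = x
  old : ∀ c < d, s'.reg (tmp c) = s.reg (tmp c)

theorem Evaluated.set {u : Setup} {σ : Env} {d : ℕ} {s s' : State} {x : ℕ}
    (h : Evaluated u σ d s x s') (y : ℕ) : Evaluated u σ d s y (s'.set (tmp d) y) where
  sim := h.sim.set_tmp d y
  val := by simp
  old c hc := by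
    rw [State.set_reg_of_ne _ _ (by simp only [tmp]; omega), h.old c hc]

theorem Evaluated.set_succ {u : Setup} {σ : Env} {d : ℕ} {s s' : State} {x : ℕ}
    (h : Evaluated u σ d s x s') (y : ℕ) : Evaluated u σ d s x (s'.set (tmp (d + 1)) y) where
  sim := h.sim.set_tmp _ y
  val := by rw [State.set_reg_of_ne _ _ (by simp only [tmp]; omega), h.val]
  old c hc := by
    rw [State.set_reg_of_ne _ _ (by simp only [tmp]; omega), h.old c hc]

theorem Evaluated.next {u : Setup} {σ : Env} {d : ℕ} {s s' s'' : State} {x y : ℕ}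
    (h : Evaluated u σ d s x s') (h' : Evaluated u σ (d + 1) s' y s'') :
    Evaluated u σ d s x s'' where
  sim := h'.sim
  val := by rw [h'.old d (by omega), h.val]
  old c hc := by rw [h'.old c (by omega), h.old c hc]

/-- Induction for all depths at once: the second operand is evaluated one level deeper and leaves
the first, in `tmp d`, untouched. `binary` serves the four binary operations. -/
theorem Ex.halts (u : Setup) (σ : Env) (e : Ex) : ∀ (d : ℕ) (s : State), Sim u s σ →
    e.Ok u σ → Halts u.w (e.compile d) s e.cost (Evaluated u σ d s (e.eval u σ)) := by
  have binary : ∀ (a b : Ex) (i : ℕ → Instr) (f : ℕ → ℕ → ℕ),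
      (∀ d s, Sim u s σ → a.Ok u σ →
        Halts u.w (a.compile d) s a.cost (Evaluated u σ d s (a.eval u σ))) →
      (∀ d s, Sim u s σ → b.Ok u σ →
        Halts u.w (b.compile d) s b.cost (Evaluated u σ d s (b.eval u σ))) →
      a.Ok u σ → b.Ok u σ →
      (∀ d s, s.reg (tmp d) = a.eval u σ → s.reg (tmp (d + 1)) = b.eval u σ →
        (i d).exec u.w s = s.set (tmp d) (f (a.eval u σ) (b.eval u σ))) →
      ∀ d s, Sim u s σ → Halts u.w (.seq (a.compile d) (.seq (b.compile (d + 1)) (.instr (i d)))) s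
        (a.cost + (b.cost + 1)) (Evaluated u σ d s (f (a.eval u σ) (b.eval u σ))) := by
    intro a b i f iha ihb ha hb hi d s hs
    refine .seq ((iha d s hs ha).imp le_rfl fun s1 h1 => .seq ?_)
    refine (ihb (d + 1) s1 h1.sim hb).imp le_rfl fun s2 h2 => .instr ?_
    have h3 := h1.next h2
    rw [hi d s2 h3.val h2.val]
    exact h3.set _
  have start : ∀ (d : ℕ) (s : State) (x : ℕ), Sim u s σ →
      Evaluated u σ d s x (s.set (tmp d) x) := fun d s x h =>
    ⟨h.set_tmp _ _, by simp, fun c hc =>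
      State.set_reg_of_ne _ _ (by simp only [tmp]; omega)⟩
  induction e with
  | var v =>
    intro d s hs _
    refine .seq (.instr (.instr ?_))
    have h1 : Evaluated u σ d s 0 (s.set (tmp d) 0) := start d s 0 hs
    have h2 := h1.set (σ.V v)
    simpa [Instr.exec, h1.sim.var, Ex.eval] using h2
  | num k =>
    intro d s hs hk
    refine .instr ?_
    have hk' : k % 2 ^ u.w = k := Nat.mod_eq_of_lt hk
    simpa only [Instr.exec, hk', Ex.eval] using start d s k hs
  | add a b iha ihb =>
    intro d s hs h
    refine binary a b (fun d => .add (tmp d) (tmp d) (tmp (d + 1))) (· + ·) iha ihb h.1 h.2.1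
      (fun d s h1 h2 => ?_) d s hs
    simp only [Instr.exec, h1, h2, Nat.mod_eq_of_lt h.2.2]
  | sub a b iha ihb =>
    intro d s hs h
    refine binary a b (fun d => .sub (tmp d) (tmp d) (tmp (d + 1))) (· - ·) iha ihb h.1 h.2
      (fun d s h1 h2 => ?_) d s hs
    simp only [Instr.exec, h1, h2]
  | mul a b iha ihb =>
    intro d s hs h
    refine binary a b (fun d => .mul (tmp d) (tmp d) (tmp (d + 1))) (· * ·) iha ihb h.1 h.2.1
      (fun d s h1 h2 => ?_) d s hs
    simp only [Instr.exec, h1, h2, Nat.mod_eq_of_lt h.2.2]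
  | lt a b iha ihb =>
    intro d s hs h
    refine binary a b (fun d => .lt (tmp d) (tmp d) (tmp (d + 1))) (fun x y => if x < y then 1 else 0)
      iha ihb h.1 h.2 (fun d s h1 h2 => ?_) d s hs
    -- The machine reduces even truth values modulo `2 ^ w`, which is harmless as `1 < 2 ^ w`.
    have : (if a.eval u σ < b.eval u σ then 1 else 0) % 2 ^ u.w =
        if a.eval u σ < b.eval u σ then 1 else 0 :=
      Nat.mod_eq_of_lt (by have := u.one_lt; split <;> omega)
    simp only [Instr.exec, h1, h2, this]
  | inp e ih =>
    intro d s hs h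
    refine .seq ((ih d s hs h.1).imp le_rfl fun s1 h1 => .instr ?_)
    have := h1.set (u.inp (e.eval u σ))
    simpa only [Instr.exec, h1.val, h1.sim.inp _ h.2, Ex.eval] using this
  | get k e ih =>
    intro d s hs h
    obtain ⟨h0, hk, hf⟩ := h
    -- The address is assembled as `16 * e`, then `+ k`, then `+ base`; `hf` bounds all three
    -- stages.
    unfold Setup.Fits at hf
    refine .seq ((ih d s hs h0).imp le_rfl fun s1 h1 => .seq (.instr ?_))
    have h2 := h1.set_succ 16
    have e2 : (Instr.const (tmp (d + 1)) 16).exec u.w s1 = s1.set (tmp (d + 1)) 16 := by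
      simp only [Instr.exec, Nat.mod_eq_of_lt (show 16 < 2 ^ u.w by omega)]
    rw [e2]
    refine .seq (.instr ?_)
    have h3 := h2.set (16 * e.eval u σ)
    have e3 : (Instr.mul (tmp d) (tmp d) (tmp (d + 1))).exec u.w (s1.set (tmp (d + 1)) 16) =
        (s1.set (tmp (d + 1)) 16).set (tmp d) (16 * e.eval u σ) := by
      simp only [Instr.exec, h2.val, State.set_reg_self, mul_comm _ 16,
        Nat.mod_eq_of_lt (show 16 * e.eval u σ < 2 ^ u.w by omega)]
    rw [e3]
    generalize (s1.set (tmp (d + 1)) 16).set (tmp d) (16 * e.eval u σ) = s3 at h3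
    refine .seq (.instr ?_)
    have h4 := h3.set_succ k
    have e4 : (Instr.const (tmp (d + 1)) k).exec u.w s3 = s3.set (tmp (d + 1)) k := by
      simp only [Instr.exec, Nat.mod_eq_of_lt (show k < 2 ^ u.w by omega)]
    rw [e4]
    refine .seq (.instr ?_)
    have h5 := h4.set (16 * e.eval u σ + k)
    have e5 : (Instr.add (tmp d) (tmp d) (tmp (d + 1))).exec u.w (s3.set (tmp (d + 1)) k) =
        (s3.set (tmp (d + 1)) k).set (tmp d) (16 * e.eval u σ + k) := by
      simp only [Instr.exec, h4.val, State.set_reg_self,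
        Nat.mod_eq_of_lt (show 16 * e.eval u σ + k < 2 ^ u.w by omega)]
    rw [e5]
    generalize (s3.set (tmp (d + 1)) k).set (tmp d) (16 * e.eval u σ + k) = s5 at h5
    refine .seq (.instr ?_)
    have h6 := h5.set (u.addr k (e.eval u σ))
    have e6 : (Instr.add (tmp d) (tmp d) 1).exec u.w s5 =
        s5.set (tmp d) (u.addr k (e.eval u σ)) := by
      simp only [Instr.exec, h5.val, h5.sim.base, Setup.addr,
        Nat.mod_eq_of_lt (show 16 * e.eval u σ + k + u.base < 2 ^ u.w by omega)]
      congr 1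
      omega
    rw [e6]
    generalize s5.set (tmp d) (u.addr k (e.eval u σ)) = s6 at h6
    refine .instr ?_
    have := h6.set (σ.A k (e.eval u σ))
    simpa only [Instr.exec, h6.val, h6.sim.arr k hk, Ex.eval] using this

/-! #### Commands -/

/-- Commands: assignment, assignment to an array cell, composition, branching, iteration. -/
inductive Cmd : Type
  | skip
  | set (v : ℕ) (e : Ex)
  | put (k : ℕ) (i e : Ex)
  | seq (c d : Cmd)
  | ite (e : Ex) (c d : Cmd)
  | while (e : Ex) (c : Cmd)

def Cmd.compile : Cmd → Program
  -- Doing nothing still takes an instruction; it overwrites a scratch register.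
  | .skip => .instr (.const (tmp 0) 0)
  | .set v e => .seq (e.compile 0) (.seq (.instr (.const (tmp 1) 0))
      (.instr (.sub (2 * v + 2) (tmp 0) (tmp 1))))
  | .put k i e => .seq (i.compile 0) (.seq (.instr (.const (tmp 1) 16))
      (.seq (.instr (.mul (tmp 0) (tmp 0) (tmp 1))) (.seq (.instr (.const (tmp 1) k))
      (.seq (.instr (.add (tmp 0) (tmp 0) (tmp 1))) (.seq (.instr (.add (tmp 0) (tmp 0) 1))
      (.seq (e.compile 1) (.instr (.store (tmp 0) (tmp 1)))))))))
  | .seq c d => .seq c.compile d.compile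
  | .ite e c d => .seq (e.compile 0) (.cond (tmp 0) c.compile d.compile)
  -- The machine loops on a register, so the guard is evaluated before the loop and again at the end
  -- of each round.
  | .while e c => .seq (e.compile 0) (.loop (tmp 0) (.seq c.compile (e.compile 0)))

/-- The command `c` run from `σ` halts within `T` machine steps in an environment satisfying
`Q`. -/
def Cmd.Run (u : Setup) (c : Cmd) (σ : Env) (T : ℕ) (Q : Env → Prop) : Prop :=
  ∀ s, Sim u s σ → Halts u.w c.compile s T fun s' => ∃ σ', Sim u s' σ' ∧ Q σ'

def Env.setV (σ : Env) (v x : ℕ) : Env := { σ with V := Function.update σ.V v x }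

def Env.setA (σ : Env) (k i x : ℕ) : Env :=
  { σ with A := Function.update σ.A k (Function.update (σ.A k) i x) }

/-! ### Rules for running commands within time bounds -/

namespace Cmd

variable {u : Setup} {σ : Env} {T T' : ℕ} {Q Q' : Env → Prop}

theorem Run.imp {c : Cmd} (h : c.Run u σ T Q) (hT : T ≤ T') (hQ : ∀ σ', Q σ' → Q' σ') :
    c.Run u σ T' Q' := fun s hs =>
  (h s hs).imp hT fun _ ⟨σ', h1, h2⟩ => ⟨σ', h1, hQ _ h2⟩

theorem Run.skip (h : Q σ) : Cmd.skip.Run u σ 1 Q := fun _ hs =>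
  .instr ⟨σ, hs.set_tmp _ _, h⟩

theorem Run.seq {c d : Cmd} (h : c.Run u σ T fun σ' => d.Run u σ' T' Q) :
    (Cmd.seq c d).Run u σ (T + T') Q := fun s hs =>
  .seq ((h s hs).imp le_rfl fun s' ⟨_, h1, h2⟩ => h2 s' h1)

theorem Run.set {v : ℕ} {e : Ex} (he : e.Ok u σ) (h : Q (σ.setV v (e.eval u σ))) :
    (Cmd.set v e).Run u σ (e.cost + 2) Q := by
  intro s hs
  refine .seq ((e.halts u σ 0 s hs he).imp le_rfl fun s1 h1 => .seq (.instr (.instr ?_)))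
  have h2 := h1.set_succ 0
  have e2 : (Instr.const (tmp (0 + 1)) 0).exec u.w s1 = s1.set (tmp (0 + 1)) 0 := by
    simp [Instr.exec]
  rw [e2]
  refine ⟨_, ?_, h⟩
  have e3 : (Instr.sub (2 * v + 2) (tmp 0) (tmp (0 + 1))).exec u.w (s1.set (tmp (0 + 1)) 0) =
      (s1.set (tmp (0 + 1)) 0).set (2 * v + 2) (e.eval u σ) := by
    simp [Instr.exec, h2.val]
  rw [e3]
  generalize s1.set (tmp (0 + 1)) 0 = s2 at h2
  refine ⟨?_, fun x => ?_, h2.sim.inp, h2.sim.arr⟩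
  · rw [State.set_reg_of_ne _ _ (by omega), h2.sim.base]
  · by_cases hx : x = v
    · subst hx; simp [Env.setV]
    · rw [State.set_reg_of_ne _ _ (by omega), h2.sim.var]
      simp [Env.setV, hx]

theorem Run.put {k : ℕ} {i e : Ex} (hi : i.Ok u σ) (he : e.Ok u σ) (hk : k < 16)
    (hf : u.Fits (i.eval u σ)) (h : Q (σ.setA k (i.eval u σ) (e.eval u σ))) :
    (Cmd.put k i e).Run u σ (i.cost + e.cost + 6) Q := by
  intro s hs
  unfold Setup.Fits at hf
  refine Halts.imp (T := i.cost + (1 + (1 + (1 + (1 + (1 + (e.cost + 1))))))) ?_ (by omega)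
    fun _ h => h
  refine .seq ((i.halts u σ 0 s hs hi).imp le_rfl fun s1 h1 => .seq (.instr ?_))
  have h2 := h1.set_succ 16
  have e2 : (Instr.const (tmp (0 + 1)) 16).exec u.w s1 = s1.set (tmp (0 + 1)) 16 := by
    simp only [Instr.exec, Nat.mod_eq_of_lt (show 16 < 2 ^ u.w by omega)]
  rw [e2]
  refine .seq (.instr ?_)
  have h3 := h2.set (16 * i.eval u σ)
  have e3 : (Instr.mul (tmp 0) (tmp 0) (tmp (0 + 1))).exec u.w (s1.set (tmp (0 + 1)) 16) =
      (s1.set (tmp (0 + 1)) 16).set (tmp 0) (16 * i.eval u σ) := by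
    simp only [Instr.exec, h2.val, State.set_reg_self, mul_comm _ 16,
      Nat.mod_eq_of_lt (show 16 * i.eval u σ < 2 ^ u.w by omega)]
  rw [e3]
  generalize (s1.set (tmp (0 + 1)) 16).set (tmp 0) (16 * i.eval u σ) = s3 at h3
  refine .seq (.instr ?_)
  have h4 := h3.set_succ k
  have e4 : (Instr.const (tmp (0 + 1)) k).exec u.w s3 = s3.set (tmp (0 + 1)) k := by
    simp only [Instr.exec, Nat.mod_eq_of_lt (show k < 2 ^ u.w by omega)]
  rw [e4]
  refine .seq (.instr ?_)
  have h5 := h4.set (16 * i.eval u σ + k)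
  have e5 : (Instr.add (tmp 0) (tmp 0) (tmp (0 + 1))).exec u.w (s3.set (tmp (0 + 1)) k) =
      (s3.set (tmp (0 + 1)) k).set (tmp 0) (16 * i.eval u σ + k) := by
    simp only [Instr.exec, h4.val, State.set_reg_self,
      Nat.mod_eq_of_lt (show 16 * i.eval u σ + k < 2 ^ u.w by omega)]
  rw [e5]
  generalize (s3.set (tmp (0 + 1)) k).set (tmp 0) (16 * i.eval u σ + k) = s5 at h5
  refine .seq (.instr ?_)
  have h6 := h5.set (u.addr k (i.eval u σ))
  have e6 : (Instr.add (tmp 0) (tmp 0) 1).exec u.w s5 =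
      s5.set (tmp 0) (u.addr k (i.eval u σ)) := by
    simp only [Instr.exec, h5.val, h5.sim.base, Setup.addr,
      Nat.mod_eq_of_lt (show 16 * i.eval u σ + k + u.base < 2 ^ u.w by omega)]
    congr 1
    omega
  rw [e6]
  generalize s5.set (tmp 0) (u.addr k (i.eval u σ)) = s6 at h6
  -- Evaluation at depth `1` preserves the address waiting in `tmp 0`.
  refine .seq ((e.halts u σ 1 s6 h6.sim he).imp le_rfl fun s7 h7 => .instr ?_)
  refine ⟨_, ?_, h⟩
  have v0 : s7.reg (tmp 0) = u.addr k (i.eval u σ) := by rw [h7.old 0 (by omega), h6.val]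
  have v1 := h7.val
  refine ⟨h7.sim.base, h7.sim.var, fun a ha => ?_, fun l hl j => ?_⟩
  · have : a ≠ u.addr k (i.eval u σ) := by simp only [Setup.addr]; omega
    simp [Instr.exec, v0, this, h7.sim.inp a ha]
  · by_cases hc : l = k ∧ j = i.eval u σ
    · obtain ⟨rfl, rfl⟩ := hc
      simp [Instr.exec, v0, v1, Env.setA]
    -- As `k` and `l` are below `16`, an address determines both array and index.
    · have : u.addr l j ≠ u.addr k (i.eval u σ) := by simp only [Setup.addr]; omega
      simp only [Instr.exec, v0, ne_eq, this, not_false_eq_true, Function.update_of_ne,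
        h7.sim.arr l hl, Env.setA]
      by_cases hl : l = k
      · subst hl
        have hj : j ≠ i.eval u σ := fun h => hc ⟨rfl, h⟩
        simp [hj]
      · simp [hl]

theorem Run.ite {e : Ex} {c d : Cmd} (he : e.Ok u σ) (h1 : e.eval u σ ≠ 0 → c.Run u σ T Q)
    (h2 : e.eval u σ = 0 → d.Run u σ T Q) : (Cmd.ite e c d).Run u σ (e.cost + T + 1) Q := by
  intro s hs
  refine Halts.imp (T := e.cost + (T + 1)) (.seq ((e.halts u σ 0 s hs he).imp le_rfl
    fun s1 h3 => ?_)) (by omega) fun _ h => h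
  by_cases hz : e.eval u σ = 0
  · obtain ⟨t, ht, s', he, hq⟩ := h2 hz s1 h3.sim
    exact ⟨t + 1, by omega, s', .condFalse (h3.val.trans hz) he, hq⟩
  · obtain ⟨t, ht, s', he, hq⟩ := h1 hz s1 h3.sim
    exact ⟨t + 1, by omega, s', .condTrue (h3.val ▸ hz) he, hq⟩

/-- Iteration with an invariant and a potential that pays for the running time. -/
theorem Run.while {e : Ex} {c : Cmd} (I : Env → ℕ → Prop) {n : ℕ} (hI : I σ n)
    (he : ∀ σ n, I σ n → e.Ok u σ) (hQ : ∀ σ n, I σ n → e.eval u σ = 0 → Q σ)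
    (hc : ∀ σ n, I σ n → e.eval u σ ≠ 0 → ∃ T,
      c.Run u σ T fun σ' => ∃ n', I σ' n' ∧ n' + T + e.cost + 1 ≤ n) :
    (Cmd.while e c).Run u σ (n + e.cost + 1) Q := by
  intro s hs
  refine Halts.imp (T := e.cost + (n + 1)) (.seq ((e.halts u σ 0 s hs (he σ n hI)).imp le_rfl
    fun s1 h1 => ?_)) (by omega) fun _ h => h
  replace h1 := And.intro h1.sim h1.val
  clear hs
  -- Each round pays from the potential for its body, the renewed guard and the test of the
  -- register, so the potential strictly decreases.
  induction n using Nat.strong_induction_on generalizing σ s1 with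
  | _ n ih =>
    by_cases hz : e.eval u σ = 0
    · exact ⟨1, by omega, s1, .loopStop (h1.2.trans hz), σ, h1.1, hQ σ n hI hz⟩
    · obtain ⟨T, hr⟩ := hc σ n hI hz
      obtain ⟨t, ht, s2, x2, σ', sim2, n', hI', hn⟩ := hr s1 h1.1
      obtain ⟨t', ht', s3, x3, h3⟩ := e.halts u σ' 0 s2 sim2 (he σ' n' hI')
      obtain ⟨t'', ht'', s4, x4, h4⟩ := ih n' (by omega) hI' s3 ⟨h3.sim, h3.val⟩
      exact ⟨t + t' + t'' + 1, by omega, s4, .loopStep (h1.2 ▸ hz) (.seq x2 x3) x4, h4⟩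

end Cmd

end OL

namespace OL

@[simp] theorem Env.setV_V (σ : Env) (v x : ℕ) : (σ.setV v x).V = Function.update σ.V v x := rfl
@[simp] theorem Env.setV_A (σ : Env) (v x : ℕ) : (σ.setV v x).A = σ.A := rfl
@[simp] theorem Env.setA_V (σ : Env) (k i x : ℕ) : (σ.setA k i x).V = σ.V := rfl
@[simp] theorem Env.setA_A (σ : Env) (k i x : ℕ) :
    (σ.setA k i x).A = Function.update σ.A k (Function.update (σ.A k) i x) := rfl

/-! ### Rules in linked lists

The rule `(c, s, z)` stands for: from `c, y` and `s, y` infer `z, y`. The newest rule comes first;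
the number of a rule is the number of older rules. Array `1` holds `s`, array `2` holds `z`, array
`4` holds for every `c` the start of the list of its rules, array `5` the links. -/

abbrev Rule : Type := ℕ × ℕ × ℕ

/-- The number of the newest rule for `x`, plus one, or `0` if there is none. -/
def top (x : ℕ) : List Rule → ℕ
  | [] => 0
  | r :: l => if r.1 = x then l.length + 1 else top x l

/-- The list is its own allocator: a rule sits at the index that counts the older ones, and cells
from the length onwards are unconstrained. -/
def Chain (A : ℕ → ℕ → ℕ) : List Rule → Prop
  | [] => True
  | r :: l => A 1 l.length = r.2.1 ∧ A 2 l.length = r.2.2 ∧ A 5 l.length = top r.1 l ∧ Chain A l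

structure Links (A : ℕ → ℕ → ℕ) (l : List Rule) : Prop where
  chain : Chain A l
  head : ∀ x, A 4 x = top x l

theorem top_eq_zero {x : ℕ} {l : List Rule} (h : top x l = 0) : ∀ r ∈ l, r.1 ≠ x := by
  induction l with
  | nil => simp
  | cons r l ih =>
    by_cases hr : r.1 = x
    · simp [top, hr] at h
    · simp only [top, hr, if_false] at h
      simpa [hr] using ih h

/-- Following a link skips precisely the newer rules with other first premises. -/
theorem exists_of_top_eq_succ {x p : ℕ} {l : List Rule} (h : top x l = p + 1) :
    ∃ pre r l', l = pre ++ r :: l' ∧ r.1 = x ∧ p = l'.length ∧ ∀ r' ∈ pre, r'.1 ≠ x := by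
  induction l with
  | nil => simp [top] at h
  | cons r l ih =>
    by_cases hr : r.1 = x
    · simp only [top, hr, if_true] at h
      exact ⟨[], r, l, rfl, hr, by omega, by simp⟩
    · simp only [top, hr, if_false] at h
      obtain ⟨pre, r', l', rfl, h1, h2, h3⟩ := ih h
      exact ⟨r :: pre, r', l', rfl, h1, h2, by simpa [hr] using h3⟩

theorem Chain.of_append {A : ℕ → ℕ → ℕ} {pre l : List Rule} (h : Chain A (pre ++ l)) :
    Chain A l := by
  induction pre with
  | nil => exact h
  | cons r pre ih => exact ih h.2.2.2

theorem Chain.congr {A B : ℕ → ℕ → ℕ} {l : List Rule} (h : Chain A l)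
    (hB : ∀ k, k = 1 ∨ k = 2 ∨ k = 5 → ∀ i < l.length, B k i = A k i) : Chain B l := by
  induction l with
  | nil => trivial
  | cons r l ih =>
    obtain ⟨h1, h2, h3, h4⟩ := h
    have e := fun k hk => hB k hk l.length (by simp)
    refine ⟨by rw [e 1 (by simp), h1], by rw [e 2 (by simp), h2], by rw [e 5 (by simp), h3],
      ih h4 fun k hk i hi => hB k hk i (by simp; omega)⟩

theorem Links.congr {A B : ℕ → ℕ → ℕ} {l : List Rule} (h : Links A l)
    (hB : ∀ k, k = 1 ∨ k = 2 ∨ k = 4 ∨ k = 5 → B k = A k) : Links B l :=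
  ⟨h.chain.congr fun k hk i _ => by rw [hB k (by tauto)], fun x => by
    rw [hB 4 (by simp), h.head]⟩

/-- The expression has the value `x`, whatever the arrays hold. -/
def Ex.Pure (u : Setup) (σ : Env) (e : Ex) (x : ℕ) : Prop :=
  ∀ A, e.Ok u ⟨σ.V, A⟩ ∧ e.eval u ⟨σ.V, A⟩ = x

theorem Ex.Pure.ok {u : Setup} {σ : Env} {e : Ex} {x : ℕ} (h : e.Pure u σ x) : e.Ok u σ :=
  (h σ.A).1

theorem Ex.Pure.eval {u : Setup} {σ : Env} {e : Ex} {x : ℕ} (h : e.Pure u σ x) :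
    e.eval u σ = x :=
  (h σ.A).2

theorem Ex.Pure.setA {u : Setup} {σ : Env} {e : Ex} {x : ℕ} (h : e.Pure u σ x) (k i y : ℕ) :
    e.Pure u (σ.setA k i y) x :=
  fun A => h A

theorem Setup.Fits.mono {u : Setup} {i j : ℕ} (h : u.Fits j) (hij : i ≤ j) : u.Fits i := by
  unfold Setup.Fits at *
  omega

theorem Setup.Fits.lt {u : Setup} {i : ℕ} (h : u.Fits i) : i + 16 < 2 ^ u.w := by
  unfold Setup.Fits at h
  omega

/-- Adds a rule; the variable `21` counts the rules. -/
def addRule (c s z : Ex) : Cmd :=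
  -- The old head goes into array `5` before array `4` is overwritten.
  .seq (.put 1 (.var 21) s) (.seq (.put 2 (.var 21) z) (.seq (.put 5 (.var 21) (.get 4 c))
    (.seq (.put 4 c (.add (.var 21) (.num 1))) (.set 21 (.add (.var 21) (.num 1))))))

/-- The cells written at index `l.length` are fresh, so `Chain.congr` preserves the older rules. The
arguments must be `Ex.Pure` because stores take place between their evaluations. -/
theorem Links.addRule {u : Setup} {σ : Env} {l : List Rule} (h : Links σ.A l)
    (hl : σ.V 21 = l.length) {c s z : Ex} {x y t : ℕ} (hc : c.Pure u σ x) (hs : s.Pure u σ y)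
    (hz : z.Pure u σ t) (hx : u.Fits x) (hf : u.Fits (l.length + 1))
    (cost : c.cost ≤ 20 ∧ s.cost ≤ 20 ∧ z.cost ≤ 20) :
    (addRule c s z).Run u σ 200 fun σ' => Links σ'.A ((x, y, t) :: l) ∧
      σ'.V 21 = l.length + 1 ∧ (∀ v, v ≠ 21 → σ'.V v = σ.V v) ∧ σ'.A 3 = σ.A 3 ∧ σ'.A 6 = σ.A 6 := by
  have hf' := hf.mono (Nat.le_succ l.length)
  have hlt := hf.lt
  refine Cmd.Run.imp (.seq <| .put trivial hs.ok (by simp) (by simpa [Ex.eval, hl]) <| .seq <|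
    .put trivial (hz.setA _ _ _).ok (by simp) (by simpa [Ex.eval, hl]) <| .seq <|
    .put trivial ?_ (by simp) (by simpa [Ex.eval, hl]) <| .seq <|
    .put (((hc.setA _ _ _).setA _ _ _).setA _ _ _).ok ?_ (by simp) ?_ <|
    .set ?_ ?_) ?_ fun _ h => h
  · refine ⟨((hc.setA _ _ _).setA _ _ _).ok, by simp, ?_⟩
    rwa [((hc.setA _ _ _).setA _ _ _).eval]
  · simp only [Ex.Ok, Ex.eval, Env.setA_V, hl, true_and]
    omega
  · rwa [(((hc.setA _ _ _).setA _ _ _).setA _ _ _).eval]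
  · simp only [Ex.Ok, Ex.eval, Env.setA_V, hl, true_and]
    omega
  · have e1 : s.eval u σ = y := hs.eval
    have e2 := (hz.setA 1 l.length y).eval
    have e3 := ((hc.setA 1 l.length y).setA 2 l.length t).eval
    have e4 := fun r => (((hc.setA 1 l.length y).setA 2 l.length t).setA 5 l.length r).eval
    simp only [Ex.eval, Env.setA_V, hl, e1, e2, e3, e4]
    refine ⟨⟨⟨?_, ?_, ?_, ?_⟩, ?_⟩, by simp, fun v hv => by simp [hv], by simp, by simp⟩
    · simp
    · simp
    · simp [h.head]
    · refine h.chain.congr ?_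
      rintro k (rfl | rfl | rfl) i hi <;> simp [hi.ne]
    · intro x'
      by_cases hx' : x = x'
      · subst hx'; simp [top]
      · have : x' ≠ x := fun h => hx' h.symm
        simp [top, hx', this, h.head]
  · simp only [Ex.cost]
    omega

/-! ### The queue

Array `6` marks the pairs that have been derived, arrays `7` and `8` hold them in the order of their
derivation, and variable `20` counts them. -/

/-- Appends `p` unless it is present. -/
def ins (q : List (ℕ × ℕ)) (p : ℕ × ℕ) : List (ℕ × ℕ) := if p ∈ q then q else q ++ [p]

theorem mem_ins {q : List (ℕ × ℕ)} {p p' : ℕ × ℕ} : p' ∈ ins q p ↔ p' ∈ q ∨ p' = p := by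
  unfold ins
  split
  · constructor
    · exact .inl
    · rintro (h | rfl) <;> assumption
  · simp

theorem prefix_ins (q : List (ℕ × ℕ)) (p : ℕ × ℕ) : q <+: ins q p := by
  unfold ins
  split
  · exact List.prefix_rfl
  · exact List.prefix_append _ _

structure Queue (N : ℕ) (A : ℕ → ℕ → ℕ) (q : List (ℕ × ℕ)) : Prop where
  fst : ∀ i (h : i < q.length), A 7 i = q[i].1
  snd : ∀ i (h : i < q.length), A 8 i = q[i].2
  mark : ∀ x < N, ∀ y < N, A 6 (x * N + y) = if (x, y) ∈ q then 1 else 0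
  nodup : q.Nodup
  lt : ∀ p ∈ q, p.1 < N ∧ p.2 < N

/-- This bound keeps the positions in the queue addressable, whatever has been derived. -/
theorem Queue.length_le {N : ℕ} {A : ℕ → ℕ → ℕ} {q : List (ℕ × ℕ)} (h : Queue N A q) :
    q.length ≤ N * N := by
  rw [← List.toFinset_card_of_nodup h.nodup]
  have : q.toFinset ⊆ Finset.range N ×ˢ Finset.range N := by
    intro p hp
    simpa using h.lt p (by simpa using hp)
  simpa using Finset.card_le_card this

theorem pair_inj {N x y x' y' : ℕ} (hy : y < N) (hy' : y' < N) (h : x * N + y = x' * N + y') :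
    x = x' ∧ y = y' := by
  have hN : 0 < N := by omega
  have h1 : (x * N + y) / N = x := by
    rw [mul_comm, Nat.mul_add_div hN, Nat.div_eq_of_lt hy, add_zero]
  have h2 : (x' * N + y') / N = x' := by
    rw [mul_comm, Nat.mul_add_div hN, Nat.div_eq_of_lt hy', add_zero]
  have : x = x' := by rw [← h1, ← h2, h]
  subst this
  exact ⟨rfl, by omega⟩

theorem pair_lt {N x y : ℕ} (hx : x < N) (hy : y < N) : x * N + y < N * N := by
  have : (x + 1) * N ≤ N * N := Nat.mul_le_mul_right N hx
  rw [add_mul, one_mul] at this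
  omega

/-- The pair number of two expressions; variable `2` holds the number of codes. -/
def pairEx (a b : Ex) : Ex := .add (.mul a (.var 2)) b

/-- The lookup before the append is what keeps the queue free of repetitions. -/
def mark (a b : Ex) : Cmd :=
  .ite (.get 6 (pairEx a b)) .skip (.seq (.put 6 (pairEx a b) (.num 1))
    (.seq (.put 7 (.var 20) a) (.seq (.put 8 (.var 20) b)
      (.set 20 (.add (.var 20) (.num 1))))))

theorem Ex.Pure.pairEx {u : Setup} {σ : Env} {a b : Ex} {x y N : ℕ} (ha : a.Pure u σ x)
    (hb : b.Pure u σ y) (hN : σ.V 2 = N) (hx : x < N) (hy : y < N) (hf : u.Fits (N * N)) :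
    (pairEx a b).Pure u σ (x * N + y) := by
  intro A
  have := pair_lt hx hy
  have := hf.lt
  have := Nat.le_add_right (x * N) y
  simp only [OL.pairEx, Ex.Ok, Ex.eval, (ha A).2, (hb A).2, hN, (ha A).1, (hb A).1, true_and,
    and_true]
  omega

theorem Queue.mark_run {u : Setup} {σ : Env} {N : ℕ} {q : List (ℕ × ℕ)} (h : Queue N σ.A q)
    (hN : σ.V 2 = N) (ht : σ.V 20 = q.length) (hf : u.Fits (N * N)) {a b : Ex} {x y : ℕ}
    (ha : a.Pure u σ x) (hb : b.Pure u σ y) (hx : x < N) (hy : y < N)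
    (cost : a.cost ≤ 20 ∧ b.cost ≤ 20) :
    (OL.mark a b).Run u σ 200 fun σ' => Queue N σ'.A (ins q (x, y)) ∧
      σ'.V 20 = (ins q (x, y)).length ∧ (∀ v, v ≠ 20 → σ'.V v = σ.V v) ∧
      ∀ k, k ≠ 6 → k ≠ 7 → k ≠ 8 → σ'.A k = σ.A k := by
  have hp := ha.pairEx hb hN hx hy hf
  have hlt := pair_lt hx hy
  have hlen := h.length_le
  have hw := hf.lt
  refine Cmd.Run.imp (T := _) (.ite (T := 140) ⟨hp.ok, by simp, ?_⟩ (fun hne => ?_) fun he => ?_)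
    ?_ fun _ h => h
  · rw [hp.eval]
    exact hf.mono hlt.le
  · have hm : (x, y) ∈ q := by
      by_contra hm
      simp [Ex.eval, hp.eval, h.mark x hx y hy, hm] at hne
    have : ins q (x, y) = q := by simp [ins, hm]
    rw [this]
    exact (Cmd.Run.skip ⟨h, ht, fun _ _ => rfl, fun _ _ _ _ => rfl⟩).imp (by simp) fun _ h => h
  · have hm : (x, y) ∉ q := by
      intro hm
      simp [Ex.eval, hp.eval, h.mark x hx y hy, hm] at he
    have hi : ins q (x, y) = q ++ [(x, y)] := by simp [ins, hm]
    rw [hi]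
    have e1 := hp.eval
    refine Cmd.Run.imp (.seq <| .put hp.ok ?_ (by simp) ?_ <| .seq <|
      .put trivial (ha.setA _ _ _).ok (by simp) ?_ <| .seq <|
      .put trivial ((hb.setA _ _ _).setA _ _ _).ok (by simp) ?_ <| .set ?_ ?_) ?_ fun _ h => h
    · have := u.one_lt
      simpa [Ex.Ok] using this
    · rw [e1]
      exact hf.mono hlt.le
    · simp only [Ex.eval, Env.setA_V, ht]
      exact hf.mono hlen
    · simp only [Ex.eval, Env.setA_V, ht]
      exact hf.mono hlen
    · simp only [Ex.Ok, Ex.eval, Env.setA_V, ht, true_and]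
      omega
    · have e2 := (ha.setA 6 (x * N + y) 1).eval
      have e3 := ((hb.setA 6 (x * N + y) 1).setA 7 q.length x).eval
      simp only [Ex.eval, Env.setA_V, ht, e1, e2, e3]
      refine ⟨⟨?_, ?_, ?_, ?_, ?_⟩, by simp, fun v hv => by simp [hv],
        fun k h6 h7 h8 => by simp [h6, h7, h8]⟩
      · intro i hi
        rcases Nat.lt_or_ge i q.length with hi' | hi'
        · simp [hi'.ne, h.fst i hi', List.getElem_append_left hi']
        · have : i = q.length := by simp at hi; omega
          subst this
          simp
      · intro i hi
        rcases Nat.lt_or_ge i q.length with hi' | hi'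
        · simp [hi'.ne, h.snd i hi', List.getElem_append_left hi']
        · have : i = q.length := by simp at hi; omega
          subst this
          simp
      · intro x' hx' y' hy'
        by_cases hc : x' * N + y' = x * N + y
        · obtain ⟨rfl, rfl⟩ := pair_inj hy' hy hc
          simp
        · have hne : (x', y') ≠ (x, y) := by
            rintro hxy
            simp only [Prod.mk.injEq] at hxy
            exact hc (by rw [hxy.1, hxy.2])
          simp [hc, h.mark x' hx' y' hy', hne]
      · simp only [List.nodup_append, h.nodup, List.nodup_singleton, true_and]
        rintro p hp p' hp' rfl
        simp only [List.mem_singleton] at hp'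
        exact hm (hp' ▸ hp)
      · intro p hp
        rcases List.mem_append.1 hp with hp | hp
        · exact h.lt p hp
        · simp only [List.mem_singleton] at hp
          subst hp
          exact ⟨hx, hy⟩
    · simp only [Ex.cost, OL.pairEx]
      omega
  · simp only [Ex.cost, OL.pairEx]
    omega

end OL

namespace OL

/-! ### The saturation loop -/

/-- A set of codes below `N` with rules, the codes `x` for which `x, y` yields `y, y`, and a
relation that is closed under all inferences. -/
structure Calc : Type where
  N : ℕ
  rules : List Rule
  ax : ℕ → Prop
  P : ℕ → ℕ → Prop
  two_le : 2 ≤ N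
  -- Linearly many rules against `N` contexts `y` make a quadratic number of instances.
  length_le : rules.length ≤ 2 * N
  lt : ∀ r ∈ rules, r.2.1 < N ∧ r.2.2 < N
  -- A rule is stored under each of its premises, so whichever of the two pairs is processed last
  -- triggers it.
  swap : ∀ r ∈ rules, (r.2.1, r.1, r.2.2) ∈ rules
  symm : ∀ {x y}, P x y → P y x
  full : ∀ {x}, P x x → ∀ y, P x y
  ax_rule : ∀ {x y}, ax x → P x y → P y y
  rule : ∀ r ∈ rules, ∀ y, P r.1 y → P r.2.1 y → P r.2.2 y

/-- All consequences of the pairs in `D` are in `q`. -/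
structure Calc.Closed (G : Calc) (D q : List (ℕ × ℕ)) : Prop where
  symm : ∀ x y, (x, y) ∈ D → (y, x) ∈ q
  full : ∀ x, (x, x) ∈ D → ∀ z < G.N, (x, z) ∈ q
  ax : ∀ x y, (x, y) ∈ D → G.ax x → (y, y) ∈ q
  rule : ∀ r ∈ G.rules, ∀ y, (r.1, y) ∈ D → (r.2.1, y) ∈ D → (r.2.2, y) ∈ q

/-- The invariant of the computation. `sound` is maintained with every mark, so soundness needs no
separate argument at the end. -/
structure Work (G : Calc) (σ : Env) (q : List (ℕ × ℕ)) : Prop where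
  size : σ.V 2 = G.N
  tail : σ.V 20 = q.length
  links : Links σ.A G.rules
  ax : ∀ x < G.N, σ.A 3 x ≠ 0 ↔ G.ax x
  queue : Queue G.N σ.A q
  sound : ∀ p ∈ q, G.P p.1 p.2

variable {u : Setup} {σ : Env} {G : Calc} {q : List (ℕ × ℕ)}

theorem Work.setV (h : Work G σ q) {v : ℕ} (x : ℕ) (h2 : v ≠ 2 := by omega)
    (h20 : v ≠ 20 := by omega) : Work G (σ.setV v x) q where
  size := by simp [h2.symm, h.size]
  tail := by simp [h20.symm, h.tail]
  links := h.links
  ax := h.ax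
  queue := h.queue
  sound := h.sound

/-- The effect of marking pairs: the queue grows and nothing else changes. -/
structure Grows (G : Calc) (σ : Env) (q : List (ℕ × ℕ)) (σ' : Env) (q' : List (ℕ × ℕ)) : Prop where
  work : Work G σ' q'
  pre : q <+: q'
  frame : ∀ v, v ≠ 20 → σ'.V v = σ.V v

theorem Grows.refl (h : Work G σ q) : Grows G σ q σ q := ⟨h, List.prefix_rfl, fun _ _ => rfl⟩

theorem Work.mark (h : Work G σ q) (hf : u.Fits (G.N * G.N)) {a b : Ex} {x y : ℕ}
    (ha : a.Pure u σ x) (hb : b.Pure u σ y) (hx : x < G.N) (hy : y < G.N) (hP : G.P x y)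
    (cost : a.cost ≤ 20 ∧ b.cost ≤ 20) :
    (OL.mark a b).Run u σ 200 fun σ' => Grows G σ q σ' (ins q (x, y)) := by
  refine (h.queue.mark_run h.size h.tail hf ha hb hx hy cost).imp le_rfl ?_
  rintro σ' ⟨h1, h2, h3, h4⟩
  refine ⟨⟨?_, h2, ?_, ?_, h1, ?_⟩, prefix_ins _ _, h3⟩
  · rw [h3 2 (by simp), h.size]
  · exact h.links.congr fun k hk => h4 k (by omega) (by omega) (by omega)
  · rw [h4 3 (by simp) (by simp) (by simp)]
    exact h.ax
  · intro p hp
    rcases mem_ins.1 hp with hp | rfl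
    · exact h.sound p hp
    · exact hP

theorem Ex.pure_var {u : Setup} {σ : Env} {v x : ℕ} (h : σ.V v = x) : (Ex.var v).Pure u σ x :=
  fun _ => ⟨trivial, h⟩

/-- Marks `x, z` for all `z`, where `x` is in variable `4`; the variable `6` is the counter. -/
def fillRow : Cmd :=
  .seq (.set 6 (.num 0)) (.while (.lt (.var 6) (.var 2))
    (.seq (OL.mark (.var 4) (.var 6)) (.set 6 (.add (.var 6) (.num 1)))))

theorem Work.fillRow (h : Work G σ q) (hf : u.Fits (G.N * G.N)) {x : ℕ} (h4 : σ.V 4 = x)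
    (hx : x < G.N) (hP : G.P x x) :
    OL.fillRow.Run u σ (300 * G.N + 20) fun σ' => ∃ q', Work G σ' q' ∧ q <+: q' ∧
      (∀ v, v ≠ 20 → v ≠ 6 → σ'.V v = σ.V v) ∧ ∀ z < G.N, (x, z) ∈ q' := by
  have hlt := hf.lt
  have hNN := Nat.le_mul_self G.N
  refine Cmd.Run.imp (.seq <| .set (by simp [Ex.Ok]) <|
    .while (n := 300 * G.N) (fun σ' n => ∃ i q', i ≤ G.N ∧ n = 300 * (G.N - i) ∧ σ'.V 6 = i ∧
      Work G σ' q' ∧ q <+: q' ∧ (∀ v, v ≠ 20 → v ≠ 6 → σ'.V v = σ.V v) ∧ ∀ z < i, (x, z) ∈ q')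
      ?_ ?_ ?_ ?_) ?_ fun _ h => h
  · exact ⟨0, q, by simp, by simp, by simp [Ex.eval], h.setV _, List.prefix_rfl,
      fun v _ hv => by simp [hv], by simp⟩
  · simp [Ex.Ok]
  · rintro σ' n ⟨i, q', hi, -, hV, hw, hp, hv, hz⟩ h0
    have : i = G.N := by
      simp only [Ex.eval, hV, hw.size] at h0
      split at h0 <;> omega
    subst this
    exact ⟨q', hw, hp, hv, hz⟩
  · rintro σ' n ⟨i, q', hi, rfl, hV, hw, hp, hv, hz⟩ h0
    have hiN : i < G.N := by
      by_contra hc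
      exact h0 (by simp [Ex.eval, hV, hw.size, hc])
    refine ⟨_, .seq <| (hw.mark hf (Ex.pure_var (x := x) ?_) (Ex.pure_var hV) hx hiN
      (G.full hP i) (by simp [Ex.cost])).imp le_rfl fun σ2 h2 => .set ?_ ?_⟩
    · rw [hv 4 (by simp) (by simp), h4]
    · simp only [Ex.Ok, Ex.eval, h2.frame 6 (by simp), hV, true_and]
      omega
    · refine ⟨_, ⟨i + 1, _, hiN, rfl, by simp [Ex.eval, h2.frame 6, hV], h2.work.setV _,
        hp.trans h2.pre, fun v h20 h6 => ?_, fun z hzi => ?_⟩, ?_⟩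
      · simp [h6, h2.frame v h20, hv v h20 h6]
      · rw [mem_ins]
        rcases Nat.lt_or_ge z i with h' | h'
        · exact .inl (hz z h')
        · exact .inr (by rw [show z = i by omega])
      · simp only [Ex.cost]
        omega
  · simp only [Ex.cost]
    omega

/-- Applies the rules for `x` to the pair `x, y`, where `x` and `y` are in the variables `4` and
`5`. -/
def applyRules : Cmd :=
  -- Between rounds variable `6` holds a link: zero ends the list, any other value is one more than
  -- the index of a rule.
  .seq (.set 6 (.get 4 (.var 4))) (.while (.var 6) (.seq (.set 6 (.sub (.var 6) (.num 1)))
    (.seq (.ite (.get 6 (pairEx (.get 1 (.var 6)) (.var 5)))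
      (.seq (.set 7 (.get 2 (.var 6))) (OL.mark (.var 7) (.var 5))) .skip)
      (.set 6 (.get 5 (.var 6))))))

/-- The linked list visits only rules with first premise `x`, and the potential counts those still
ahead. Only second premises already in `q` are promised; those that come later are caught by
`Calc.swap` when they are processed. -/
theorem Work.applyRules (h : Work G σ q) (hf : u.Fits (G.N * G.N)) {x y : ℕ} (h4 : σ.V 4 = x)
    (h5 : σ.V 5 = y) (hx : x < G.N) (hy : y < G.N) (hxy : (x, y) ∈ q) :
    OL.applyRules.Run u σ (400 * G.rules.countP (fun r => r.1 = x) + 20)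
      fun σ' => ∃ q', Work G σ' q' ∧ q <+: q' ∧
        (∀ v, v ≠ 20 → v ≠ 6 → v ≠ 7 → σ'.V v = σ.V v) ∧
        ∀ r ∈ G.rules, r.1 = x → (r.2.1, y) ∈ q → (r.2.2, y) ∈ q' := by
  have hlt := hf.lt
  have hNN := Nat.le_mul_self G.N
  have hN2 : 2 * G.N ≤ G.N * G.N := Nat.mul_le_mul_right _ G.two_le
  have hlen := G.length_le
  refine Cmd.Run.imp (.seq <| .set ?_ <|
    .while (n := 400 * G.rules.countP (fun r => r.1 = x)) (fun σ' n => ∃ pre l q',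
      G.rules = pre ++ l ∧ n = 400 * l.countP (fun r => r.1 = x) ∧ σ'.V 6 = top x l ∧
      Work G σ' q' ∧ q <+: q' ∧ (∀ v, v ≠ 20 → v ≠ 6 → v ≠ 7 → σ'.V v = σ.V v) ∧
      ∀ r ∈ pre, r.1 = x → (r.2.1, y) ∈ q → (r.2.2, y) ∈ q')
      ?_ ?_ ?_ ?_) ?_ fun _ h => h
  · refine ⟨trivial, by simp, ?_⟩
    simp only [Ex.eval, h4]
    exact hf.mono (by omega)
  · exact ⟨[], G.rules, q, rfl, rfl, by simp [Ex.eval, h4, h.links.head], h.setV _,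
      List.prefix_rfl, fun v _ hv _ => by simp [hv], by simp⟩
  · simp [Ex.Ok]
  · rintro σ' n ⟨pre, l, q', hl, -, hV, hw, hp, hv, hz⟩ h0
    refine ⟨q', hw, hp, hv, fun r hr hrx => ?_⟩
    rw [hl, List.mem_append] at hr
    rcases hr with hr | hr
    · exact hz r hr hrx
    · simp only [Ex.eval, hV] at h0
      exact absurd hrx (top_eq_zero h0 r hr)
  · rintro σ' n ⟨pre, l, q', hl, rfl, hV, hw, hp, hv, hz⟩ h0
    simp only [Ex.eval, hV] at h0
    obtain ⟨i, hi⟩ := Nat.exists_eq_succ_of_ne_zero h0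
    obtain ⟨pre', r, l', rfl, hrx, rfl, hpre'⟩ := exists_of_top_eq_succ hi
    have hmem : r ∈ G.rules := by rw [hl]; simp
    have hll : l'.length < G.rules.length := by rw [hl]; simp; omega
    obtain ⟨hs, hzN⟩ := G.lt r hmem
    have hch : Chain σ'.A (r :: l') := by
      have := hw.links.chain
      rw [hl] at this
      exact this.of_append.of_append
    obtain ⟨c1, c2, c5, -⟩ := hch
    have hV5 : σ'.V 5 = y := by rw [hv 5 (by simp) (by simp) (by simp), h5]
    have hfl : u.Fits l'.length := hf.mono (by omega)
    have w1 := hw.setV (v := 6) l'.length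
    have hplt := pair_lt hs hy
    -- The skipped rules in `pre'` do not count, so a round consumes exactly one unit of 400.
    have hcount : (pre' ++ r :: l').countP (fun r => r.1 = x) =
        l'.countP (fun r => r.1 = x) + 1 := by
      rw [List.countP_append, List.countP_cons, List.countP_eq_zero.2 (by simpa using hpre')]
      simp [hrx]
    -- The end of a round, common to both branches: follow the link and restore the invariant.
    have final : ∀ σ2 q2, Work G σ2 q2 → q' <+: q2 → (∀ v, v ≠ 20 → v ≠ 6 → v ≠ 7 →
        σ2.V v = σ'.V v) → σ2.V 6 = l'.length → ((r.2.1, y) ∈ q → (r.2.2, y) ∈ q2) →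
        (Cmd.set 6 (.get 5 (.var 6))).Run u σ2 20 fun σ3 => ∃ n', (∃ pre l q',
          G.rules = pre ++ l ∧ n' = 400 * l.countP (fun r => r.1 = x) ∧ σ3.V 6 = top x l ∧
          Work G σ3 q' ∧ q <+: q' ∧ (∀ v, v ≠ 20 → v ≠ 6 → v ≠ 7 → σ3.V v = σ.V v) ∧
          ∀ r ∈ pre, r.1 = x → (r.2.1, y) ∈ q → (r.2.2, y) ∈ q') ∧ n' + 368 + (Ex.var 6).cost + 1 ≤
            400 * (pre' ++ r :: l').countP (fun r => r.1 = x) := by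
      intro σ2 q2 w2 hq2 hv2 h6 hr
      have hch : Chain σ2.A (r :: l') := by
        have := w2.links.chain
        rw [hl] at this
        exact this.of_append.of_append
      refine Cmd.Run.imp (.set ⟨trivial, by simp, by simpa [Ex.eval, h6] using hfl⟩
        ⟨_, ⟨pre ++ pre' ++ [r], l', q2, by simp [hl], rfl, ?_, w2.setV _, hp.trans hq2, ?_, ?_⟩,
          by rw [hcount]; simp only [Ex.cost]; omega⟩) (by simp [Ex.cost]) fun _ h => h
      · simp [Ex.eval, h6, hch.2.2.1, hrx]
      · intro v h20 h6 h7
        simp [h6, hv2 v h20 h6 h7, hv v h20 h6 h7]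
      · intro r' hr' hrx' hq
        simp only [List.mem_append, List.mem_singleton] at hr'
        rcases hr' with (hr' | hr') | rfl
        · exact hq2.subset (hz r' hr' hrx' hq)
        · exact absurd hrx' (hpre' r' hr')
        · exact hr hq
    have ev : (Ex.sub (.var 6) (.num 1)).eval u σ' = l'.length := by
      simp [Ex.eval, hV, hi]
    have ok : (Ex.sub (.var 6) (.num 1)).Ok u σ' := ⟨trivial, u.one_lt⟩
    refine ⟨368, ?_⟩
    refine Cmd.Run.imp (.seq (T' := 320) <| Cmd.Run.set ok ?_) (by simp [Ex.cost]) fun _ h => h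
    · rw [ev]
      have hp6 : (pairEx (.get 1 (.var 6)) (.var 5)).eval u (σ'.setV 6 l'.length) =
          r.2.1 * G.N + y := by
        simp [pairEx, Ex.eval, c1, hV5, hw.size]
      have hok : (pairEx (.get 1 (.var 6)) (.var 5)).Ok u (σ'.setV 6 l'.length) := by
        have := Nat.le_add_right (r.2.1 * G.N) y
        simp only [pairEx, Ex.Ok, Ex.eval, Env.setV_V, Env.setV_A, Function.update_self, c1,
          hV5, hw.size, hfl, Function.update_of_ne (show 5 ≠ 6 by simp),
          Function.update_of_ne (show 2 ≠ 6 by simp), true_and, and_true, Nat.reduceLT]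
        omega
      refine Cmd.Run.seq (T := 300) (T' := 20) (Cmd.Run.imp (Cmd.Run.ite (T := 230) ?_ (fun hne => ?_)
        fun heq => ?_) ?_ fun _ h => h)
      · refine ⟨hok, by simp, ?_⟩
        rw [hp6]
        exact hf.mono hplt.le
      · simp only [Ex.eval, hp6, Env.setV_A, hw.queue.mark _ hs y hy] at hne
        have hq' : (r.2.1, y) ∈ q' := by
          by_contra hc
          simp [hc] at hne
        have ok2 : (Ex.get 2 (.var 6)).Ok u (σ'.setV 6 l'.length) :=
          ⟨trivial, by simp, by simpa [Ex.eval] using hfl⟩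
        refine Cmd.Run.imp (Cmd.Run.seq <| Cmd.Run.set ok2 <|
          ((w1.setV (v := 7) _).mark hf (x := r.2.2) (y := y) (Ex.pure_var ?_) (Ex.pure_var ?_)
          hzN hy (G.rule r hmem y ?_ (hw.sound _ hq')) (by simp [Ex.cost])).imp le_rfl
          fun σ2 h2 => ?_) (by simp [Ex.cost]) fun _ h => h
        · simp [Ex.eval, c2]
        · simp [hV5]
        · rw [hrx]
          exact h.sound _ hxy
        · refine final σ2 _ h2.work h2.pre (fun v h20 h6 h7 => ?_) ?_ fun _ => mem_ins.2 (.inr rfl)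
          · simp [h2.frame v h20, h6, h7]
          · simp [h2.frame 6]
      · simp only [Ex.eval, hp6, Env.setV_A, hw.queue.mark _ hs y hy] at heq
        have hq' : (r.2.1, y) ∉ q := by
          intro hc
          simp [hp.subset hc] at heq
        refine Cmd.Run.imp (Cmd.Run.skip ?_) (by simp) fun _ h => h
        exact final _ _ w1 List.prefix_rfl (fun v _ h6 _ => by simp [h6]) (by simp)
          fun hc => absurd hc hq'
      · simp [Ex.cost, pairEx]
  · simp only [Ex.cost]
    omega

end OL

namespace OL

variable {u : Setup} {σ : Env} {G : Calc} {q : List (ℕ × ℕ)}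

/-! ### Processing one pair, and the total time -/

/-- An inference that is not covered by `D` uses the new pair. If that is the second premise of a
rule, `G.swap` makes it the first. -/
theorem Calc.Closed.snoc {D q' : List (ℕ × ℕ)} {x y : ℕ} (h : G.Closed D q) (hD : D ⊆ q)
    (hq : q ⊆ q') (hsymm : (y, x) ∈ q') (hfull : x = y → ∀ z < G.N, (x, z) ∈ q')
    (hax : G.ax x → (y, y) ∈ q')
    (hrule : ∀ r ∈ G.rules, r.1 = x → (r.2.1, y) ∈ q → (r.2.2, y) ∈ q') (hxy : (x, y) ∈ q) :
    G.Closed (D ++ [(x, y)]) q' := by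
  have sub : ∀ p, p ∈ D ++ [(x, y)] → p ∈ q := by
    intro p hp
    rcases List.mem_append.1 hp with hp | hp
    · exact hD hp
    · rwa [List.mem_singleton.1 hp]
  refine ⟨fun a b hab => ?_, fun a ha z hz => ?_, fun a b hab ha => ?_, fun r hr b h1 h2 => ?_⟩
  · rcases List.mem_append.1 hab with hab | hab
    · exact hq (h.symm a b hab)
    · simp only [List.mem_singleton, Prod.mk.injEq] at hab
      rw [hab.1, hab.2]
      exact hsymm
  · rcases List.mem_append.1 ha with ha | ha
    · exact hq (h.full a ha z hz)
    · simp only [List.mem_singleton, Prod.mk.injEq] at ha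
      rw [ha.1]
      exact hfull (ha.1.symm.trans ha.2) z hz
  · rcases List.mem_append.1 hab with hab | hab
    · exact hq (h.ax a b hab ha)
    · simp only [List.mem_singleton, Prod.mk.injEq] at hab
      rw [hab.2]
      exact hax (hab.1 ▸ ha)
  · rcases List.mem_append.1 h1 with h1' | h1'
    · rcases List.mem_append.1 h2 with h2' | h2'
      · exact hq (h.rule r hr b h1' h2')
      · simp only [List.mem_singleton, Prod.mk.injEq] at h2'
        have := hrule _ (G.swap r hr) h2'.1
        rw [← h2'.2] at this
        exact this (hD h1')
    · simp only [List.mem_singleton, Prod.mk.injEq] at h1'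
      have := hrule r hr h1'.1
      rw [← h1'.2] at this
      exact this (sub _ h2)

/-- The time that is allotted to the processing of a pair. -/
def Calc.cost (G : Calc) (p : ℕ × ℕ) : ℕ :=
  400 * G.rules.countP (fun r => r.1 = p.1) + (if p.1 = p.2 then 300 * G.N else 0) + 1000

/-- The time that is allotted to the pairs outside of `D`. -/
def Calc.rest (G : Calc) (D : List (ℕ × ℕ)) : ℕ :=
  ∑ p ∈ (Finset.range G.N ×ˢ Finset.range G.N).filter (· ∉ D), G.cost p

theorem Calc.rest_snoc (G : Calc) {D : List (ℕ × ℕ)} {p : ℕ × ℕ} (hp : p.1 < G.N ∧ p.2 < G.N)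
    (hD : p ∉ D) : G.rest (D ++ [p]) + G.cost p = G.rest D := by
  have : (Finset.range G.N ×ˢ Finset.range G.N).filter (· ∉ D ++ [p]) =
      ((Finset.range G.N ×ˢ Finset.range G.N).filter (· ∉ D)).erase p := by
    ext p'
    simp only [Finset.mem_filter, Finset.mem_erase, List.mem_append, List.mem_singleton]
    tauto
  rw [Calc.rest, Calc.rest, this, Finset.sum_erase_add]
  simp [hp, hD]

/-- Double counting: a rule is counted for at most one `x`. -/
theorem sum_countP_le (N : ℕ) (l : List Rule) :
    ∑ x ∈ Finset.range N, l.countP (fun r => r.1 = x) ≤ l.length := by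
  induction l with
  | nil => simp
  | cons r l ih =>
    simp only [List.countP_cons, Finset.sum_add_distrib, List.length_cons, decide_eq_true_eq]
    have : ∑ x ∈ Finset.range N, (if r.1 = x then 1 else 0) ≤ 1 := by
      rw [Finset.sum_ite_eq]
      split <;> simp
    omega

/-- The constant is `400 * 2` for at most `2 * N` rules with `N` contexts, plus `300` for the `N`
diagonal pairs with a row each, plus the flat `1000` per pair. -/
theorem Calc.rest_le (G : Calc) (D : List (ℕ × ℕ)) : G.rest D ≤ 2100 * (G.N * G.N) := by
  have h1 : G.rest D ≤ ∑ p ∈ Finset.range G.N ×ˢ Finset.range G.N, G.cost p :=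
    Finset.sum_le_sum_of_subset (Finset.filter_subset _ _)
  refine h1.trans ?_
  simp only [Finset.sum_product, Calc.cost, Finset.sum_add_distrib, Finset.sum_const,
    smul_eq_mul, Finset.sum_ite_eq, ← Finset.mul_sum, Finset.card_product, Finset.card_range]
  have h2 : G.N * ∑ x ∈ Finset.range G.N, G.rules.countP (fun r => r.1 = x) ≤
      G.N * (2 * G.N) := Nat.mul_le_mul_left _ ((sum_countP_le _ _).trans G.length_le)
  have h3 : ∑ x ∈ Finset.range G.N, (if x ∈ Finset.range G.N then 300 * G.N else 0) ≤
      300 * (G.N * G.N) := by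
    rw [Finset.sum_congr rfl fun x hx => if_pos hx]
    simp only [Finset.sum_const, Finset.card_range, smul_eq_mul]
    linarith
  have h4 : ∑ x ∈ Finset.range G.N, ∑ _y ∈ Finset.range G.N, G.rules.countP (fun r => r.1 = x) =
      G.N * ∑ x ∈ Finset.range G.N, G.rules.countP (fun r => r.1 = x) := by
    simp [Finset.mul_sum]
  linarith

def eqEx (a b : Ex) : Ex := .sub (.num 1) (.add (.lt a b) (.lt b a))

theorem Ex.eval_eqEx (a b : Ex) : (eqEx a b).eval u σ = if a.eval u σ = b.eval u σ then 1 else 0 := by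
  simp only [eqEx, Ex.eval]
  split_ifs <;> omega

theorem Ex.ok_eqEx {a b : Ex} (ha : a.Ok u σ) (hb : b.Ok u σ) : (eqEx a b).Ok u σ := by
  have := u.one_lt
  refine ⟨this, ⟨ha, hb⟩, ⟨hb, ha⟩, ?_⟩
  simp only [Ex.eval]
  split_ifs <;> omega

/-- Processes the pair with the number in variable `3`. -/
def step : Cmd :=
  .seq (.set 4 (.get 7 (.var 3))) <| .seq (.set 5 (.get 8 (.var 3))) <|
  .seq (mark (.var 5) (.var 4)) <|
  .seq (.ite (.get 3 (.var 4)) (mark (.var 5) (.var 5)) .skip) <|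
  .seq (.ite (eqEx (.var 4) (.var 5)) fillRow .skip) <|
  .seq applyRules (.set 3 (.add (.var 3) (.num 1)))

/-- The 20 steps held back from the allotment pay for the guard of the enclosing loop. -/
theorem Work.step (h : Work G σ q) (hf : u.Fits (G.N * G.N)) {i : ℕ} (h3 : σ.V 3 = i)
    (hi : i < q.length) (hcl : G.Closed (q.take i) q) :
    OL.step.Run u σ (G.cost q[i] - 20) fun σ' => ∃ q', Work G σ' q' ∧ q <+: q' ∧ σ'.V 3 = i + 1 ∧
      (∀ v, v ≠ 20 → v ∉ Set.Icc 3 7 → σ'.V v = σ.V v) ∧ G.Closed (q.take (i + 1)) q' := by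
  have hlt := hf.lt
  have hlen := h.queue.length_le
  have hfi : u.Fits i := hf.mono (by omega)
  have hmem : q[i] ∈ q := List.getElem_mem hi
  have htake : q.take (i + 1) = q.take i ++ [q[i]] := by simp
  have e7 := h.queue.fst i hi
  have e8 := h.queue.snd i hi
  rw [htake]
  revert hmem e7 e8
  generalize q[i] = p
  obtain ⟨x, y⟩ := p
  intro hmem e7 e8
  obtain ⟨hx, hy⟩ := h.queue.lt _ hmem
  simp only at hx hy e7 e8
  have hP : G.P x y := h.sound _ hmem
  have ok1 : (Ex.get 7 (.var 3)).Ok u σ := ⟨trivial, by simp, by simpa [Ex.eval, h3] using hfi⟩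
  have ev1 : (Ex.get 7 (.var 3)).eval u σ = x := by simp [Ex.eval, h3, e7]
  have ok2 : (Ex.get 8 (.var 3)).Ok u (σ.setV 4 x) :=
    ⟨trivial, by simp, by simpa [Ex.eval, h3] using hfi⟩
  have ev2 : (Ex.get 8 (.var 3)).eval u (σ.setV 4 x) = y := by simp [Ex.eval, h3, e8]
  have w2 := (h.setV (v := 4) x).setV (v := 5) y
  -- The summands are, in order: two reads from the queue, symmetry, the cut with an axiom,
  -- weakening, the introduction rules, and the increment.
  have key : OL.step.Run u σ (10 + (10 + (200 + (210 + ((40 + if x = y then 300 * G.N else 0) +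
      ((400 * G.rules.countP (fun r => r.1 = x) + 20) + 10)))))) fun σ' => ∃ q', Work G σ' q' ∧
      q <+: q' ∧ σ'.V 3 = i + 1 ∧ (∀ v, v ≠ 20 → v ∉ Set.Icc 3 7 → σ'.V v = σ.V v) ∧
      G.Closed (q.take i ++ [(x, y)]) q' := by
    refine Cmd.Run.seq <| (Cmd.Run.set ok1 ?_).imp (by simp [Ex.cost]) fun _ h => h
    rw [ev1]
    refine Cmd.Run.seq <| (Cmd.Run.set ok2 ?_).imp (by simp [Ex.cost]) fun _ h => h
    rw [ev2]
    refine Cmd.Run.seq <| (w2.mark hf (x := y) (y := x) (Ex.pure_var (by simp))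
      (Ex.pure_var (by simp)) hy hx (G.symm hP) (by simp [Ex.cost])).imp le_rfl fun σ3 g3 => ?_
    have w3 := g3.work
    have v43 : σ3.V 4 = x := by simp [g3.frame 4]
    have v53 : σ3.V 5 = y := by simp [g3.frame 5]
    have okax : (Ex.get 3 (.var 4)).Ok u σ3 :=
      ⟨trivial, by simp, by
        simp only [Ex.eval, v43]
        exact hf.mono (hx.le.trans (Nat.le_mul_self _))⟩
    refine Cmd.Run.seq <| Cmd.Run.imp (Q := fun σ4 => ∃ q4, Grows G σ3 (ins q (y, x)) σ4 q4 ∧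
      (G.ax x → (y, y) ∈ q4)) (Cmd.Run.ite (T := 200) okax (fun hne => ?_) fun heq => ?_)
      (by simp [Ex.cost]) fun σ4 h4 => ?_
    · simp only [Ex.eval, v43] at hne
      have hax := (w3.ax x hx).1 hne
      exact (w3.mark hf (Ex.pure_var v53) (Ex.pure_var v53) hy hy (G.ax_rule hax hP)
        (by simp [Ex.cost])).imp le_rfl fun σ4 g4 => ⟨_, g4, fun _ => mem_ins.2 (.inr rfl)⟩
    · simp only [Ex.eval, v43] at heq
      exact (Cmd.Run.skip ⟨_, .refl w3, fun hax => absurd heq ((w3.ax x hx).2 hax)⟩).imp (by simp)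
        fun _ h => h
    obtain ⟨q4, g4, hax4⟩ := h4
    have w4 := g4.work
    have v44 : σ4.V 4 = x := by rw [g4.frame 4 (by simp), v43]
    have v54 : σ4.V 5 = y := by rw [g4.frame 5 (by simp), v53]
    refine Cmd.Run.seq <| Cmd.Run.imp (Q := fun σ5 => ∃ q5, Work G σ5 q5 ∧ q4 <+: q5 ∧
      (∀ v, v ≠ 20 → v ≠ 6 → σ5.V v = σ4.V v) ∧ (x = y → ∀ z < G.N, (x, z) ∈ q5))
      (Cmd.Run.ite (T := 20 + if x = y then 300 * G.N else 0)
        (Ex.ok_eqEx (a := .var 4) (b := .var 5) trivial trivial)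
        (fun hne => ?_) fun heq => ?_) (by simp only [Ex.cost, eqEx]; omega) fun σ5 h5 => ?_
    · rw [Ex.eval_eqEx] at hne
      have hxy : x = y := by
        by_contra hc
        simp [Ex.eval, v44, v54, hc] at hne
      refine (w4.fillRow hf v44 hx ?_).imp (by simp [hxy]; omega) fun σ5 ⟨q5, w5, p5, f5, z5⟩ =>
        ⟨q5, w5, p5, f5, fun _ => z5⟩
      simpa [hxy] using hP
    · rw [Ex.eval_eqEx] at heq
      have hxy : x ≠ y := by
        intro hc
        simp [Ex.eval, v44, v54, hc] at heq
      exact (Cmd.Run.skip ⟨q4, w4, List.prefix_rfl, fun _ _ _ => rfl, fun hc => absurd hc hxy⟩).imp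
        (by omega) fun _ h => h
    obtain ⟨q5, w5, p5, f5, z5⟩ := h5
    have p45 : q <+: q5 := g3.pre.trans (g4.pre.trans p5)
    have hmem5 : (x, y) ∈ q5 := p45.subset hmem
    refine Cmd.Run.seq <| (w5.applyRules hf (x := x) (y := y) (by rw [f5 4 (by simp) (by simp), v44])
      (by rw [f5 5 (by simp) (by simp), v54]) hx hy hmem5).imp le_rfl
      fun σ6 ⟨q6, w6, p6, f6, r6⟩ => ?_
    have v36 : σ6.V 3 = i := by
      rw [f6 3 (by simp) (by simp) (by simp), f5 3 (by simp) (by simp), g4.frame 3 (by simp),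
        g3.frame 3 (by simp)]
      simp [h3]
    have ok6 : (Ex.add (.var 3) (.num 1)).Ok u σ6 := by
      refine ⟨trivial, u.one_lt, ?_⟩
      simp only [Ex.eval, v36]
      omega
    refine (Cmd.Run.set ok6 ⟨q6, w6.setV _, p45.trans p6, by simp [Ex.eval, v36],
      fun v h20 hv => ?_, ?_⟩).imp (by simp [Ex.cost]) fun _ h => h
    · have h3' : v ≠ 3 := by rintro rfl; simp at hv
      have h4' : v ≠ 4 := by rintro rfl; simp at hv
      have h5' : v ≠ 5 := by rintro rfl; simp at hv
      have h6' : v ≠ 6 := by rintro rfl; simp at hv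
      have h7' : v ≠ 7 := by rintro rfl; simp at hv
      simp [h3', h4', h5', f6 v h20 h6' h7', f5 v h20 h6', g4.frame v h20, g3.frame v h20]
    · refine hcl.snoc (List.take_subset _ _) (p45.trans p6).subset ?_ ?_ ?_ ?_ hmem
      · exact p6.subset (p5.subset (g4.pre.subset (mem_ins.2 (.inr rfl))))
      · exact fun hxy z hz => p6.subset (z5 hxy z hz)
      · exact fun hax => p6.subset (p5.subset (hax4 hax))
      · exact fun r hr hrx hs => r6 r hr hrx (p45.subset hs)
  refine key.imp ?_ fun _ h => h
  simp only [Calc.cost]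
  omega

def saturate : Cmd := .seq (.set 3 (.num 0)) (.while (.lt (.var 3) (.var 20)) step)

/-- The potential covers all pairs not yet processed, including those never derived, so growth of
the queue costs nothing extra. When the head meets the tail, the processed pairs are the whole
queue. -/
theorem Work.saturate (h : Work G σ q) (hf : u.Fits (G.N * G.N)) :
    OL.saturate.Run u σ (2110 * (G.N * G.N)) fun σ' => ∃ q', Work G σ' q' ∧ q <+: q' ∧
      (∀ v, v ≠ 20 → v ∉ Set.Icc 3 7 → σ'.V v = σ.V v) ∧ G.Closed q' q' := by
  have hlt := hf.lt
  -- With `N * N ≥ 4`, the excess of 2110 over 2100 absorbs the constant overhead.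
  have h4 : 2 * 2 ≤ G.N * G.N := Nat.mul_le_mul G.two_le G.two_le
  refine Cmd.Run.imp (.seq <| .set (by simp [Ex.Ok]) <|
    .while (n := G.rest []) (fun σ' n => ∃ i q', i ≤ q'.length ∧ n = G.rest (q'.take i) ∧
      σ'.V 3 = i ∧ Work G σ' q' ∧ q <+: q' ∧ (∀ v, v ≠ 20 → v ∉ Set.Icc 3 7 → σ'.V v = σ.V v) ∧
      G.Closed (q'.take i) q') ?_ ?_ ?_ ?_) ?_ fun _ h => h
  · refine ⟨0, q, by simp, by simp, by simp [Ex.eval], h.setV _, List.prefix_rfl,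
      fun v _ hv => ?_, by constructor <;> simp⟩
    have h3' : v ≠ 3 := by rintro rfl; simp at hv
    simp [h3']
  · simp [Ex.Ok]
  · rintro σ' n ⟨i, q', hi, -, hV, hw, hp, hv, hc⟩ h0
    have : i = q'.length := by
      by_contra hne
      have : i < q'.length := by omega
      simp [Ex.eval, hV, hw.tail, this] at h0
    subst this
    rw [List.take_length] at hc
    exact ⟨q', hw, hp, hv, hc⟩
  · rintro σ' n ⟨i, q', hi, rfl, hV, hw, hp, hv, hc⟩ h0
    have hi' : i < q'.length := by
      by_contra hne
      simp [Ex.eval, hV, hw.tail, hne] at h0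
    refine ⟨_, (hw.step hf hV hi' hc).imp le_rfl
      fun σ2 ⟨q2, w2, p2, v2, f2, c2⟩ => ⟨_, ⟨i + 1, q2, ?_, rfl, v2, w2, hp.trans p2,
        fun v h20 h37 => by rw [f2 v h20 h37, hv v h20 h37], ?_⟩, ?_⟩⟩
    · have := p2.length_le
      omega
    -- The queue grows only at its end, so the processed part is the same list before and after.
    · have : q2.take (i + 1) = q'.take (i + 1) := by
        obtain ⟨s, rfl⟩ := p2
        rw [List.take_append_of_le_length (by omega)]
      rwa [this]
    · have e1 : q2.take (i + 1) = q'.take (i + 1) := by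
        obtain ⟨s, rfl⟩ := p2
        rw [List.take_append_of_le_length (by omega)]
      have e2 : q'.take (i + 1) = q'.take i ++ [q'[i]] := by simp
      -- The queue has no repetitions, so the allotment of this pair is still unspent.
      have h3 : q'[i] ∉ q'.take i := by
        have := hw.queue.nodup.sublist (List.take_sublist (i + 1) q')
        rw [e2, List.nodup_append] at this
        exact fun h => this.2.2 _ h _ (by simp) rfl
      have h4 := G.rest_snoc (hw.queue.lt _ (List.getElem_mem hi')) h3
      rw [e1, e2]
      have h5 : 1000 ≤ G.cost q'[i] := by simp [Calc.cost]
      simp only [Ex.cost]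
      omega
  · have := G.rest_le []
    simp only [Ex.cost]
    omega

end OL

namespace OL

/-! ### Reading the input -/

def Input.node (I : Input) (i : ℕ) : Node := I.nodes.getD i .zero

def Input.axm (I : Input) (i : ℕ) : Slot × Slot := I.axs.getD i (none, none)

/-- The number of codes: two for every node, and two for an additional node `0`. -/
def Input.N (I : Input) : ℕ := 2 * I.nodes.length + 2

/-- The input that `u` holds is `I`, and there is enough memory. -/
structure Setup.Holds (u : Setup) (I : Input) : Prop where
  base : u.base = 6 + 3 * I.nodes.length + 4 * I.axs.length
  fits : u.Fits (I.N * I.N)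
  num_nodes : u.inp 0 = I.nodes.length
  num_axs : u.inp 1 = I.axs.length
  node : ∀ i < I.nodes.length,
    (I.node i).words = [u.inp (2 + 3 * i), u.inp (3 + 3 * i), u.inp (4 + 3 * i)]
  goal₁ : I.goal.1.words = [u.inp (2 + 3 * I.nodes.length), u.inp (3 + 3 * I.nodes.length)]
  goal₂ : I.goal.2.words = [u.inp (4 + 3 * I.nodes.length), u.inp (5 + 3 * I.nodes.length)]
  axm₁ : ∀ i < I.axs.length, (I.axm i).1.words = [u.inp (6 + 3 * I.nodes.length + 4 * i),
    u.inp (6 + 3 * I.nodes.length + 4 * i + 1)]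
  axm₂ : ∀ i < I.axs.length, (I.axm i).2.words = [u.inp (6 + 3 * I.nodes.length + 4 * i + 2),
    u.inp (6 + 3 * I.nodes.length + 4 * i + 2 + 1)]

theorem flatMap_getD {α : Type*} (f : α → List ℕ) {c : ℕ} (hf : ∀ a, (f a).length = c) (d : α)
    (l : List α) (l' : List ℕ) : ∀ i < l.length, ∀ r < c,
      (l.flatMap f ++ l').getD (c * i + r) 0 = (f (l.getD i d)).getD r 0 := by
  induction l with
  | nil => simp
  | cons a l ih =>
    intro i hi r hr
    rw [List.flatMap_cons, List.append_assoc]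
    cases i with
    | zero => rw [List.getD_append _ _ _ _ (by rw [hf]; omega)]; simp
    | succ i =>
      rw [List.getD_append_right _ _ _ _ (by rw [hf, mul_add]; omega), hf,
        show c * (i + 1) + r - c = c * i + r by rw [mul_add]; omega,
        ih i (by simpa using hi) r hr]
      simp

theorem flatMap_length {α : Type*} (f : α → List ℕ) {c : ℕ} (hf : ∀ a, (f a).length = c)
    (l : List α) : (l.flatMap f).length = c * l.length := by
  simp [List.length_flatMap, hf, mul_comm]

theorem Node.length_words (nd : Node) : nd.words.length = 3 := by cases nd <;> rfl

theorem Slot.length_words (x : Slot) : x.words.length = 2 := by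
  rcases x with _ | ⟨_ | _, _⟩ <;> rfl

theorem Input.length_words (I : Input) :
    I.words.length = 6 + 3 * I.nodes.length + 4 * I.axs.length := by
  simp only [Input.words, List.length_append, List.length_cons, List.length_nil,
    flatMap_length _ Node.length_words, Slot.length_words,
    flatMap_length (fun x : Slot × Slot => x.1.words ++ x.2.words) (c := 4)
      (fun x => by simp [Slot.length_words])]
  omega

theorem list_getD_three {l : List ℕ} (h : l.length = 3) :
    l = [l.getD 0 0, l.getD 1 0, l.getD 2 0] := by
  match l, h with
  | [a, b, c], _ => rfl

/-- The address arithmetic of the layout, done once: two header words, three per node, four for the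
goal, four per axiom. -/
theorem Input.holds (I : Input) {u : Setup} (hb : u.base = I.words.length)
    (hi : u.inp = fun i => I.words.getD i 0) (hf : u.Fits (I.N * I.N)) : u.Holds I := by
  have e0 : ∀ i, u.inp (2 + i) = (I.nodes.flatMap Node.words ++ ((I.goal.1.words ++ I.goal.2.words) ++
      I.axs.flatMap fun x => x.1.words ++ x.2.words)).getD i 0 := by
    intro i
    rw [hi, Input.words, add_comm]
    simp only [List.append_assoc]
    rfl
  have e1 : ∀ r < 4, u.inp (2 + 3 * I.nodes.length + r) =
      (I.goal.1.words ++ I.goal.2.words).getD r 0 := by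
    intro r hr
    have l4 : (I.goal.1.words ++ I.goal.2.words).length = 4 := by simp [Slot.length_words]
    rw [add_assoc, e0, List.getD_append_right _ _ _ _ (by
      rw [flatMap_length _ Node.length_words]; omega), flatMap_length _ Node.length_words,
      Nat.add_sub_cancel_left, List.getD_append _ _ _ _ (by omega)]
  have e2 : ∀ i < I.axs.length, ∀ r < 4, u.inp (6 + 3 * I.nodes.length + 4 * i + r) =
      ((I.axm i).1.words ++ (I.axm i).2.words).getD r 0 := by
    intro i hil r hr
    have l4 : (I.goal.1.words ++ I.goal.2.words).length = 4 := by simp [Slot.length_words]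
    rw [show 6 + 3 * I.nodes.length + 4 * i + r = 2 + (3 * I.nodes.length + (4 + (4 * i + r))) by
      omega, e0, List.getD_append_right _ _ _ _ (by
      rw [flatMap_length _ Node.length_words]; omega), flatMap_length _ Node.length_words,
      Nat.add_sub_cancel_left, List.getD_append_right _ _ _ _ (by omega), l4,
      Nat.add_sub_cancel_left]
    have := flatMap_getD (fun x : Slot × Slot => x.1.words ++ x.2.words) (c := 4)
      (fun x => by simp [Slot.length_words]) (none, none) I.axs [] i hil r hr
    rwa [List.append_nil] at this
  have e3 : ∀ i < I.nodes.length, ∀ r < 3, u.inp (2 + 3 * i + r) = (I.node i).words.getD r 0 := by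
    intro i hil r hr
    rw [add_assoc, e0]
    exact flatMap_getD _ Node.length_words .zero _ _ i hil r hr
  have pair : ∀ (x y : Slot), x.words = [(x.words ++ y.words).getD 0 0, (x.words ++ y.words).getD 1 0] ∧
      y.words = [(x.words ++ y.words).getD 2 0, (x.words ++ y.words).getD 3 0] := by
    rintro (_ | ⟨_ | _, _⟩) (_ | ⟨_ | _, _⟩) <;> exact ⟨rfl, rfl⟩
  refine ⟨by rw [hb, I.length_words], hf, by rw [hi]; rfl, by rw [hi]; rfl, fun i hil => ?_, ?_, ?_,
    fun i hil => ?_, fun i hil => ?_⟩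
  · have a0 := e3 i hil 0 (by simp)
    have a1 := e3 i hil 1 (by simp)
    have a2 := e3 i hil 2 (by simp)
    rw [show 3 + 3 * i = 2 + 3 * i + 1 by omega, show 4 + 3 * i = 2 + 3 * i + 2 by omega, a1, a2]
    exact (list_getD_three (I.node i).length_words).trans (by rw [← a0]; rfl)
  · have a0 := e1 0 (by simp)
    have a1 := e1 1 (by simp)
    rw [show 3 + 3 * I.nodes.length = 2 + 3 * I.nodes.length + 1 by omega, a1]
    exact (pair I.goal.1 I.goal.2).1.trans (by rw [← a0]; rfl)
  · have a2 := e1 2 (by simp)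
    have a3 := e1 3 (by simp)
    rw [show 4 + 3 * I.nodes.length = 2 + 3 * I.nodes.length + 2 by omega,
      show 5 + 3 * I.nodes.length = 2 + 3 * I.nodes.length + 3 by omega, a2, a3]
    exact (pair I.goal.1 I.goal.2).2
  · have a0 := e2 i hil 0 (by simp)
    rw [e2 i hil 1 (by simp)]
    exact (pair (I.axm i).1 (I.axm i).2).1.trans (by rw [← a0]; rfl)
  · rw [e2 i hil 2 (by simp), show 6 + 3 * I.nodes.length + 4 * i + 2 + 1 =
      6 + 3 * I.nodes.length + 4 * i + 3 by omega, e2 i hil 3 (by simp)]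
    exact (pair (I.axm i).1 (I.axm i).2).2

variable {u : Setup} {σ : Env} {I : Input}

/-! #### The rules -/

/-- The rules that introduce the formula at the node `i`, the newest first. -/
def nodeRules (i : ℕ) : Node → List Rule
  -- A rule with one premise is stored with the premise repeated; a rule with two premises appears
  -- in both orders. This gives the closure under swapping.
  | .neg a => [(2 * a, 2 * a, 2 * i + 1), (2 * a + 1, 2 * a + 1, 2 * i)]
  | .and a b => [(2 * b + 1, 2 * a + 1, 2 * i + 1), (2 * a + 1, 2 * b + 1, 2 * i + 1),
      (2 * b, 2 * b, 2 * i), (2 * a, 2 * a, 2 * i)]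
  | .or a b => [(2 * b, 2 * a, 2 * i), (2 * a, 2 * b, 2 * i),
      (2 * b + 1, 2 * b + 1, 2 * i + 1), (2 * a + 1, 2 * a + 1, 2 * i + 1)]
  | _ => []

def Input.rules (I : Input) : ℕ → List Rule
  | 0 => []
  | i + 1 => nodeRules i (I.node i) ++ I.rules i

theorem length_nodeRules_le (i : ℕ) (nd : Node) : (nodeRules i nd).length ≤ 4 := by
  cases nd <;> simp [nodeRules]

theorem Input.length_rules_le (I : Input) (i : ℕ) : (I.rules i).length ≤ 4 * i := by
  induction i with
  | zero => simp [Input.rules]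
  | succ i ih =>
    have := length_nodeRules_le i (I.node i)
    simp only [Input.rules, List.length_append]
    omega

theorem Input.mem_rules (I : Input) (r : Rule) (m : ℕ) :
    r ∈ I.rules m ↔ ∃ i < m, r ∈ nodeRules i (I.node i) := by
  induction m with
  | zero => simp [Input.rules]
  | succ m ih =>
    simp only [Input.rules, List.mem_append, ih]
    constructor
    · rintro (h | ⟨i, hi, h⟩)
      · exact ⟨m, by omega, h⟩
      · exact ⟨i, by omega, h⟩
    · rintro ⟨i, hi, h⟩
      rcases Nat.lt_succ_iff_lt_or_eq.1 hi with hi | rfl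
      · exact .inr ⟨i, hi, h⟩
      · exact .inl h

/-- The codes of the two annotations of the formula whose node is in the variable `v`. -/
def lft (v : ℕ) : Ex := .mul (.num 2) (.var v)
def rgt (v : ℕ) : Ex := .add (.mul (.num 2) (.var v)) (.num 1)

theorem Setup.Holds.lt (h : u.Holds I) :
    u.base + 16 * (I.N * I.N) + 16 < 2 ^ u.w ∧ I.N ≤ I.N * I.N ∧ 2 * I.N ≤ I.N * I.N := by
  refine ⟨h.fits, Nat.le_mul_self _, Nat.mul_le_mul_right _ ?_⟩
  simp [Input.N]

theorem Setup.Holds.lft (h : u.Holds I) {v i : ℕ} (hv : σ.V v = i) (hi : i ≤ I.nodes.length) :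
    (lft v).Pure u σ (2 * i) := by
  have h1 := h.lt
  have h2 : I.N = 2 * I.nodes.length + 2 := rfl
  intro A
  simp only [OL.lft, Ex.Ok, Ex.eval, hv, true_and, and_true]
  omega

theorem Setup.Holds.rgt (h : u.Holds I) {v i : ℕ} (hv : σ.V v = i) (hi : i ≤ I.nodes.length) :
    (rgt v).Pure u σ (2 * i + 1) := by
  have h1 := h.lt
  have h2 : I.N = 2 * I.nodes.length + 2 := rfl
  intro A
  simp only [OL.rgt, Ex.Ok, Ex.eval, hv, true_and, and_true]
  omega

/-- The words of the node in the variable `v`, for `j = 2, 3, 4`. -/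
def nodeEx (j v : ℕ) : Ex := .inp (.add (.num j) (.mul (.num 3) (.var v)))

theorem Setup.Holds.nodeEx_ok (h : u.Holds I) {v j : ℕ} (hv : σ.V v < I.nodes.length)
    (hj : j ≤ 4) : (nodeEx j v).Ok u σ := by
  have h1 := h.lt
  have h2 : I.N = 2 * I.nodes.length + 2 := rfl
  have h3 := h.base
  simp only [nodeEx, Ex.Ok, Ex.eval, true_and]
  omega

/-- Adds the rules for the node in variable `3`, whose words are in the variables `4`, `5`, `6`. -/
def addNodeRules : Cmd :=
  -- Symbols below 3 are leaves and have no rules; 3 is negation, 4 conjunction, and 5 is left for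
  -- disjunction.
  .ite (.lt (.var 4) (.num 3)) .skip <|
  .ite (.lt (.var 4) (.num 4))
    (.seq (addRule (rgt 5) (rgt 5) (lft 3)) (addRule (lft 5) (lft 5) (rgt 3))) <|
  .ite (.lt (.var 4) (.num 5))
    (.seq (addRule (lft 5) (lft 5) (lft 3)) <| .seq (addRule (lft 6) (lft 6) (lft 3)) <|
      .seq (addRule (rgt 5) (rgt 6) (rgt 3)) (addRule (rgt 6) (rgt 5) (rgt 3)))
    (.seq (addRule (rgt 5) (rgt 5) (rgt 3)) <| .seq (addRule (rgt 6) (rgt 6) (rgt 3)) <|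
      .seq (addRule (lft 5) (lft 6) (lft 3)) (addRule (lft 6) (lft 5) (lft 3)))

/-- What adding rules does. -/
structure Adds (σ : Env) (l : List Rule) (σ' : Env) : Prop where
  links : Links σ'.A l
  count : σ'.V 21 = l.length
  frame : ∀ v, v ≠ 21 → σ'.V v = σ.V v
  ax : σ'.A 3 = σ.A 3
  mark : σ'.A 6 = σ.A 6

theorem Adds.addRule {σ₀ : Env} {l : List Rule} (h : Adds σ₀ l σ) {c s z : Ex} {x y t : ℕ}
    (hc : c.Pure u σ x) (hs : s.Pure u σ y) (hz : z.Pure u σ t) (hx : u.Fits x)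
    (hf : u.Fits (l.length + 1)) (cost : c.cost ≤ 20 ∧ s.cost ≤ 20 ∧ z.cost ≤ 20) :
    (addRule c s z).Run u σ 200 (Adds σ₀ ((x, y, t) :: l)) := by
  refine (h.links.addRule h.count hc hs hz hx hf cost).imp le_rfl ?_
  rintro σ' ⟨h1, h2, h3, h4, h5⟩
  exact ⟨h1, by simpa using h2, fun v hv => by rw [h3 v hv, h.frame v hv], by rw [h4, h.ax],
    by rw [h5, h.mark]⟩

/-- The rules are added in the reverse of the order in `nodeRules`, as the newest comes first. -/
theorem Setup.Holds.addNodeRules (hu : u.Holds I) {i : ℕ} (hi : i < I.nodes.length)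
    (hch : ∀ j ∈ (I.node i).children, j < i) (h3 : σ.V 3 = i)
    (hw : (I.node i).words = [σ.V 4, σ.V 5, σ.V 6]) {l : List Rule} (hl : l.length ≤ 4 * i)
    (h : Adds σ l σ) :
    OL.addNodeRules.Run u σ 900 (Adds σ (nodeRules i (I.node i) ++ l)) := by
  have h1 := hu.lt
  have h2 : I.N = 2 * I.nodes.length + 2 := rfl
  -- At most `4 * i` older rules with `i` below the number of nodes leave room for four more.
  have fit : ∀ x, x ≤ 4 * I.nodes.length → u.Fits x := fun x hx => hu.fits.mono (by omega)
  have ok : ∀ k ≤ 5, (Ex.lt (.var 4) (.num k)).Ok u σ := by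
    intro k hk
    refine ⟨trivial, ?_⟩
    simp only [Ex.Ok]
    omega
  have L : ∀ (σ' : Env) (l' : List Rule), Adds σ l' σ' → ∀ v ≠ 21, ∀ a, σ.V v = a →
      a ≤ I.nodes.length → (OL.lft v).Pure u σ' (2 * a) := fun σ' l' h' v hv a ha hle =>
    hu.lft ((h'.frame v hv).trans ha) hle
  have R : ∀ (σ' : Env) (l' : List Rule), Adds σ l' σ' → ∀ v ≠ 21, ∀ a, σ.V v = a →
      a ≤ I.nodes.length → (OL.rgt v).Pure u σ' (2 * a + 1) := fun σ' l' h' v hv a ha hle =>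
    hu.rgt ((h'.frame v hv).trans ha) hle
  have cl : ∀ v, (OL.lft v).cost ≤ 20 := fun v => by simp [OL.lft, Ex.cost]
  have cr : ∀ v, (OL.rgt v).cost ≤ 20 := fun v => by simp [OL.rgt, Ex.cost]
  have leaf : ∀ t ≤ 2, σ.V 4 = t → OL.addNodeRules.Run u σ 900 (Adds σ l) := by
    intro t ht h4
    refine (Cmd.Run.ite (T := 1) (ok 3 (by simp)) (fun _ => .skip h) fun h0 => ?_).imp
      (by simp [Ex.cost]) fun _ h => h
    have : t < 3 := by omega
    simp [Ex.eval, h4, this] at h0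
  revert hch hw
  cases hnd : I.node i with
  | var k =>
    intro _ hw
    simp only [Node.words, List.cons.injEq, and_true] at hw
    exact leaf 0 (by simp) hw.1.symm
  | zero =>
    intro _ hw
    simp only [Node.words, List.cons.injEq, and_true] at hw
    exact leaf 1 (by simp) hw.1.symm
  | one =>
    intro _ hw
    simp only [Node.words, List.cons.injEq, and_true] at hw
    exact leaf 2 (by simp) hw.1.symm
  | neg a =>
    intro hch hw
    simp only [Node.words, List.cons.injEq, and_true] at hw
    simp only [Node.children, List.mem_singleton, forall_eq] at hch
    obtain ⟨h4, h5, -⟩ := hw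
    refine (Cmd.Run.ite (T := 800) (ok 3 (by simp)) (fun h0 => ?_) fun _ =>
      (Cmd.Run.ite (T := 400) (ok 4 (by simp)) (fun _ => ?_) fun h0 => ?_).imp ?_
        fun _ h => h).imp (by simp [Ex.cost]) fun _ h => h
    · simp [Ex.eval, ← h4] at h0
    · refine Cmd.Run.seq (T' := 200) <| (h.addRule (R _ _ h 5 (by simp) a h5.symm (by omega))
        (R _ _ h 5 (by simp) a h5.symm (by omega)) (L _ _ h 3 (by simp) i h3 (by omega))
        (fit _ (by omega)) (fit _ (by omega)) ⟨cr _, cr _, cl _⟩).imp le_rfl fun σ1 g1 => ?_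
      refine (g1.addRule (L _ _ g1 5 (by simp) a h5.symm (by omega))
        (L _ _ g1 5 (by simp) a h5.symm (by omega)) (R _ _ g1 3 (by simp) i h3 (by omega))
        (fit _ (by omega)) (fit _ (by simp only [List.length_cons]; omega)) ⟨cl _, cl _, cr _⟩)
    · simp [Ex.eval, ← h4] at h0
    · simp [Ex.cost]
  | and a b =>
    intro hch hw
    simp only [Node.words, List.cons.injEq, and_true] at hw
    simp only [Node.children, List.mem_cons, List.not_mem_nil, or_false, forall_eq_or_imp,
      forall_eq] at hch
    obtain ⟨h4, h5, h6⟩ := hw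
    refine (Cmd.Run.ite (T := 840) (ok 3 (by simp)) (fun h0 => ?_) fun _ =>
      (Cmd.Run.ite (T := 820) (ok 4 (by simp)) (fun h0 => ?_) fun _ =>
      (Cmd.Run.ite (T := 800) (ok 5 (by simp)) (fun _ => ?_) fun h0 => ?_).imp ?_
        fun _ h => h).imp ?_ fun _ h => h).imp (by simp [Ex.cost]) fun _ h => h
    · simp [Ex.eval, ← h4] at h0
    · simp [Ex.eval, ← h4] at h0
    · refine Cmd.Run.seq (T' := 600) <| (h.addRule (L _ _ h 5 (by simp) a h5.symm (by omega))
        (L _ _ h 5 (by simp) a h5.symm (by omega)) (L _ _ h 3 (by simp) i h3 (by omega))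
        (fit _ (by omega)) (fit _ (by omega)) ⟨cl _, cl _, cl _⟩).imp le_rfl fun σ1 g1 => ?_
      refine Cmd.Run.seq (T' := 400) <| (g1.addRule (L _ _ g1 6 (by simp) b h6.symm (by omega))
        (L _ _ g1 6 (by simp) b h6.symm (by omega)) (L _ _ g1 3 (by simp) i h3 (by omega))
        (fit _ (by omega)) (fit _ (by simp only [List.length_cons]; omega))
        ⟨cl _, cl _, cl _⟩).imp le_rfl fun σ2 g2 => ?_
      refine Cmd.Run.seq (T' := 200) <| (g2.addRule (R _ _ g2 5 (by simp) a h5.symm (by omega))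
        (R _ _ g2 6 (by simp) b h6.symm (by omega)) (R _ _ g2 3 (by simp) i h3 (by omega))
        (fit _ (by omega)) (fit _ (by simp only [List.length_cons]; omega))
        ⟨cr _, cr _, cr _⟩).imp le_rfl fun σ3 g3 => ?_
      exact (g3.addRule (R _ _ g3 6 (by simp) b h6.symm (by omega))
        (R _ _ g3 5 (by simp) a h5.symm (by omega)) (R _ _ g3 3 (by simp) i h3 (by omega))
        (fit _ (by omega)) (fit _ (by simp only [List.length_cons]; omega)) ⟨cr _, cr _, cr _⟩)
    · simp [Ex.eval, ← h4] at h0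
    · simp [Ex.cost]
    · simp [Ex.cost]
  | or a b =>
    intro hch hw
    simp only [Node.words, List.cons.injEq, and_true] at hw
    simp only [Node.children, List.mem_cons, List.not_mem_nil, or_false, forall_eq_or_imp,
      forall_eq] at hch
    obtain ⟨h4, h5, h6⟩ := hw
    refine (Cmd.Run.ite (T := 840) (ok 3 (by simp)) (fun h0 => ?_) fun _ =>
      (Cmd.Run.ite (T := 820) (ok 4 (by simp)) (fun h0 => ?_) fun _ =>
      (Cmd.Run.ite (T := 800) (ok 5 (by simp)) (fun h0 => ?_) fun _ => ?_).imp ?_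
        fun _ h => h).imp ?_ fun _ h => h).imp (by simp [Ex.cost]) fun _ h => h
    · simp [Ex.eval, ← h4] at h0
    · simp [Ex.eval, ← h4] at h0
    · simp [Ex.eval, ← h4] at h0
    · refine Cmd.Run.seq (T' := 600) <| (h.addRule (R _ _ h 5 (by simp) a h5.symm (by omega))
        (R _ _ h 5 (by simp) a h5.symm (by omega)) (R _ _ h 3 (by simp) i h3 (by omega))
        (fit _ (by omega)) (fit _ (by omega)) ⟨cr _, cr _, cr _⟩).imp le_rfl fun σ1 g1 => ?_
      refine Cmd.Run.seq (T' := 400) <| (g1.addRule (R _ _ g1 6 (by simp) b h6.symm (by omega))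
        (R _ _ g1 6 (by simp) b h6.symm (by omega)) (R _ _ g1 3 (by simp) i h3 (by omega))
        (fit _ (by omega)) (fit _ (by simp only [List.length_cons]; omega))
        ⟨cr _, cr _, cr _⟩).imp le_rfl fun σ2 g2 => ?_
      refine Cmd.Run.seq (T' := 200) <| (g2.addRule (L _ _ g2 5 (by simp) a h5.symm (by omega))
        (L _ _ g2 6 (by simp) b h6.symm (by omega)) (L _ _ g2 3 (by simp) i h3 (by omega))
        (fit _ (by omega)) (fit _ (by simp only [List.length_cons]; omega))
        ⟨cl _, cl _, cl _⟩).imp le_rfl fun σ3 g3 => ?_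
      exact (g3.addRule (L _ _ g3 6 (by simp) b h6.symm (by omega))
        (L _ _ g3 5 (by simp) a h5.symm (by omega)) (L _ _ g3 3 (by simp) i h3 (by omega))
        (fit _ (by omega)) (fit _ (by simp only [List.length_cons]; omega)) ⟨cl _, cl _, cl _⟩)
    · simp [Ex.cost]
    · simp [Ex.cost]

/-- Sets up the rules for all nodes; variable `0` holds the number of nodes. -/
def readNodes : Cmd :=
  .seq (.set 3 (.num 0)) <| .while (.lt (.var 3) (.var 0)) <|
    .seq (.set 4 (nodeEx 2 3)) <| .seq (.set 5 (nodeEx 3 3)) <| .seq (.set 6 (nodeEx 4 3)) <|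
    .seq addNodeRules <| .set 3 (.add (.var 3) (.num 1))

/-- Zeroed heads already represent the empty rule list; each round adds the rules of one node. -/
theorem Setup.Holds.readNodes (hu : u.Holds I)
    (hch : ∀ i < I.nodes.length, ∀ j ∈ (I.node i).children, j < i) (h0 : σ.V 0 = I.nodes.length)
    (h21 : σ.V 21 = 0) (h4 : ∀ x, σ.A 4 x = 0) :
    OL.readNodes.Run u σ (1000 * I.nodes.length + 10) fun σ' =>
      Links σ'.A (I.rules I.nodes.length) ∧ (∀ v, v ≠ 21 → v ∉ Set.Icc 3 6 → σ'.V v = σ.V v) ∧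
      σ'.A 3 = σ.A 3 ∧ σ'.A 6 = σ.A 6 := by
  have h1 := hu.lt
  have h2 : I.N = 2 * I.nodes.length + 2 := rfl
  refine Cmd.Run.imp (.seq <| .set (by simp [Ex.Ok]) <|
    .while (n := 1000 * I.nodes.length) (fun σ' n => ∃ i, i ≤ I.nodes.length ∧
      n = 1000 * (I.nodes.length - i) ∧ σ'.V 3 = i ∧ Links σ'.A (I.rules i) ∧
      σ'.V 21 = (I.rules i).length ∧ (∀ v, v ≠ 21 → v ∉ Set.Icc 3 6 → σ'.V v = σ.V v) ∧
      σ'.A 3 = σ.A 3 ∧ σ'.A 6 = σ.A 6) ?_ ?_ ?_ ?_) ?_ fun _ h => h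
  · refine ⟨0, by simp, by simp, by simp [Ex.eval], ⟨trivial, h4⟩, by simp [h21, Input.rules],
      fun v _ hv => ?_, rfl, rfl⟩
    have h3' : v ≠ 3 := by rintro rfl; simp at hv
    simp [h3']
  · simp [Ex.Ok]
  · rintro σ' n ⟨i, hi, -, hV, hl, -, hv, h3, h6⟩ hz
    have : i = I.nodes.length := by
      by_contra hne
      have : i < I.nodes.length := by omega
      simp [Ex.eval, hV, hv 0, h0, this] at hz
    subst this
    exact ⟨hl, hv, h3, h6⟩
  · rintro σ' n ⟨i, hi, rfl, hV, hl, h21, hv, h3, h6⟩ hz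
    have hi' : i < I.nodes.length := by
      by_contra hne
      simp [Ex.eval, hV, hv 0, h0, hne] at hz
    refine ⟨12 + (12 + (12 + (900 + 20))), ?_⟩
    refine Cmd.Run.seq <| (Cmd.Run.set (hu.nodeEx_ok (by omega) (by simp)) ?_).imp
      (by simp [Ex.cost, nodeEx]) fun _ h => h
    refine Cmd.Run.seq <| (Cmd.Run.set (hu.nodeEx_ok (by simpa [hV] using hi') (by simp)) ?_).imp
      (by simp [Ex.cost, nodeEx]) fun _ h => h
    refine Cmd.Run.seq <| (Cmd.Run.set (hu.nodeEx_ok (by simpa [hV] using hi') (by simp)) ?_).imp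
      (by simp [Ex.cost, nodeEx]) fun _ h => h
    simp only [nodeEx, Ex.eval, Env.setV_V, hV, Function.update_of_ne (show 3 ≠ 4 by simp),
      Function.update_of_ne (show 3 ≠ 5 by simp)]
    have add := hu.addNodeRules (σ := ((σ'.setV 4 (u.inp (2 + 3 * i))).setV 5
      (u.inp (3 + 3 * i))).setV 6 (u.inp (4 + 3 * i))) hi' (hch i hi') (by simp [hV])
      (by simpa using hu.node i hi') (I.length_rules_le i)
      ⟨hl, by simpa using h21, fun _ _ => rfl, rfl, rfl⟩
    refine Cmd.Run.seq <| add.imp le_rfl fun σ2 g => ?_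
    have hV2 : σ2.V 3 = i := by simp [g.frame 3, hV]
    have ok : (Ex.add (.var 3) (.num 1)).Ok u σ2 := by
      refine ⟨trivial, u.one_lt, ?_⟩
      simp only [Ex.eval, hV2]
      omega
    refine (Cmd.Run.set ok ⟨_, ⟨i + 1, hi', rfl, by simp [Ex.eval, hV2], g.links,
      by simpa [Input.rules] using g.count, fun v h21 hv' => ?_, ?_, ?_⟩, ?_⟩).imp (by simp [Ex.cost]) fun _ h => h
    · have h3' : v ≠ 3 := by rintro rfl; simp at hv'
      have h4' : v ≠ 4 := by rintro rfl; simp at hv'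
      have h5' : v ≠ 5 := by rintro rfl; simp at hv'
      have h6' : v ≠ 6 := by rintro rfl; simp at hv'
      simp [h3', h4', h5', h6', g.frame v h21, hv v h21 hv']
    · simp [g.ax, h3]
    · simp [g.mark, h6]
    · simp only [Ex.cost]
      omega
  · simp only [Ex.cost]
    omega

end OL

namespace OL

variable {u : Setup} {σ : Env} {I : Input}

/-! #### The axioms -/

/-- Among the first `n` axioms there is one that consists of the dual of the annotated formula with
code `x`. -/
def Input.DualAx (I : Input) (n x : ℕ) : Prop :=
  ∃ j < n, ∃ p : Side × ℕ, ((I.axm j).1 = some p ∨ (I.axm j).2 = some p) ∧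
    x = code (p.1.dual, p.2)

/-- Reads a slot of an axiom, whose address is in the variable `4`. -/
def readAxSlot : Cmd :=
  -- With side word `s`, `1` for left and `2` for right, `2 * i + 2 - s` is the code of the dual
  -- annotation.
  .ite (.inp (.var 4)) (.put 3 (.sub (.add (.mul (.num 2) (.inp (.add (.var 4) (.num 1)))) (.num 2))
    (.inp (.var 4))) (.num 1)) .skip

theorem Setup.Holds.readAxSlot (hu : u.Holds I) {x : Slot} {a : ℕ} (h4 : σ.V 4 = a)
    (ha : a + 1 < u.base) (hx : x.words = [u.inp a, u.inp (a + 1)])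
    (hp : ∀ p, x = some p → p.2 < I.nodes.length) :
    OL.readAxSlot.Run u σ 40 fun σ' => σ'.V = σ.V ∧ (∀ k ≠ 3, σ'.A k = σ.A k) ∧
      ∀ y, σ'.A 3 y ≠ 0 ↔ σ.A 3 y ≠ 0 ∨ ∃ p, x = some p ∧ y = code (p.1.dual, p.2) := by
  have h1 := hu.lt
  have h2 : I.N = 2 * I.nodes.length + 2 := rfl
  have ok : (Ex.inp (.var 4)).Ok u σ := ⟨trivial, by simp only [Ex.eval, h4]; omega⟩
  refine (Cmd.Run.ite (T := 35) ok (fun h0 => ?_) fun h0 => ?_).imp (by simp [Ex.cost])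
    fun _ h => h
  · simp only [Ex.eval, h4] at h0
    obtain ⟨p, rfl, hlt, hcode, hsmall⟩ : ∃ p, x = some p ∧ p.2 < I.nodes.length ∧
        2 * u.inp (a + 1) + 2 - u.inp a = code (p.1.dual, p.2) ∧ u.inp (a + 1) = p.2 := by
      rcases x with _ | ⟨_ | _, i⟩
      · simp only [Slot.words, List.cons.injEq, and_true] at hx
        exact absurd hx.1.symm h0
      · simp only [Slot.words, List.cons.injEq, and_true] at hx
        refine ⟨_, rfl, hp _ rfl, ?_, hx.2.symm⟩
        rw [← hx.1, ← hx.2]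
        simp only [Side.dual, code]
        omega
      · simp only [Slot.words, List.cons.injEq, and_true] at hx
        refine ⟨_, rfl, hp _ rfl, ?_, hx.2.symm⟩
        rw [← hx.1, ← hx.2]
        simp only [Side.dual, code]
        omega
    have hle : code (p.1.dual, p.2) ≤ I.N * I.N := by
      have : code (p.1.dual, p.2) ≤ 2 * p.2 + 1 := by cases p.1.dual <;> simp [code]
      omega
    have ev : (Ex.sub (.add (.mul (.num 2) (.inp (.add (.var 4) (.num 1)))) (.num 2))
        (.inp (.var 4))).eval u σ = code (p.1.dual, p.2) := by
      simp only [Ex.eval, h4, hcode]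
    refine (Cmd.Run.put ?_ ?_ (by simp) ?_ ⟨rfl, fun k hk => by simp [hk], fun y => ?_⟩).imp
      (by simp [Ex.cost]) fun _ h => h
    · simp only [Ex.Ok, Ex.eval, h4, true_and, hsmall]
      omega
    · exact u.one_lt
    · rw [ev]
      exact hu.fits.mono hle
    · rw [ev]
      by_cases hy : y = code (p.1.dual, p.2)
      · simp [hy, Ex.eval]
      · simp [hy]
  · simp only [Ex.eval, h4] at h0
    have : x = none := by
      rcases x with _ | ⟨_ | _, i⟩
      · rfl
      all_goals
        simp only [Slot.words, List.cons.injEq, and_true] at hx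
        rw [← hx.1] at h0
        simp at h0
    subst this
    exact (Cmd.Run.skip ⟨rfl, fun _ _ => rfl, by simp⟩).imp (by simp) fun _ h => h

/-- Reads the axioms; variables `0` and `1` hold the numbers of nodes and of axioms. -/
def readAxs : Cmd :=
  .seq (.set 3 (.num 0)) <| .while (.lt (.var 3) (.var 1)) <|
    .seq (.set 4 (.add (.add (.num 6) (.mul (.num 3) (.var 0))) (.mul (.num 4) (.var 3)))) <|
    .seq readAxSlot <| .seq (.set 4 (.add (.var 4) (.num 2))) <| .seq readAxSlot <|
    .set 3 (.add (.var 3) (.num 1))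

/-- Both slots are marked. For a singleton axiom this is harmless, since two filled slots denote the
same annotated formula even if their pointers differ. -/
theorem Setup.Holds.readAxs (hu : u.Holds I)
    (hp : ∀ i < I.axs.length, ∀ p, (I.axm i).1 = some p ∨ (I.axm i).2 = some p →
      p.2 < I.nodes.length)
    (h0 : σ.V 0 = I.nodes.length) (h1 : σ.V 1 = I.axs.length) (hA : ∀ x, σ.A 3 x = 0) :
    OL.readAxs.Run u σ (200 * I.axs.length + 10) fun σ' =>
      (∀ v, v ∉ Set.Icc 3 4 → σ'.V v = σ.V v) ∧ (∀ k ≠ 3, σ'.A k = σ.A k) ∧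
      ∀ x, σ'.A 3 x ≠ 0 ↔ I.DualAx I.axs.length x := by
  have hlt := hu.lt
  have hb := hu.base
  refine Cmd.Run.imp (.seq <| .set (by simp [Ex.Ok]) <|
    .while (n := 200 * I.axs.length) (fun σ' n => ∃ i, i ≤ I.axs.length ∧
      n = 200 * (I.axs.length - i) ∧ σ'.V 3 = i ∧ (∀ v, v ∉ Set.Icc 3 4 → σ'.V v = σ.V v) ∧
      (∀ k ≠ 3, σ'.A k = σ.A k) ∧ ∀ x, σ'.A 3 x ≠ 0 ↔ I.DualAx i x) ?_ ?_ ?_ ?_) ?_ fun _ h => h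
  · refine ⟨0, by simp, by simp, by simp [Ex.eval], fun v hv => ?_, fun _ _ => rfl, fun x => ?_⟩
    · have h3' : v ≠ 3 := by rintro rfl; simp at hv
      simp [h3']
    · simp [hA, Input.DualAx]
  · simp [Ex.Ok]
  · rintro σ' n ⟨i, hi, -, hV, hv, hk, hx⟩ hz
    have : i = I.axs.length := by
      by_contra hne
      have : i < I.axs.length := by omega
      simp [Ex.eval, hV, hv 1, h1, this] at hz
    subst this
    exact ⟨hv, hk, hx⟩
  · rintro σ' n ⟨i, hi, rfl, hV, hv, hk, hx⟩ hz
    have hi' : i < I.axs.length := by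
      by_contra hne
      simp [Ex.eval, hV, hv 1, h1, hne] at hz
    have hV0 : σ'.V 0 = I.nodes.length := by rw [hv 0 (by simp), h0]
    refine ⟨16 + (40 + (16 + (40 + 16))), ?_⟩
    have ok : (Ex.add (.add (.num 6) (.mul (.num 3) (.var 0))) (.mul (.num 4) (.var 3))).Ok u σ' := by
      simp only [Ex.Ok, Ex.eval, hV, hV0, true_and]
      omega
    refine Cmd.Run.seq <| (Cmd.Run.set ok ?_).imp (by simp [Ex.cost]) fun _ h => h
    simp only [Ex.eval, hV, hV0]
    set a := 6 + 3 * I.nodes.length + 4 * i with ha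
    have s1 := hu.readAxSlot (σ := σ'.setV 4 a) (x := (I.axm i).1) (a := a) (by simp) (by omega)
      (hu.axm₁ i hi') fun p hp' => hp i hi' p (.inl hp')
    refine Cmd.Run.seq <| s1.imp le_rfl fun σ1 ⟨v1, k1, x1⟩ => ?_
    have ok2 : (Ex.add (.var 4) (.num 2)).Ok u σ1 := by
      simp only [Ex.Ok, Ex.eval, v1, Env.setV_V, Function.update_self, true_and]
      omega
    have ev2 : (Ex.add (.var 4) (.num 2)).eval u σ1 = a + 2 := by simp [Ex.eval, v1]
    refine Cmd.Run.seq <| (Cmd.Run.set ok2 ?_).imp (by simp [Ex.cost]) fun _ h => h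
    rw [ev2]
    have s2 := hu.readAxSlot (σ := σ1.setV 4 (a + 2)) (x := (I.axm i).2) (a := a + 2) (by simp)
      (by omega) (hu.axm₂ i hi') fun p hp' => hp i hi' p (.inr hp')
    refine Cmd.Run.seq <| s2.imp le_rfl fun σ2 ⟨v2, k2, x2⟩ => ?_
    have hV2 : σ2.V 3 = i := by simp [v2, v1, hV]
    have ok3 : (Ex.add (.var 3) (.num 1)).Ok u σ2 := by
      refine ⟨trivial, u.one_lt, ?_⟩
      simp only [Ex.eval, hV2]
      omega
    refine (Cmd.Run.set ok3 ⟨_, ⟨i + 1, hi', rfl, by simp [Ex.eval, hV2], fun v hv' => ?_,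
      fun k hk' => ?_, fun x => ?_⟩, ?_⟩).imp (by simp [Ex.cost]) fun _ h => h
    · have h3' : v ≠ 3 := by rintro rfl; simp at hv'
      have h4' : v ≠ 4 := by rintro rfl; simp at hv'
      simp [h3', h4', v2, v1, hv v hv']
    · simp [k2 k hk', k1 k hk', hk k hk']
    · rw [Env.setV_A, x2, Env.setV_A, x1, Env.setV_A, hx]
      constructor
      · rintro ((⟨j, hj, p, hj', h⟩ | ⟨p, hp', h⟩) | ⟨p, hp', h⟩)
        · exact ⟨j, by omega, p, hj', h⟩
        · exact ⟨i, by omega, p, .inl hp', h⟩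
        · exact ⟨i, by omega, p, .inr hp', h⟩
      · rintro ⟨j, hj, p, hj', h⟩
        rcases Nat.lt_succ_iff_lt_or_eq.1 hj with hj | rfl
        · exact .inl (.inl ⟨j, hj, p, hj', h⟩)
        · rcases hj' with hj' | hj'
          · exact .inl (.inr ⟨p, hj', h⟩)
          · exact .inr ⟨p, hj', h⟩
    · simp only [Ex.cost]
      omega
  · simp only [Ex.cost]
    omega

/-! #### The initial pairs -/

/-- The queue contains the instances of the rules without premises at the first `n` nodes. -/
structure Input.Seeded (I : Input) (n : ℕ) (q : List (ℕ × ℕ)) : Prop where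
  zero : ∀ i < n, I.node i = .zero → (2 * i, 2 * i) ∈ q
  one : ∀ i < n, I.node i = .one → (2 * i + 1, 2 * i + 1) ∈ q
  -- Sharing is not required, so one variable may sit at many nodes and all these pairs are needed.
  var : ∀ i < n, ∀ j < I.nodes.length, ∀ k, I.node i = .var k → I.node j = .var k →
    (2 * i, 2 * j + 1) ∈ q

theorem Input.Seeded.mono {n : ℕ} {q q' : List (ℕ × ℕ)} (h : I.Seeded n q) (hq : q ⊆ q') :
    I.Seeded n q' :=
  ⟨fun i hi e => hq (h.zero i hi e), fun i hi e => hq (h.one i hi e),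
    fun i hi j hj k e e' => hq (h.var i hi j hj k e e')⟩

/-- For the variable at the node `i` marks the pairs with all nodes with the same variable. Variable
`3` holds `i`. -/
def seedVar : Cmd :=
  .seq (.set 5 (nodeEx 3 3)) <| .seq (.set 4 (.num 0)) <| .while (.lt (.var 4) (.var 0)) <|
    .seq (.ite (nodeEx 2 4) .skip
      (.ite (eqEx (.var 5) (nodeEx 3 4)) (mark (lft 3) (rgt 4)) .skip)) <|
    .set 4 (.add (.var 4) (.num 1))

variable {G : Calc} {q : List (ℕ × ℕ)}

/-- Comparison with all nodes is linear for one variable node, hence quadratic in all, within the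
total budget. -/
theorem Setup.Holds.seedVar (hu : u.Holds I) (hG : G.N = I.N) (h : Work G σ q)
    (h0 : σ.V 0 = I.nodes.length) {i k : ℕ} (h3 : σ.V 3 = i) (hi : i < I.nodes.length)
    (hk : I.node i = .var k)
    (hP : ∀ j < I.nodes.length, I.node j = .var k → G.P (2 * i) (2 * j + 1)) :
    OL.seedVar.Run u σ (300 * I.nodes.length + 30) fun σ' => ∃ q', Work G σ' q' ∧ q <+: q' ∧
      (∀ v, v ≠ 20 → v ∉ Set.Icc 4 5 → σ'.V v = σ.V v) ∧
      ∀ j < I.nodes.length, I.node j = .var k → (2 * i, 2 * j + 1) ∈ q' := by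
  have hlt := hu.lt
  have h2 : I.N = 2 * I.nodes.length + 2 := rfl
  have hf : u.Fits (G.N * G.N) := hG ▸ hu.fits
  have hwi := hu.node i hi
  rw [hk] at hwi
  simp only [Node.words, List.cons.injEq, and_true] at hwi
  refine Cmd.Run.imp (.seq <| .set (hu.nodeEx_ok (by omega) (by simp)) <|
    .seq <| .set (by simp [Ex.Ok]) <|
    .while (n := 300 * I.nodes.length) (fun σ' n => ∃ j q', j ≤ I.nodes.length ∧
      n = 300 * (I.nodes.length - j) ∧ σ'.V 4 = j ∧ σ'.V 5 = k ∧ Work G σ' q' ∧ q <+: q' ∧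
      (∀ v, v ≠ 20 → v ∉ Set.Icc 4 5 → σ'.V v = σ.V v) ∧
      ∀ b < j, I.node b = .var k → (2 * i, 2 * b + 1) ∈ q') ?_ ?_ ?_ ?_) ?_ fun _ h => h
  · refine ⟨0, q, by simp, by simp, by simp [Ex.eval], ?_, (h.setV _).setV _, List.prefix_rfl,
      fun v _ hv => ?_, by simp⟩
    · simp [Ex.eval, nodeEx, h3, ← hwi.2.1]
    · have h4' : v ≠ 4 := by rintro rfl; simp at hv
      have h5' : v ≠ 5 := by rintro rfl; simp at hv
      simp [h4', h5']
  · simp [Ex.Ok]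
  · rintro σ' n ⟨j, q', hj, -, h4, -, hw, hp, hv, hq⟩ hz
    have : j = I.nodes.length := by
      by_contra hne
      have : j < I.nodes.length := by omega
      simp [Ex.eval, h4, hv 0, h0, this] at hz
    subst this
    exact ⟨q', hw, hp, hv, hq⟩
  · rintro σ' n ⟨j, q', hj, rfl, h4, h5, hw, hp, hv, hq⟩ hz
    have hj' : j < I.nodes.length := by
      by_contra hne
      simp [Ex.eval, h4, hv 0, h0, hne] at hz
    have hwj := hu.node j hj'
    have e2 : (nodeEx 2 4).eval u σ' = u.inp (2 + 3 * j) := by simp [nodeEx, Ex.eval, h4]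
    have e3 : (nodeEx 3 4).eval u σ' = u.inp (3 + 3 * j) := by simp [nodeEx, Ex.eval, h4]
    have ok2 : (nodeEx 2 4).Ok u σ' := hu.nodeEx_ok (by omega) (by simp)
    have ok3 : (nodeEx 3 4).Ok u σ' := hu.nodeEx_ok (by omega) (by simp)
    refine ⟨260 + 20, ?_⟩
    refine Cmd.Run.seq <| Cmd.Run.imp (Q := fun σ2 => ∃ q2, Grows G σ' q' σ2 q2 ∧
      (I.node j = .var k → (2 * i, 2 * j + 1) ∈ q2)) (Cmd.Run.ite (T := 240) ok2 (fun hne => ?_)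
      fun heq => (Cmd.Run.ite (T := 200) (Ex.ok_eqEx (a := .var 5) trivial ok3) (fun hne => ?_)
      fun hne => ?_).imp ?_ fun _ h => h) ?_ fun σ2 ⟨q2, g2, m2⟩ => ?_
    · refine (Cmd.Run.skip ⟨q', .refl hw, fun hc => ?_⟩).imp (by simp) fun _ h => h
      rw [hc] at hwj
      simp only [Node.words, List.cons.injEq, and_true] at hwj
      exact absurd (e2.trans hwj.1.symm) hne
    · have hjk : I.node j = .var k := by
        rw [e2] at heq
        rw [Ex.eval_eqEx, e3] at hne
        have hk' : k = u.inp (3 + 3 * j) := by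
          by_contra hc
          simp [Ex.eval, h5, hc] at hne
        revert hwj
        cases I.node j <;> simp [Node.words, heq]
        intro hx _
        rw [hx, hk']
      refine (hw.mark hf (hu.lft ?_ hi.le) (hu.rgt h4 hj'.le) (by omega) (by omega) (hP j hj' hjk)
        (by simp [Ex.cost, OL.lft, OL.rgt])).imp le_rfl fun σ2 g2 => ⟨_, g2, fun _ => mem_ins.2 (.inr rfl)⟩
      rw [hv 3 (by simp) (by simp), h3]
    · refine (Cmd.Run.skip ⟨q', .refl hw, fun hc => ?_⟩).imp (by simp) fun _ h => h
      rw [hc] at hwj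
      simp only [Node.words, List.cons.injEq, and_true] at hwj
      rw [Ex.eval_eqEx, e3] at hne
      simp [Ex.eval, h5, ← hwj.2.1] at hne
    · simp [Ex.cost, eqEx, nodeEx]
    · simp [Ex.cost, nodeEx]
    · have hV2 : σ2.V 4 = j := by simp [g2.frame 4, h4]
      have ok : (Ex.add (.var 4) (.num 1)).Ok u σ2 := by
        refine ⟨trivial, u.one_lt, ?_⟩
        simp only [Ex.eval, hV2]
        omega
      refine (Cmd.Run.set ok ⟨_, ⟨j + 1, q2, hj', rfl, by simp [Ex.eval, hV2], ?_, g2.work.setV _,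
        hp.trans g2.pre, fun v h20 hv' => ?_, fun b hb hbk => ?_⟩, ?_⟩).imp (by simp [Ex.cost])
        fun _ h => h
      · simp [g2.frame 5, h5]
      · have h4' : v ≠ 4 := by rintro rfl; simp at hv'
        simp [h4', g2.frame v h20, hv v h20 hv']
      · rcases Nat.lt_succ_iff_lt_or_eq.1 hb with hb | rfl
        · exact g2.pre.subset (hq b hb hbk)
        · exact m2 hbk
      · simp only [Ex.cost]
        omega
  · simp only [Ex.cost, nodeEx]
    omega

/-- Marks the initial pairs. -/
def seed : Cmd :=
  -- Variable `0` holds the number of nodes, so this is the left code of the additional node: the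
  -- sequent `0^L`.
  .seq (mark (lft 0) (lft 0)) <| .seq (.set 3 (.num 0)) <| .while (.lt (.var 3) (.var 0)) <|
    .seq (.ite (nodeEx 2 3) (.ite (.lt (nodeEx 2 3) (.num 2)) (mark (lft 3) (lft 3))
      (.ite (.lt (nodeEx 2 3) (.num 3)) (mark (rgt 3) (rgt 3)) .skip)) seedVar) <|
    .set 3 (.add (.var 3) (.num 1))

theorem Setup.Holds.seed (hu : u.Holds I) (hG : G.N = I.N) (h : Work G σ q)
    (h0 : σ.V 0 = I.nodes.length) (hlast : G.P (2 * I.nodes.length) (2 * I.nodes.length))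
    (hzero : ∀ i < I.nodes.length, I.node i = .zero → G.P (2 * i) (2 * i))
    (hone : ∀ i < I.nodes.length, I.node i = .one → G.P (2 * i + 1) (2 * i + 1))
    (hvar : ∀ i < I.nodes.length, ∀ j < I.nodes.length, ∀ k, I.node i = .var k →
      I.node j = .var k → G.P (2 * i) (2 * j + 1)) :
    OL.seed.Run u σ (I.nodes.length * (300 * I.nodes.length + 400) + 300) fun σ' =>
      ∃ q', Work G σ' q' ∧ (∀ v, v ≠ 20 → v ∉ Set.Icc 3 5 → σ'.V v = σ.V v) ∧
      (2 * I.nodes.length, 2 * I.nodes.length) ∈ q' ∧ I.Seeded I.nodes.length q' := by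
  have hlt := hu.lt
  have h2 : I.N = 2 * I.nodes.length + 2 := rfl
  have hf : u.Fits (G.N * G.N) := hG ▸ hu.fits
  have cl : ∀ v, (OL.lft v).cost ≤ 20 := fun v => by simp [OL.lft, Ex.cost]
  have cr : ∀ v, (OL.rgt v).cost ≤ 20 := fun v => by simp [OL.rgt, Ex.cost]
  set c := 300 * I.nodes.length + 400 with hc
  refine Cmd.Run.imp (.seq <| (h.mark hf (hu.lft h0 le_rfl) (hu.lft h0 le_rfl) (by omega) (by omega)
    hlast ⟨cl _, cl _⟩).imp le_rfl fun σ1 g1 => .seq <| .set (by simp [Ex.Ok]) <|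
    .while (n := I.nodes.length * c) (fun σ' n => ∃ i q', i ≤ I.nodes.length ∧
      n = (I.nodes.length - i) * c ∧ σ'.V 3 = i ∧ Work G σ' q' ∧
      (∀ v, v ≠ 20 → v ∉ Set.Icc 3 5 → σ'.V v = σ.V v) ∧
      (2 * I.nodes.length, 2 * I.nodes.length) ∈ q' ∧ I.Seeded i q') ?_ ?_ ?_ ?_) ?_ fun _ h => h
  · refine ⟨0, _, by simp, by simp, by simp [Ex.eval], g1.work.setV _, fun v h20 hv => ?_,
      mem_ins.2 (.inr rfl), by constructor <;> simp⟩
    have h3' : v ≠ 3 := by rintro rfl; simp at hv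
    simp [h3', g1.frame v h20]
  · simp [Ex.Ok]
  · rintro σ' n ⟨i, q', hi, -, h3, hw, hv, hm, hs⟩ hz
    have : i = I.nodes.length := by
      by_contra hne
      have : i < I.nodes.length := by omega
      simp [Ex.eval, h3, hv 0, h0, this] at hz
    subst this
    exact ⟨q', hw, hv, hm, hs⟩
  · rintro σ' n ⟨i, q', hi, rfl, h3, hw, hv, hm, hs⟩ hz
    have hi' : i < I.nodes.length := by
      by_contra hne
      simp [Ex.eval, h3, hv 0, h0, hne] at hz
    have hwi := hu.node i hi'
    have e2 : (nodeEx 2 3).eval u σ' = u.inp (2 + 3 * i) := by simp [nodeEx, Ex.eval, h3]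
    have ok2 : (nodeEx 2 3).Ok u σ' := hu.nodeEx_ok (by omega) (by simp)
    have ok3 : ∀ k ≤ 3, (Ex.lt (nodeEx 2 3) (.num k)).Ok u σ' := fun k hk => ⟨ok2, by
      simp only [Ex.Ok]; omega⟩
    refine ⟨(300 * I.nodes.length + 360) + 20, ?_⟩
    refine Cmd.Run.seq <| Cmd.Run.imp (Q := fun σ2 => ∃ q2, Work G σ2 q2 ∧ q' <+: q2 ∧
      (∀ v, v ≠ 20 → v ∉ Set.Icc 4 5 → σ2.V v = σ'.V v) ∧ I.Seeded (i + 1) q2)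
      (Cmd.Run.ite (T := 300 * I.nodes.length + 340) ok2 (fun hne =>
      (Cmd.Run.ite (T := 300) (ok3 2 (by simp)) (fun h4 => ?_) fun h4 =>
      (Cmd.Run.ite (T := 200) (ok3 3 (by simp)) (fun h5 => ?_) fun h5 => ?_).imp ?_
      fun _ h => h).imp ?_ fun _ h => h) fun heq => ?_) ?_ fun σ2 ⟨q2, w2, p2, f2, s2⟩ => ?_
    · have hz : I.node i = .zero := by
        simp only [Ex.eval, e2] at h4
        rw [e2] at hne
        have h41 : u.inp (2 + 3 * i) = 1 := by
          by_contra hc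
          have : ¬ u.inp (2 + 3 * i) < 2 := by omega
          simp [this] at h4
        revert hwi
        cases I.node i <;> simp [Node.words, h41]
      refine (hw.mark hf (hu.lft h3 hi) (hu.lft h3 hi) (by omega) (by omega) (hzero i hi' hz)
        ⟨cl _, cl _⟩).imp (by simp) fun σ2 g2 => ⟨_, g2.work, g2.pre, fun v h20 _ => g2.frame v h20,
          ⟨fun j hj e => ?_, fun j hj e => ?_, fun j hj j' hj' k e e' => ?_⟩⟩
      all_goals rcases Nat.lt_succ_iff_lt_or_eq.1 hj with hj | rfl
      · exact g2.pre.subset (hs.zero j hj e)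
      · exact mem_ins.2 (.inr rfl)
      · exact g2.pre.subset (hs.one j hj e)
      · simp [hz] at e
      · exact g2.pre.subset (hs.var j hj j' hj' k e e')
      · simp [hz] at e
    · have hz : I.node i = .one := by
        simp only [Ex.eval, e2] at h4 h5
        have h41 : u.inp (2 + 3 * i) = 2 := by
          have h6 : ¬ u.inp (2 + 3 * i) < 2 := fun hc => by simp [hc] at h4
          by_contra hc
          have : ¬ u.inp (2 + 3 * i) < 3 := by omega
          simp [this] at h5
        revert hwi
        cases I.node i <;> simp [Node.words, h41]
      refine (hw.mark hf (hu.rgt h3 hi) (hu.rgt h3 hi) (by omega) (by omega) (hone i hi' hz)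
        ⟨cr _, cr _⟩).imp (by simp) fun σ2 g2 => ⟨_, g2.work, g2.pre, fun v h20 _ => g2.frame v h20,
          ⟨fun j hj e => ?_, fun j hj e => ?_, fun j hj j' hj' k e e' => ?_⟩⟩
      all_goals rcases Nat.lt_succ_iff_lt_or_eq.1 hj with hj | rfl
      · exact g2.pre.subset (hs.zero j hj e)
      · simp [hz] at e
      · exact g2.pre.subset (hs.one j hj e)
      · exact mem_ins.2 (.inr rfl)
      · exact g2.pre.subset (hs.var j hj j' hj' k e e')
      · simp [hz] at e
    · have h6 : ¬ u.inp (2 + 3 * i) < 3 := fun hc => by simp [Ex.eval, e2, hc] at h5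
      refine (Cmd.Run.skip ⟨q', hw, List.prefix_rfl, fun _ _ _ => rfl,
        ⟨fun j hj e => ?_, fun j hj e => ?_, fun j hj j' hj' k e e' => ?_⟩⟩).imp (by simp)
        fun _ h => h
      all_goals rcases Nat.lt_succ_iff_lt_or_eq.1 hj with hj | rfl
      · exact hs.zero j hj e
      · rw [e] at hwi
        simp only [Node.words, List.cons.injEq, and_true] at hwi
        omega
      · exact hs.one j hj e
      · rw [e] at hwi
        simp only [Node.words, List.cons.injEq, and_true] at hwi
        omega
      · exact hs.var j hj j' hj' k e e'
      · rw [e] at hwi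
        simp only [Node.words, List.cons.injEq, and_true] at hwi
        omega
    · simp [Ex.cost, nodeEx]
    · simp only [Ex.cost, nodeEx]
      omega
    · rw [e2] at heq
      obtain ⟨k, hk⟩ : ∃ k, I.node i = .var k := by
        revert hwi
        cases I.node i <;> simp [Node.words, heq]
      refine (hu.seedVar hG hw (by rw [hv 0 (by simp) (by simp), h0]) h3 hi' hk fun j hj e =>
        hvar i hi' j hj k hk e).imp (by omega) fun σ2 ⟨q2, w2, p2, f2, m2⟩ => ⟨q2, w2, p2, f2,
          ⟨fun j hj e => ?_, fun j hj e => ?_, fun j hj j' hj' k' e e' => ?_⟩⟩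
      all_goals rcases Nat.lt_succ_iff_lt_or_eq.1 hj with hj | rfl
      · exact p2.subset (hs.zero j hj e)
      · simp [hk] at e
      · exact p2.subset (hs.one j hj e)
      · simp [hk] at e
      · exact p2.subset (hs.var j hj j' hj' k' e e')
      · rw [hk] at e
        cases e
        exact m2 j' hj' e'
    · simp only [Ex.cost, nodeEx]
      omega
    · have hV2 : σ2.V 3 = i := by rw [f2 3 (by simp) (by simp), h3]
      have ok : (Ex.add (.var 3) (.num 1)).Ok u σ2 := by
        refine ⟨trivial, u.one_lt, ?_⟩
        simp only [Ex.eval, hV2]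
        omega
      refine (Cmd.Run.set ok ⟨_, ⟨i + 1, q2, hi', rfl, by simp [Ex.eval, hV2], w2.setV _,
        fun v h20 hv' => ?_, p2.subset hm, s2⟩, ?_⟩).imp (by simp [Ex.cost]) fun _ h => h
      · have h3' : v ≠ 3 := by rintro rfl; simp at hv'
        have h45 : v ∉ Set.Icc 4 5 := fun hc => hv' ⟨le_trans (by simp) hc.1, hc.2⟩
        simp [h3', f2 v h20 h45, hv v h20 hv']
      · obtain ⟨d, hd⟩ : ∃ d, I.nodes.length - i = d + 1 := ⟨I.nodes.length - i - 1, by omega⟩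
        rw [hd, show I.nodes.length - (i + 1) = d by omega, add_mul, one_mul]
        simp only [Ex.cost]
        omega
  · simp only [Ex.cost]
    omega

end OL

namespace OL

variable {u : Setup} {σ : Env} {I : Input}

/-! ### The decision procedure -/

/-- The code of a slot; an empty slot is treated as `0^R`. -/
def Input.slotCode (I : Input) : Slot → ℕ
  | none => 2 * I.nodes.length + 1
  | some p => code p

/-- Puts the code of the slot at the address `j + 3 * m` into the variable `d`, where `m` is the
number of nodes, in variable `0`. -/
def readSlot (d j : ℕ) : Cmd :=
  -- With side word `s` the code is `2 * i + s - 1`; in the other branch variable `0` yields the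
  -- right code of the additional node.
  .ite (nodeEx j 0) (.set d (.sub (.add (.mul (.num 2) (nodeEx (j + 1) 0)) (nodeEx j 0)) (.num 1)))
    (.set d (rgt 0))

theorem Setup.Holds.readSlot (hu : u.Holds I) {x : Slot} {d j : ℕ} (hj : j ≤ 4)
    (h0 : σ.V 0 = I.nodes.length)
    (hx : x.words = [u.inp (j + 3 * I.nodes.length), u.inp (j + 1 + 3 * I.nodes.length)])
    (hp : ∀ p, x = some p → p.2 < I.nodes.length) :
    (OL.readSlot d j).Run u σ 50 fun σ' => σ' = σ.setV d (I.slotCode x) := by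
  have hlt := hu.lt
  have hb := hu.base
  have h2 : I.N = 2 * I.nodes.length + 2 := rfl
  have ok : ∀ i ≤ 5, (nodeEx i 0).Ok u σ := fun i hi => by
    simp only [nodeEx, Ex.Ok, Ex.eval, h0, true_and]
    omega
  have ev : ∀ i, (nodeEx i 0).eval u σ = u.inp (i + 3 * I.nodes.length) := fun i => by
    simp [nodeEx, Ex.eval, h0]
  refine (Cmd.Run.ite (T := 30) (ok j (by omega)) (fun hne => ?_) fun heq => ?_).imp
    (by simp [Ex.cost, nodeEx]) fun _ h => h
  · rw [ev] at hne
    obtain ⟨p, rfl, hlt', hcode, hsmall⟩ : ∃ p, x = some p ∧ p.2 < I.nodes.length ∧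
        2 * u.inp (j + 1 + 3 * I.nodes.length) + u.inp (j + 3 * I.nodes.length) = code p + 1 ∧
        u.inp (j + 1 + 3 * I.nodes.length) = p.2 := by
      rcases x with _ | ⟨_ | _, i⟩ <;> simp only [Slot.words, List.cons.injEq, and_true] at hx
      · exact absurd hx.1.symm hne
      · exact ⟨_, rfl, hp _ rfl, by rw [← hx.1, ← hx.2, code], hx.2.symm⟩
      · exact ⟨_, rfl, hp _ rfl, by rw [← hx.1, ← hx.2, code], hx.2.symm⟩
    have hle : code p ≤ 2 * p.2 + 1 := by rcases p with ⟨_ | _, i⟩ <;> simp [code]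
    refine (Cmd.Run.set ?_ ?_).imp ?_ fun _ h => h
    · refine ⟨⟨⟨?_, ok _ (by omega), ?_⟩, ok _ (by omega), ?_⟩, u.one_lt⟩
      · simp only [Ex.Ok]
        omega
      · rw [ev, hsmall]
        simp only [Ex.eval]
        omega
      · simp only [Ex.eval, ev, hcode]
        omega
    · simp only [Ex.eval, ev, hcode, Nat.add_sub_cancel, Input.slotCode]
    · simp [Ex.cost, nodeEx]
  · rw [ev] at heq
    have : x = none := by
      rcases x with _ | ⟨_ | _, i⟩ <;> simp only [Slot.words, List.cons.injEq, and_true] at hx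
      · rfl
      · omega
      · omega
    subst this
    have hr := hu.rgt h0 le_rfl
    refine (Cmd.Run.set hr.ok ?_).imp (by simp [Ex.cost, OL.rgt]) fun _ h => h
    rw [hr.eval, Input.slotCode]

/-- The main program. The result is in variable `5`. -/
def decideCmd : Cmd :=
  .seq (.set 0 (.inp (.num 0))) <| .seq (.set 1 (.inp (.num 1))) <|
  .seq (.set 2 (.add (.mul (.num 2) (.var 0)) (.num 2))) <|
  .seq readNodes <| .seq readAxs <| .seq seed <| .seq saturate <|
  .seq (readSlot 3 2) <| .seq (readSlot 4 4) <| .set 5 (.get 6 (pairEx (.var 3) (.var 4)))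

def Env.blank : Env := ⟨fun _ => 0, fun _ _ => 0⟩

/-- A calculus whose rules are those that the input describes. -/
structure Input.Describes (I : Input) (G : Calc) : Prop where
  size : G.N = I.N
  rules : G.rules = I.rules I.nodes.length
  ax : ∀ x, G.ax x ↔ I.DualAx I.axs.length x
  last : G.P (2 * I.nodes.length) (2 * I.nodes.length)
  zero : ∀ i < I.nodes.length, I.node i = .zero → G.P (2 * i) (2 * i)
  one : ∀ i < I.nodes.length, I.node i = .one → G.P (2 * i + 1) (2 * i + 1)
  var : ∀ i < I.nodes.length, ∀ j < I.nodes.length, ∀ k, I.node i = .var k →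
      I.node j = .var k → G.P (2 * i) (2 * j + 1)

/-- Pointers go to nodes of the table. -/
structure Input.WellFormed (I : Input) : Prop where
  children : ∀ i < I.nodes.length, ∀ j ∈ (I.node i).children, j < i
  goal : ∀ p, I.goal.1 = some p ∨ I.goal.2 = some p → p.2 < I.nodes.length
  axs : ∀ i < I.axs.length, ∀ p, (I.axm i).1 = some p ∨ (I.axm i).2 = some p →
      p.2 < I.nodes.length

theorem Input.slotCode_lt {x : Slot} (hx : ∀ p, x = some p → p.2 < I.nodes.length) :
    I.slotCode x < I.N := by
  rcases x with _ | ⟨_ | _, i⟩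
  · simp [Input.slotCode, Input.N]
  · have := hx _ rfl
    simp only [Input.slotCode, Input.N, code]
    omega
  · have := hx _ rfl
    simp only [Input.slotCode, Input.N, code]
    omega

/-- The final queue is exposed only through closure, soundness and initial pairs. What remains to be
proved is logic and does not mention the program. -/
theorem Setup.Holds.decideCmd (hu : u.Holds I) (hI : I.WellFormed) {G : Calc}
    (hG : I.Describes G) :
    OL.decideCmd.Run u Env.blank (1000 * I.nodes.length + 200 * I.axs.length +
      I.nodes.length * (300 * I.nodes.length + 400) + 2110 * (I.N * I.N) + 600) fun σ =>
      ∃ q, G.Closed q q ∧ (∀ p ∈ q, G.P p.1 p.2) ∧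
        (2 * I.nodes.length, 2 * I.nodes.length) ∈ q ∧ I.Seeded I.nodes.length q ∧
        σ.V 5 = if (I.slotCode I.goal.1, I.slotCode I.goal.2) ∈ q then 1 else 0 := by
  have hlt := hu.lt
  have hb := hu.base
  have h2 : I.N = 2 * I.nodes.length + 2 := rfl
  have hf : u.Fits (G.N * G.N) := hG.size ▸ hu.fits
  refine Cmd.Run.imp (T := 4 + (4 + (10 + ((1000 * I.nodes.length + 10) +
    ((200 * I.axs.length + 10) + ((I.nodes.length * (300 * I.nodes.length + 400) + 300) +
    (2110 * (I.N * I.N) + (50 + (50 + 30))))))))) ?_ (by omega) fun _ h => h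
  refine Cmd.Run.seq <| (Cmd.Run.set (v := 0) (e := .inp (.num 0))
    ⟨by simp [Ex.Ok], by simp only [Ex.eval]; omega⟩ ?_).imp
    (by simp [Ex.cost]) fun _ h => h
  refine Cmd.Run.seq <| (Cmd.Run.set (v := 1) (e := .inp (.num 1))
    ⟨by simpa [Ex.Ok] using u.one_lt.ne', by simp only [Ex.eval]; omega⟩ ?_).imp
    (by simp [Ex.cost]) fun _ h => h
  simp only [Ex.eval, hu.num_nodes, hu.num_axs]
  have ok : (Ex.add (.mul (.num 2) (.var 0)) (.num 2)).Ok u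
      ((Env.blank.setV 0 I.nodes.length).setV 1 I.axs.length) := by
    simp only [Ex.Ok, Ex.eval, Env.setV_V, Function.update_self,
      Function.update_of_ne (show 0 ≠ 1 by simp), true_and]
    omega
  refine Cmd.Run.seq <| (Cmd.Run.set ok ?_).imp (by simp [Ex.cost]) fun _ h => h
  have ev : (Ex.add (.mul (.num 2) (.var 0)) (.num 2)).eval u
      ((Env.blank.setV 0 I.nodes.length).setV 1 I.axs.length) = I.N := by
    simp [Ex.eval, h2]
  rw [ev]
  set σ₀ := ((Env.blank.setV 0 I.nodes.length).setV 1 I.axs.length).setV 2 I.N with hσ₀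
  refine Cmd.Run.seq <| (hu.readNodes (σ := σ₀) hI.children (by simp [hσ₀])
    (by simp [hσ₀, Env.blank]) (by simp [hσ₀, Env.blank])).imp le_rfl
    fun σ1 ⟨l1, f1, a1, m1⟩ => ?_
  refine Cmd.Run.seq <| (hu.readAxs (σ := σ1) hI.axs (by rw [f1 0 (by simp) (by simp)]; simp [hσ₀])
    (by rw [f1 1 (by simp) (by simp)]; simp [hσ₀]) (by simp [a1, hσ₀, Env.blank])).imp le_rfl
    fun σ2 ⟨f2, a2, x2⟩ => ?_
  -- The marks of array `6` are still blank and therefore represent the empty queue.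
  have hw : Work G σ2 [] := by
    refine ⟨?_, ?_, ?_, fun x _ => by rw [x2, hG.ax], ⟨by simp, by simp, fun x _ y _ => ?_, by simp,
      by simp⟩, by simp⟩
    · rw [f2 2 (by simp), f1 2 (by simp) (by simp), hG.size]
      simp [hσ₀]
    · rw [f2 20 (by simp), f1 20 (by simp) (by simp)]
      simp [hσ₀, Env.blank]
    · rw [hG.rules]
      exact l1.congr fun k hk => a2 k (by omega)
    · rw [a2 6 (by simp), m1]
      simp [hσ₀, Env.blank]
  have v02 : σ2.V 0 = I.nodes.length := by
    rw [f2 0 (by simp), f1 0 (by simp) (by simp)]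
    simp [hσ₀]
  refine Cmd.Run.seq <| (hu.seed hG.size hw v02 hG.last hG.zero hG.one hG.var).imp le_rfl
    fun σ3 ⟨q3, w3, f3, last3, s3⟩ => ?_
  rw [← hG.size]
  refine Cmd.Run.seq <| (w3.saturate hf).imp le_rfl fun σ4 ⟨q, w4, p4, f4, c4⟩ => ?_
  have v04 : σ4.V 0 = I.nodes.length := by
    rw [f4 0 (by simp) (by simp), f3 0 (by simp) (by simp), v02]
  refine Cmd.Run.seq <| (hu.readSlot (by simp) v04 hu.goal₁ fun p hp => hI.goal p (.inl hp)).imp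
    le_rfl fun σ5 h5 => ?_
  subst h5
  refine Cmd.Run.seq <| (hu.readSlot (by simp) (by simpa using v04) hu.goal₂
    fun p hp => hI.goal p (.inr hp)).imp le_rfl fun σ6 h6 => ?_
  subst h6
  have lt1 := I.slotCode_lt (x := I.goal.1) fun p hp => hI.goal p (.inl hp)
  have lt2 := I.slotCode_lt (x := I.goal.2) fun p hp => hI.goal p (.inr hp)
  rw [← hG.size] at lt1 lt2
  have w6 := (w4.setV (v := 3) (I.slotCode I.goal.1)).setV (v := 4) (I.slotCode I.goal.2)
  have hp := Ex.Pure.pairEx (u := u) (a := .var 3) (b := .var 4)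
    (σ := (σ4.setV 3 (I.slotCode I.goal.1)).setV 4 (I.slotCode I.goal.2))
    (Ex.pure_var (by simp)) (Ex.pure_var (by simp)) w6.size lt1 lt2 hf
  have ok6 : (Ex.get 6 (pairEx (.var 3) (.var 4))).Ok u
      ((σ4.setV 3 (I.slotCode I.goal.1)).setV 4 (I.slotCode I.goal.2)) := by
    refine ⟨hp.ok, by simp, ?_⟩
    rw [hp.eval]
    exact hf.mono (pair_lt lt1 lt2).le
  refine (Cmd.Run.set ok6 ⟨q, c4, w4.sound, p4.subset last3,
    s3.mono p4.subset, ?_⟩).imp (by simp [Ex.cost, pairEx]) fun _ h => h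
  simp only [Ex.eval, hp.eval, Env.setV_V, Env.setV_A, Function.update_self]
  exact w4.queue.mark _ lt1 _ lt2

/-- Code that puts the length of the input into register `1`. -/
def startProgram : Program :=
  .seq (.instr (.const 3 0)) <| .seq (.instr (.load 5 3)) <| .seq (.instr (.const 3 1)) <|
  .seq (.instr (.load 7 3)) <| .seq (.instr (.const 3 3)) <| .seq (.instr (.mul 5 5 3)) <|
  .seq (.instr (.const 3 4)) <| .seq (.instr (.mul 7 7 3)) <| .seq (.instr (.add 1 5 7)) <|
  .seq (.instr (.const 3 6)) (.instr (.add 1 1 3))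

def decideProgram : Program :=
  -- Variable `5`, the result, lives in register `12 = 2 * 5 + 2` and is copied to register `0` by
  -- subtracting zero.
  .seq startProgram <| .seq decideCmd.compile <| .seq (.instr (.const 3 0)) (.instr (.sub 0 12 3))

/-- Apart from register `1` only the scratch registers `3`, `5`, `7` are written, and memory behind
the input is zero, so variables and arrays start blank. -/
theorem Setup.Holds.startProgram (hu : u.Holds I) (hi : u.inp = fun i => I.words.getD i 0) :
    Halts u.w OL.startProgram (State.init I.words) 11 fun s => Sim u s Env.blank := by
  have hlt := hu.lt
  have hb := hu.base
  have m0 : I.words.getD 0 0 = I.nodes.length := rfl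
  have m1 : I.words.getD 1 0 = I.axs.length := rfl
  have r : ∀ x, x ≤ u.base → x % 2 ^ u.w = x := fun x hx => Nat.mod_eq_of_lt (by omega)
  refine Halts.imp (T := 1 + (1 + (1 + (1 + (1 + (1 + (1 + (1 + (1 + (1 + 1)))))))))) (Q := fun s =>
    Sim u s Env.blank) ?_ (by simp) fun _ h => h
  refine .seq <| .instr <| .seq <| .instr <| .seq <| .instr <| .seq <| .instr <| .seq <| .instr <|
    .seq <| .instr <| .seq <| .instr <| .seq <| .instr <| .seq <| .instr <| .seq <| .instr <|
    .instr ?_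
  simp only [Instr.exec, State.set, State.init, Function.update_self, ne_eq,
    not_false_eq_true, Function.update_of_ne, Nat.reduceEqDiff, r 0 (by omega), r 1 (by omega),
    r 3 (by omega), r 4 (by omega), r 6 (by omega), m0, m1, r (I.nodes.length * 3) (by omega),
    r (I.axs.length * 4) (by omega), OfNat.one_ne_ofNat,
    r (I.nodes.length * 3 + I.axs.length * 4) (by omega),
    r (I.nodes.length * 3 + I.axs.length * 4 + 6) (by omega)]
  refine ⟨?_, fun v => ?_, fun a _ => by rw [hi], fun k _ i => ?_⟩
  · simp only [Function.update_self, hb]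
    omega
  · have h1 : 2 * v + 2 ≠ 1 := by omega
    have h3 : 2 * v + 2 ≠ 3 := by omega
    have h5 : 2 * v + 2 ≠ 5 := by omega
    have h7 : 2 * v + 2 ≠ 7 := by omega
    simp only [Function.update_of_ne h1, Function.update_of_ne h3, Function.update_of_ne h5,
      Function.update_of_ne h7, Env.blank]
  · change I.words.getD _ 0 = 0
    rw [List.getD_eq_default]
    rw [I.length_words, ← hb, Setup.addr]
    omega

theorem Input.WellFormed.decides (hI : I.WellFormed) {G : Calc} (hG : I.Describes G) {w : ℕ}
    (hw : 5000 * I.words.length ^ 2 ≤ 2 ^ w) {Q : Prop}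
    (hQ : ∀ q, G.Closed q q → (∀ p ∈ q, G.P p.1 p.2) →
      (2 * I.nodes.length, 2 * I.nodes.length) ∈ q → I.Seeded I.nodes.length q →
      ((I.slotCode I.goal.1, I.slotCode I.goal.2) ∈ q ↔ Q)) :
    decideProgram.Decides w I.words (5000 * I.words.length ^ 2) Q := by
  have hlen := I.length_words
  have h2 : I.N = 2 * I.nodes.length + 2 := rfl
  set n := I.words.length with hn
  -- The input has at least `6 + 3 * m` words for `m` nodes, which bounds the `2 * m + 2` codes; `n
  -- ≥ 6` then absorbs linear and constant terms into `n * n`.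
  have hNn : I.N * I.N ≤ n * n := Nat.mul_le_mul (by omega) (by omega)
  have hnn : 6 * n ≤ n * n := Nat.mul_le_mul_right _ (by omega)
  have hmm : I.nodes.length * (300 * I.nodes.length + 400) ≤ n * (300 * n + 400) :=
    Nat.mul_le_mul (by omega) (by omega)
  rw [show n * (300 * n + 400) = 300 * (n * n) + 400 * n by ring] at hmm
  rw [pow_two] at hw ⊢
  let u : Setup := ⟨w, n, fun i => I.words.getD i 0, by omega⟩
  have hu : u.Holds I := I.holds rfl rfl (by
    show n + 16 * (I.N * I.N) + 16 < 2 ^ w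
    omega)
  obtain ⟨t₁, ht₁, s₁, e₁, h₁⟩ := hu.startProgram rfl
  obtain ⟨t₂, ht₂, s₂, e₂, σ', hsim, q, hc, hs, hl, hseed, hV⟩ := hu.decideCmd hI hG s₁ h₁
  refine ⟨t₁ + (t₂ + (1 + 1)), by omega, _, .seq e₁ (.seq e₂ (.seq (.instr _ _) (.instr _ _))), ?_⟩
  have h5 := hsim.var 5
  have key : (Instr.exec w (Instr.exec w s₂ (.const 3 0)) (.sub 0 12 3)).reg 0 = σ'.V 5 := by
    simp [Instr.exec, State.set, ← h5]
  rw [key, hV, ← hQ q hc hs hl hseed]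
  exact ⟨fun h => if_pos h, fun h => if_neg h⟩

end OL

namespace OL

variable {I : Input} {A : Finset Sequent} {f : ℕ → Formula}

/-! ### Correctness -/

/-- The formula at a node, extended by `0` at the additional node. -/
def Input.form (I : Input) (f : ℕ → Formula) (i : ℕ) : Formula :=
  if i < I.nodes.length then f i else .zero

/-- The annotated formula with code `x`. -/
def Input.den (I : Input) (f : ℕ → Formula) (x : ℕ) : AFormula :=
  ⟨if x % 2 = 0 then .left else .right, I.form f (x / 2)⟩

theorem Input.den_left (I : Input) (f : ℕ → Formula) (i : ℕ) :
    I.den f (2 * i) = L (I.form f i) := by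
  simp [Input.den, L]

theorem Input.den_right (I : Input) (f : ℕ → Formula) (i : ℕ) :
    I.den f (2 * i + 1) = R (I.form f i) := by
  have h1 : (2 * i + 1) % 2 = 1 := by omega
  have h2 : (2 * i + 1) / 2 = i := by omega
  simp [Input.den, R, h1, h2]

theorem Input.den_code (I : Input) (f : ℕ → Formula) (p : Side × ℕ) :
    I.den f (code p) = ⟨p.1, I.form f p.2⟩ := by
  rcases p with ⟨_ | _, i⟩
  · exact I.den_left f i
  · exact I.den_right f i

theorem Input.form_of_lt (f : ℕ → Formula) {i : ℕ} (hi : i < I.nodes.length) :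
    I.form f i = f i := if_pos hi

theorem Input.form_last (I : Input) (f : ℕ → Formula) : I.form f I.nodes.length = .zero := by
  simp [Input.form]

theorem Input.getElem?_nodes {i : ℕ} (hi : i < I.nodes.length) :
    I.nodes[i]? = some (I.node i) := by
  simp [Input.node, hi]

/-- Children have smaller numbers, so they lie in the table too, where `I.form f` and `f` agree. -/
theorem Input.form_eq (hT : IsTable I.nodes f) {i : ℕ} (hi : i < I.nodes.length) :
    I.form f i = (I.node i).formula (I.form f) := by
  obtain ⟨hch, hf⟩ := hT i _ (I.getElem?_nodes hi)
  rw [I.form_of_lt f hi, hf]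
  revert hch
  cases I.node i <;> simp +contextual only [Node.children, Node.formula, List.mem_cons,
    List.not_mem_nil, or_false, forall_eq_or_imp, forall_eq, implies_true]
  · intro ha
    rw [I.form_of_lt f (by omega)]
  · intro hab
    rw [I.form_of_lt f (by omega), I.form_of_lt f (by omega)]
  · intro hab
    rw [I.form_of_lt f (by omega), I.form_of_lt f (by omega)]

/-- Provability of the sequent of two codes. -/
def Input.Prov (I : Input) (f : ℕ → Formula) (A : Finset Sequent) (x y : ℕ) : Prop :=
  Provable (A : Set Sequent) (seq (some (I.den f x)) (some (I.den f y)))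

theorem Provable.symm {A : Set Sequent} {Γ Δ : Option AFormula} (h : Provable A (seq Γ Δ)) :
    Provable A (seq Δ Γ) := seq_comm Γ Δ ▸ h

/-- The only form of cut that the algorithm performs: one premise is a singleton and leaves no
context behind. -/
theorem Provable.dual_cut {A : Set Sequent} {c : Side} {φ : Formula} {Δ : Option AFormula}
    (h : Provable A (seq none (some ⟨c, φ⟩))) (h' : Provable A (seq (some ⟨c.dual, φ⟩) Δ)) :
    Provable A (seq none Δ) := by
  cases c
  · exact (Provable.cut φ h'.symm h.symm).symm
  · exact .cut φ h h'

theorem Sequent.IsSingleton.eq_of_mem {S : Sequent} (h : S.IsSingleton) {a : AFormula}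
    (ha : a ∈ S.1) : S = seq none (some a) := by
  obtain ⟨b, rfl⟩ := h.exists_eq
  have : a = b := by simpa [seq] using ha
  rw [this]

theorem Input.swap_mem_nodeRules {i : ℕ} {nd : Node} {r : Rule} (h : r ∈ nodeRules i nd) :
    (r.2.1, r.1, r.2.2) ∈ nodeRules i nd := by
  cases nd <;> simp only [nodeRules, List.mem_cons, List.not_mem_nil, or_false] at h ⊢
  all_goals
    rcases h with rfl | rfl | rfl | rfl <;> simp

/-- Each stored rule is an introduction rule of orthologic with `y` as its context; swapping the
sides brings `y` into the position of `Γ`. -/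
theorem Input.prov_rule (hT : IsTable I.nodes f) {i : ℕ} (hi : i < I.nodes.length) {r : Rule}
    (hr : r ∈ nodeRules i (I.node i)) {y : ℕ} (h1 : I.Prov f A r.1 y)
    (h2 : I.Prov f A r.2.1 y) : I.Prov f A r.2.2 y := by
  have hform := Input.form_eq hT hi
  revert hr hform
  cases I.node i <;> simp only [nodeRules, List.mem_cons, List.not_mem_nil, or_false,
    IsEmpty.forall_iff, Node.formula]
  all_goals
    intro hr hform
    unfold Input.Prov at *
    replace h1 := h1.symm
    replace h2 := h2.symm
    apply Provable.symm
  · rcases hr with rfl | rfl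
    · simp only [Input.den_left, Input.den_right, hform] at *
      exact .rightNot h1
    · simp only [Input.den_left, Input.den_right, hform] at *
      exact .leftNot h1
  · rcases hr with rfl | rfl | rfl | rfl <;>
      simp only [Input.den_left, Input.den_right, hform] at *
    · exact .rightAnd h2 h1
    · exact .rightAnd h1 h2
    · exact .leftAnd₂ _ h1
    · exact .leftAnd₁ _ h1
  · rcases hr with rfl | rfl | rfl | rfl <;>
      simp only [Input.den_left, Input.den_right, hform] at *
    · exact .leftOr h2 h1
    · exact .leftOr h1 h2
    · exact .rightOr₂ _ h1
    · exact .rightOr₁ _ h1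

/-- What it means that the input represents the axioms and the goal, node by node. -/
structure Input.Encodes (I : Input) (f : ℕ → Formula) (A : Finset Sequent) : Prop where
  table : IsTable I.nodes f
  wf : I.WellFormed
  single : ∀ a ∈ A, a.IsSingleton
  axs : ∀ a, a ∈ A ↔ ∃ x ∈ I.axs, a = seq (x.1.denote f) (x.2.denote f)

/-- As the axiom is a singleton, any filled slot already denotes the entire sequent. -/
theorem Input.Encodes.dualAx (h : I.Encodes f A) {x : ℕ} (hx : I.DualAx I.axs.length x) :
    ∃ p : Side × ℕ, p.2 < I.nodes.length ∧ x = code (p.1.dual, p.2) ∧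
      seq none (some ⟨p.1, I.form f p.2⟩) ∈ A := by
  obtain ⟨j, hj, p, hp, rfl⟩ := hx
  have hlt := h.wf.axs j hj p hp
  refine ⟨p, hlt, rfl, ?_⟩
  have hmem : I.axm j ∈ I.axs := by
    simp [Input.axm, hj]
  have hA := (h.axs _).2 ⟨_, hmem, rfl⟩
  rw [I.form_of_lt f hlt, ← (h.single _ hA).eq_of_mem (a := ⟨p.1, f p.2⟩)]
  · exact hA
  · rcases hp with hp | hp <;> simp [seq, hp, Slot.denote]

theorem Input.Encodes.exists_dualAx (h : I.Encodes f A) {S : Sequent} (hS : S ∈ A) :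
    ∃ p : Side × ℕ, p.2 < I.nodes.length ∧ S = seq none (some ⟨p.1, I.form f p.2⟩) ∧
      I.DualAx I.axs.length (code (p.1.dual, p.2)) := by
  have hs := h.single S hS
  obtain ⟨x, hx, hSx⟩ := (h.axs S).1 hS
  obtain ⟨j, hj, hjx⟩ := List.getElem_of_mem hx
  have hax : I.axm j = x := by simp [Input.axm, hj, hjx]
  obtain ⟨p, hp⟩ : ∃ p, x.1 = some p ∨ x.2 = some p := by
    rcases h1 : x.1 with _ | p
    · rcases h2 : x.2 with _ | p
      · rw [hSx, h1, h2] at hs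
        simp [Sequent.IsSingleton, seq, Slot.denote] at hs
      · exact ⟨p, .inr rfl⟩
    · exact ⟨p, .inl rfl⟩
  have hlt := h.wf.axs j hj p (hax ▸ hp)
  refine ⟨p, hlt, ?_, j, hj, p, hax ▸ hp, rfl⟩
  rw [I.form_of_lt f hlt]
  refine hs.eq_of_mem ?_
  rw [hSx]
  rcases hp with hp | hp <;> simp [seq, hp, Slot.denote]

/-- The calculus of an input. -/
def Input.Encodes.calc (h : I.Encodes f A) : Calc where
  N := I.N
  rules := I.rules I.nodes.length
  ax := I.DualAx I.axs.length
  P := I.Prov f A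
  two_le := by simp [Input.N]
  length_le := (I.length_rules_le _).trans (by simp only [Input.N]; omega)
  lt r hr := by
    obtain ⟨i, hi, hr⟩ := (I.mem_rules r _).1 hr
    have hch := h.wf.children i hi
    revert hch hr
    cases I.node i <;> simp only [nodeRules, List.mem_cons, List.not_mem_nil, or_false,
      IsEmpty.forall_iff, Node.children, forall_eq_or_imp, forall_eq, Input.N]
    · rintro (rfl | rfl) ha <;> dsimp only <;> omega
    · rintro (rfl | rfl | rfl | rfl) ha <;> dsimp only <;> omega
    · rintro (rfl | rfl | rfl | rfl) ha <;> dsimp only <;> omega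
  swap r hr := by
    obtain ⟨i, hi, hr⟩ := (I.mem_rules r _).1 hr
    exact (I.mem_rules _ _).2 ⟨i, hi, Input.swap_mem_nodeRules hr⟩
  symm := Provable.symm
  -- The sequent of `x, x` is the singleton `x`, so this is weakening.
  full hx y := by
    unfold Input.Prov at *
    rw [seq_self] at hx
    exact .weaken _ hx.symm
  ax_rule hx hxy := by
    obtain ⟨p, -, rfl, hp⟩ := h.dualAx hx
    unfold Input.Prov at *
    rw [I.den_code] at hxy
    rw [seq_self]
    exact Provable.dual_cut (.ax hp) hxy
  rule r hr y h1 h2 := by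
    obtain ⟨i, hi, hr⟩ := (I.mem_rules r _).1 hr
    exact Input.prov_rule h.table hi hr h1 h2

theorem Input.Encodes.form_node (h : I.Encodes f A) {i : ℕ} (hi : i < I.nodes.length) {nd : Node}
    (hn : I.node i = nd) : I.form f i = nd.formula (I.form f) :=
  hn ▸ Input.form_eq h.table hi

theorem Input.Encodes.describes (h : I.Encodes f A) : I.Describes h.calc where
  size := rfl
  rules := rfl
  ax _ := Iff.rfl
  last := by
    change I.Prov f A _ _
    rw [Input.Prov, I.den_left, I.form_last, seq_self]
    exact .leftZero
  zero i hi hn := by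
    change I.Prov f A _ _
    rw [Input.Prov, I.den_left, h.form_node hi hn, seq_self]
    exact .leftZero
  one i hi hn := by
    change I.Prov f A _ _
    rw [Input.Prov, I.den_right, h.form_node hi hn, seq_self]
    exact .rightOne
  var i hi j hj k hn hn' := by
    change I.Prov f A _ _
    rw [Input.Prov, I.den_left, I.den_right, h.form_node hi hn, h.form_node hj hn']
    exact .hyp _

theorem Input.Encodes.cases (h : I.Encodes f A) {i : ℕ} (hi : i ≤ I.nodes.length) :
    i = I.nodes.length ∧ I.form f i = .zero ∨
      i < I.nodes.length ∧ I.form f i = (I.node i).formula (I.form f) := by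
  rcases hi.lt_or_eq with hi | rfl
  · exact .inr ⟨hi, Input.form_eq h.table hi⟩
  · exact .inl ⟨rfl, I.form_last f⟩

/-- Rows are filled only below `N`, but `IsOrthoframe.full` speaks of all natural numbers. Declaring
every pair with a code outside the range related makes the conditions vacuous there. -/
theorem Input.Encodes.saturated (h : I.Encodes f A) {q : List (ℕ × ℕ)} (hc : h.calc.Closed q q)
    (hl : (2 * I.nodes.length, 2 * I.nodes.length) ∈ q) (hs : I.Seeded I.nodes.length q) :
    Saturated (I.form f) I.nodes.length fun x y => x < I.N → y < I.N → (x, y) ∈ q := by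
  have lt : ∀ i, i ≤ I.nodes.length → 2 * i < I.N ∧ 2 * i + 1 < I.N := by
    intro i hi
    simp only [Input.N]
    omega
  have rule : ∀ i < I.nodes.length, ∀ c s z, (c, s, z) ∈ nodeRules i (I.node i) → c < I.N →
      s < I.N → ∀ y, (c < I.N → y < I.N → (c, y) ∈ q) → (s < I.N → y < I.N → (s, y) ∈ q) →
      z < I.N → y < I.N → (z, y) ∈ q := by
    intro i hi c s z hr hc' hs' y h1 h2 _ hy
    exact hc.rule _ ((I.mem_rules _ _).2 ⟨i, hi, hr⟩) y (h1 hc' hy) (h2 hs' hy)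
  refine ⟨⟨fun h hx hy => hc.symm _ _ (h hy hx), fun h y hx hy => hc.full _ (h hx hx) _ hy⟩,
    fun i hi j hj k hi' hj' _ _ => ?_, fun i hi hi' _ _ => ?_, fun i hi hi' _ _ => ?_,
    fun i hi φ hi' => ?_, fun i hi φ ψ hi' => ?_, fun i hi φ ψ hi' => ?_⟩
  · obtain ⟨rfl, e⟩ | ⟨hi, e⟩ := h.cases hi
    · rw [e] at hi'; cases hi'
    obtain ⟨rfl, e'⟩ | ⟨hj, e'⟩ := h.cases hj
    · rw [e'] at hj'; cases hj'
    refine hs.var i hi j hj k ?_ ?_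
    · rw [hi'] at e
      revert e
      cases I.node i <;> simp [Node.formula, eq_comm]
    · rw [hj'] at e'
      revert e'
      cases I.node j <;> simp [Node.formula, eq_comm]
  · obtain ⟨rfl, e⟩ | ⟨hi, e⟩ := h.cases hi
    -- The additional node holds `0` as well, which is why its pair was put into the queue
    -- separately.
    · exact hl
    refine hs.zero i hi ?_
    rw [hi'] at e
    revert e
    cases I.node i <;> simp [Node.formula]
  · obtain ⟨rfl, e⟩ | ⟨hi, e⟩ := h.cases hi
    · rw [e] at hi'; cases hi'
    refine hs.one i hi ?_
    rw [hi'] at e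
    revert e
    cases I.node i <;> simp [Node.formula]
  · obtain ⟨rfl, e⟩ | ⟨hi, e⟩ := h.cases hi
    · rw [e] at hi'; cases hi'
    rw [hi'] at e
    have hch := h.wf.children i hi
    have hr := rule i hi
    revert e hch hr
    cases I.node i <;> simp only [Node.formula, reduceCtorEq, IsEmpty.forall_iff, Node.children,
      List.mem_singleton, forall_eq, Formula.neg.injEq]
    rename_i a
    intro e ha hr
    obtain ⟨la, ra⟩ := lt a (by omega)
    exact ⟨a, by omega, e.symm, fun y => ⟨fun h1 => hr _ _ _ (by simp [nodeRules]) ra ra y h1 h1,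
      fun h1 => hr _ _ _ (by simp [nodeRules]) la la y h1 h1⟩⟩
  · obtain ⟨rfl, e⟩ | ⟨hi, e⟩ := h.cases hi
    · rw [e] at hi'; cases hi'
    rw [hi'] at e
    have hch := h.wf.children i hi
    have hr := rule i hi
    revert e hch hr
    cases I.node i <;> simp only [Node.formula, reduceCtorEq, IsEmpty.forall_iff, Node.children,
      List.mem_cons, List.not_mem_nil, or_false, forall_eq_or_imp, forall_eq, Formula.and.injEq]
    rename_i a b
    intro e hab hr
    obtain ⟨la, ra⟩ := lt a (by omega)
    obtain ⟨lb, rb⟩ := lt b (by omega)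
    exact ⟨a, by omega, b, by omega, e.1.symm, e.2.symm, fun y =>
      ⟨fun h1 => hr _ _ _ (by simp [nodeRules]) la la y h1 h1,
      fun h1 => hr _ _ _ (by simp [nodeRules]) lb lb y h1 h1,
      fun h1 h2 => hr _ _ _ (by simp [nodeRules]) ra rb y h1 h2⟩⟩
  · obtain ⟨rfl, e⟩ | ⟨hi, e⟩ := h.cases hi
    · rw [e] at hi'; cases hi'
    rw [hi'] at e
    have hch := h.wf.children i hi
    have hr := rule i hi
    revert e hch hr
    cases I.node i <;> simp only [Node.formula, reduceCtorEq, IsEmpty.forall_iff, Node.children,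
      List.mem_cons, List.not_mem_nil, or_false, forall_eq_or_imp, forall_eq, Formula.or.injEq]
    rename_i a b
    intro e hab hr
    obtain ⟨la, ra⟩ := lt a (by omega)
    obtain ⟨lb, rb⟩ := lt b (by omega)
    exact ⟨a, by omega, b, by omega, e.1.symm, e.2.symm, fun y =>
      ⟨fun h1 => hr _ _ _ (by simp [nodeRules]) ra ra y h1 h1,
      fun h1 => hr _ _ _ (by simp [nodeRules]) rb rb y h1 h1,
      fun h1 h2 => hr _ _ _ (by simp [nodeRules]) la lb y h1 h2⟩⟩

/-- The side and the node of a slot; an empty slot is treated as `0^R`. -/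
def Input.slotPos (I : Input) : Slot → Side × ℕ
  | none => (.right, I.nodes.length)
  | some p => p

theorem Input.code_slotPos (I : Input) (x : Slot) : code (I.slotPos x) = I.slotCode x := by
  cases x <;> rfl

/-- Adding `0^R` is weakening, and removing it is a cut with `0^L`. A goal with empty slots thus
becomes a pair of codes. -/
theorem Input.provable_slot_iff {x : Slot} (hx : ∀ p, x = some p → p.2 < I.nodes.length)
    {B : Set Sequent} {Δ : Option AFormula} :
    Provable B (seq (x.denote f) Δ) ↔
      Provable B (seq (some ⟨(I.slotPos x).1, I.form f (I.slotPos x).2⟩) Δ) := by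
  rcases x with _ | p
  · simp only [Input.slotPos, I.form_last]
    refine ⟨fun h => ?_, fun h => ?_⟩
    · exact (Provable.weaken _ h.symm).symm
    · exact (Provable.cut .zero h.symm Provable.leftZero.symm).symm
  · rw [show I.slotPos (some p) = p from rfl, I.form_of_lt f (hx p rfl)]
    rfl

theorem Input.Encodes.decides (h : I.Encodes f A) {w : ℕ}
    (hw : 5000 * I.words.length ^ 2 ≤ 2 ^ w) :
    decideProgram.Decides w I.words (5000 * I.words.length ^ 2)
      (Provable (A : Set Sequent) (seq (I.goal.1.denote f) (I.goal.2.denote f))) := by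
  refine h.wf.decides h.describes hw fun q hc hsound hl hs => ?_
  have hp1 := fun p hp => h.wf.goal p (.inl hp)
  have hp2 := fun p hp => h.wf.goal p (.inr hp)
  have hle : ∀ x : Slot, (∀ p, x = some p → p.2 < I.nodes.length) →
      (I.slotPos x).2 ≤ I.nodes.length := by
    rintro (_ | p) hp
    · exact le_rfl
    · exact (hp p rfl).le
  rw [Input.provable_slot_iff hp1, seq_comm, Input.provable_slot_iff hp2, seq_comm]
  constructor
  · intro hq
    have := hsound _ hq
    change I.Prov f A _ _ at this
    rwa [Input.Prov, ← I.code_slotPos, ← I.code_slotPos, I.den_code, I.den_code] at this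
  · intro hp
    have := (h.saturated hc hl hs).complete (fun S hS => ?_) (hle _ hp1) (hle _ hp2) hp
    · rw [I.code_slotPos, I.code_slotPos] at this
      exact this (I.slotCode_lt hp1) (I.slotCode_lt hp2)
    -- For codes in range, closure under axiom cuts is a property of the queue; the rest checks that
    -- the dual code is in range.
    · obtain ⟨p, hp, rfl, hd⟩ := h.exists_dualAx hS
      refine ⟨p.1, p.2, hp.le, rfl, fun y hT hy _ => hc.ax _ y (hT ?_ hy) hd⟩
      have : code (p.1.dual, p.2) ≤ 2 * p.2 + 1 := by cases p.1.dual <;> simp [code]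
      simp only [Input.N]
      omega

theorem Input.Represents.encodes {S : Sequent} (hA : ∀ a ∈ A, a.IsSingleton)
    (h : I.Represents A S) :
    ∃ f, I.Encodes f A ∧ S = seq (I.goal.1.denote f) (I.goal.2.denote f) := by
  obtain ⟨f, hT, hp, hS, hax⟩ := h
  refine ⟨f, ⟨hT, ⟨fun i hi => (hT i _ (I.getElem?_nodes hi)).1, hp _ (by simp),
    fun i hi => hp _ ?_⟩, hA, hax⟩, hS⟩
  simp [Input.axm, hi]

end OL

/-! ### The decision procedure and the merged axiom together -/

theorem mainTheorem5 :
    (∃ (P : OL.Program) (C : ℕ), ∀ (A : Finset OL.Sequent) (S : OL.Sequent),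
      (∀ a ∈ A, a.IsSingleton) →
      ∀ I : OL.Input, I.Represents A S →
      ∀ w : ℕ, (∀ x ∈ I.words, x < 2 ^ w) → C * I.words.length ^ 2 ≤ 2 ^ w →
        P.Decides w I.words (C * I.words.length ^ 2) (OL.Provable (A : Set OL.Sequent) S)) ∧
    (∀ A : Finset OL.Sequent, (∀ a ∈ A, a.IsSingleton) →
      ∃ b : OL.Formula, b.size ≤ 3 * ∑ a ∈ A, a.size + 1 ∧
        ∀ S : OL.Sequent, OL.Provable (A : Set OL.Sequent) S ↔
          OL.Provable {OL.seq none (some (OL.R b))} S) := by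
  refine ⟨⟨OL.decideProgram, 5000, fun A S hA I hI w _ hw => ?_⟩, OL.exists_merged_axiom⟩
  obtain ⟨f, hf, rfl⟩ := hI.encodes hA
  exact hf.decides hw
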